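/- **Setting.** Let $n\ge 1$ and let $\Theta\subset\mathbb R^n$ be compact with $0$ in its interior. Let $H$ be a separable complex Hilbert space and let $a_\theta,b_\theta$ ($\theta\in\Theta$) be non-negative sesquilinear forms on $H$ such that $(u,\tilde u)_\theta:=a_\theta(u,\tilde u)+b_\theta(u,\tilde u)$ are uniformly equivalent inner products on $H$, with norms $\|\cdot\|_\theta$. Write $s[u]:=s(u,u)$ for a form $s$. Assume that for some $L_a>0$ $$|a_{\theta_1}(u,\tilde u)-a_{\theta_2}(u,\tilde u)|\le L_a|\theta_1-\theta_2|\,\|u\|_{\theta_1}\|\tilde u\|_{\theta_1}\qquad(u,\tilde u\in H,\ \theta_1,\theta_2\in\Theta).$$ Let $V_\theta:=\{v\in H: a_\theta[v]=0\}$, let $W_\theta$ be its $(\cdot,\cdot)_\theta$-orthogonal complement, and assume: * (H1) for every $\theta\in\Theta$ there is $\nu_\theta>0$ with $a_\theta[w]\ge\nu_\theta\|w\|_\theta^2$ for all $w\in W_\theta$; * (H2) there are a closed subspace $V_\star\subset H$ and $L_\star\ge 0$ such that, with $V^\star_\theta:=V_\theta$ for $\theta\ne0$ and $V^\star_0:=V_\star$,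 one has $\inf_{v_2\in V^\star_{\theta_2}}\|v_1-v_2\|_{\theta_2}\le L_\star|\theta_1-\theta_2|\,\|v_1\|_{\theta_1}$ for all $v_1\in V^\star_{\theta_1}$, $\theta_1,\theta_2\in\Theta$; * (H3) there is $\gamma>0$ with $a_\theta[w]\ge\gamma|\theta|^2\|w\|^2_\theta$ for all $w\in W_\theta$, $\theta\in\Theta$; * (H4) there are sesquilinear maps $a_0':V_0\times H\to\mathbb C^n$ and $a_0'':V_0\times V_0\to\mathbb C^{n\times n}$ and constants $K',K''\ge0$ with $|a_\theta(v,u)-a_0'(v,u)\cdot\theta|\le K'|\theta|^2\|v\|_0\|u\|_0$ and $|a_\theta(v,\tilde v)-a_0''(v,\tilde v)\theta\cdot\theta|\le K''|\theta|^3\|v\|_0\|\tilde v\|_0$ for all $v,\tilde v\in V_0$, $u\in H$, $\theta\in\Theta$. Let $Z\subset V_0$ be a closed subspace with $V_0=V_\star\dotplus Z$ and $|(v,z)_0|\le K_Z\|v\|_0\|z\|_0$ for all $v\in V_\star$, $z\in Z$, for some $K_Z\in[0,1)$. Let $H$ be compactly and densely embedded in a separable complex Hilbert space $\mathcal H$ with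 inner product $d_0$, with $d_0[u]\le b_0[u]$ for all $u\in H$. Closures $\overline{V_0},\overline{V_\star},\overline Z$ of subspaces are taken in $\mathcal H$. For $\xi\in\mathbb R^n$ and $v\in V_0$ let $N_\xi v\in W_0$ be the unique solution of $a_0(N_\xi v,w)=-a_0'(v,w)\cdot\xi$ for all $w\in W_0$, and put $a^{\rm h}_\xi(v,\tilde v):=a_0''(v,\tilde v)\xi\cdot\xi-a_0(N_\xi v,N_\xi\tilde v)$ on $V_0$. Let * $\mathbb L_\xi$ be the self-adjoint operator in $(\overline{V_0},d_0)$ generated by the form $\mathbb S_\xi(v+z,\tilde v+\tilde z):=a^{\rm h}_\xi(z,\tilde z)+b_0(v+z,\tilde v+\tilde z)$ with form domain $V_\star\dotplus Z=V_0$; * $\mathbf B_0$ and $\mathbf B_\star$ be the self-adjoint operators in $(\overline{V_0},d_0)$ and $(\overline{V_\star},d_0)$ generated by $b_0$ with form domains $V_0$ and $V_\star$, respectively. The limit collective spectrum is $\mathrm{Sp}_0:=\overline{\bigcup_{\xi\in\mathbb R^n}\mathrm{Sp}\,\mathbb L_\xi}$. **Theorem.** 1. The eigenvalues $\lambda_0^{(k)}$,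 $1\le k$ ($k\le\dim V_0$ if $\dim V_0<\infty$), of $\mathbf B_0$, which are also those of $\mathbb L_0$, and the eigenvalues $\lambda_\star^{(k)}$, $1\le k$ ($k\le\dim V_\star$ if $\dim V_\star<\infty$), of $\mathbf B_\star$ are real and can be listed in ascending order accounting for multiplicities. One has $\lambda_0^{(k)}\le\lambda_\star^{(k)}$ for all $k$ if $\dim V_\star=\infty$, and for all $k\le\dim V_\star$ otherwise. If $Z\neq\{0\}$, then $$\mathrm{Sp}_0=\bigcup_{k=1}^\infty\big[\lambda_0^{(k)},\lambda_\star^{(k)}\big]\quad\text{if }\dim V_\star=\infty,$$ $$\mathrm{Sp}_0=\bigcup_{k=1}^N\big[\lambda_0^{(k)},\lambda_\star^{(k)}\big]\cup\big[\lambda_0^{(N+1)},+\infty\big)\quad\text{if }N:=\dim V_\star<\infty.$$ 2. Suppose in addition that $Z$ is chosen so that $b_0(z,v)=d_0(z,v)$ for all $z\in Z$, $v\in V_\star$. For real $\lambda\notin\mathrm{Sp}\,\mathbf B_\star$ let $\beta(\lambda):\overline Z\to\overline Z$ be the bounded operator $$\beta(\lambda):=\lambda I+(\lambda-1)^2\,\mathcal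 P_{\overline Z}\,(\mathbf B_\star-\lambda I)^{-1}\mathcal P_{\overline{V_\star}},$$ where $\mathcal P$ denotes $d_0$-orthogonal projections, and let $\beta_\lambda(z,\tilde z):=-b_0(z,\tilde z)+d_0(\beta(\lambda)z,\tilde z)$ on $Z$. Then $$\mathrm{Sp}_0=\big\{\lambda\in\mathbb R\setminus\mathrm{Sp}\,\mathbf B_\star:\ \beta_\lambda[z]\ge0\ \text{for some } 0\ne z\in Z\big\}\ \cup\ \mathrm{Sp}\,\mathbf B_\star .$$ -/

import Mathlib

open scoped ComplexOrder InnerProductSpace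

noncomputable section

/-! ### Non-negative sesquilinear forms

Sesquilinear forms are linear in the first and antilinear in the second argument. -/

/-- A non-negative sesquilinear form on a complex vector space: `form u u` is real and `≥ 0`
(the order on `ℂ` is the one for which `0 ≤ w` means that `w` is real and non-negative). -/
structure NonnegForm (H : Type*) [AddCommGroup H] [Module ℂ H] where
  form : H →ₗ[ℂ] H →ₗ⋆[ℂ] ℂ
  nonneg : ∀ u : H, 0 ≤ form u u

namespace NonnegForm

variable {H : Type*} [AddCommGroup H] [Module ℂ H]

theorem conj_symm (s : NonnegForm H) (u v : H) :
    (starRingEnd ℂ) (s.form u v) = s.form v u := by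
  have im0 : ∀ x : H, (s.form x x).im = 0 := fun x => ((Complex.nonneg_iff).1 (s.nonneg x)).2.symm
  have h1 := im0 (u + v)
  have h2 := im0 (u + Complex.I • v)
  simp only [map_add, LinearMap.add_apply, map_smul, LinearMap.smul_apply, LinearMap.map_smulₛₗ,
    smul_eq_mul, Complex.add_im, Complex.mul_im, Complex.I_re, Complex.I_im, Complex.conj_I,
    Complex.neg_re, Complex.neg_im, Complex.add_re, Complex.mul_re, im0] at h1 h2
  apply Complex.ext
  · simp only [Complex.conj_re]
    linarith
  · simp only [Complex.conj_im]
    linarith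

/-- The semi-inner product `⟪u, v⟫ = s(v, u)` in Mathlib's convention. -/
abbrev core (s : NonnegForm H) : PreInnerProductSpace.Core ℂ H where
  inner u v := s.form v u
  conj_inner_symm u v := s.conj_symm u v
  re_inner_nonneg u := ((Complex.nonneg_iff).1 (s.nonneg u)).1
  add_left u v w := by simp
  smul_left u v r := by simp

theorem norm_sq_le (s : NonnegForm H) (u v : H) :
    ‖s.form u v‖ ^ 2 ≤ (s.form u u).re * (s.form v v).re := by
  have h := @InnerProductSpace.Core.inner_mul_inner_self_le ℂ H _ _ _ s.core v u
  have h' : ‖s.form u v‖ * ‖s.form v u‖ ≤ (s.form v v).re * (s.form u u).re := h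
  have h3 : ‖s.form v u‖ = ‖s.form u v‖ := by rw [← s.conj_symm u v, RCLike.norm_conj]
  rw [h3] at h'
  nlinarith

theorem apply_eq_zero (s : NonnegForm H) {v : H} (hv : s.form v v = 0) (u : H) :
    s.form v u = 0 := by
  have h := s.norm_sq_le v u
  rw [hv, Complex.zero_re, zero_mul] at h
  have h2 : ‖s.form v u‖ = 0 := by nlinarith [norm_nonneg (s.form v u)]
  exact norm_eq_zero.1 h2

/-- The null space `{v | s[v] = 0}` of a non-negative form. -/
def nullSpace (s : NonnegForm H) : Submodule ℂ H where
  carrier := {v | s.form v v = 0}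
  zero_mem' := by simp
  add_mem' := by
    intro u v hu hv
    simp only [Set.mem_ofPred_eq] at hu hv ⊢
    simp [s.apply_eq_zero hu, s.apply_eq_zero hv]
  smul_mem' := by
    intro c v hv
    simp only [Set.mem_ofPred_eq] at hv ⊢
    simp [hv]

/-- The sum of two non-negative forms. -/
def add (a b : NonnegForm H) : NonnegForm H where
  form := a.form + b.form
  nonneg u := by
    simpa using add_nonneg (a.nonneg u) (b.nonneg u)

/-- The norm `s[u] ^ (1/2)` of a non-negative form. -/
def norm (s : NonnegForm H) (u : H) : ℝ := √((s.form u u).re)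

/-- The orthogonal complement of a subspace with respect to a form. -/
def orthCompl (s : NonnegForm H) (V : Submodule ℂ H) : Submodule ℂ H where
  carrier := {w | ∀ v ∈ V, s.form w v = 0}
  zero_mem' := by simp
  add_mem' := by
    intro u w hu hw v hv
    simp [hu v hv, hw v hv]
  smul_mem' := by
    intro c w hw v hv
    simp [hw v hv]

theorem norm_sq (s : NonnegForm H) (u : H) : s.norm u ^ 2 = (s.form u u).re :=
  Real.sq_sqrt ((Complex.nonneg_iff).1 (s.nonneg u)).1

theorem norm_nonneg' (s : NonnegForm H) (u : H) : 0 ≤ s.norm u := Real.sqrt_nonneg _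

theorem norm_apply_le (s : NonnegForm H) (u v : H) : ‖s.form u v‖ ≤ s.norm u * s.norm v := by
  have h := s.norm_sq_le u v
  rw [← s.norm_sq, ← s.norm_sq, ← mul_pow] at h
  exact le_of_sq_le_sq h (mul_nonneg (s.norm_nonneg' u) (s.norm_nonneg' v))

theorem re_le_add_re (a b : NonnegForm H) (u : H) :
    (a.form u u).re ≤ ((a.add b).form u u).re := by
  have := ((Complex.nonneg_iff).1 (b.nonneg u)).1
  simp [add]
  exact this

theorem norm_le_add_norm (a b : NonnegForm H) (u : H) : a.norm u ≤ (a.add b).norm u :=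
  Real.sqrt_le_sqrt (re_le_add_re a b u)

end NonnegForm

/-- A bounded non-negative form which is coercive on a closed subspace `W` of a Hilbert space is
uniquely solvable on `W` for bounded antilinear right-hand sides. -/
theorem NonnegForm.existsUnique_solution {H : Type*} [NormedAddCommGroup H]
    [InnerProductSpace ℂ H] [CompleteSpace H] (s : NonnegForm H) (W : Submodule ℂ H)
    (hW : IsClosed (W : Set H)) (C c : ℝ) (hc : 0 < c)
    (hbdd : ∀ u v : H, ‖s.form u v‖ ≤ C * ‖u‖ * ‖v‖)
    (hcoer : ∀ w ∈ W, c * ‖w‖ ^ 2 ≤ (s.form w w).re)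
    (l : H →ₗ⋆[ℂ] ℂ) (D : ℝ) (hl : ∀ u : H, ‖l u‖ ≤ D * ‖u‖) :
    ∃! w : W, ∀ x ∈ W, s.form w x = l x := by
  have : CompleteSpace W := hW.completeSpace_coe
  -- the form as an operator on `W`
  let B0 : W →ₗ⋆[ℂ] W →ₗ[ℂ] ℂ := LinearMap.mk₂'ₛₗ (starRingEnd ℂ) (RingHom.id ℂ)
    (fun u v => s.form v u) (by intros; simp) (by intros; simp) (by intros; simp)
    (by intros; simp)
  let B : W →L⋆[ℂ] W →L[ℂ] ℂ := B0.mkContinuous₂ C (by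
    intro u v
    have h := hbdd v u
    change ‖s.form v u‖ ≤ C * ‖(u : H)‖ * ‖(v : H)‖
    linarith)
  let T : W →L[ℂ] W := InnerProductSpace.continuousLinearMapOfBilin B
  have hT : ∀ u v : W, ⟪T u, v⟫_ℂ = s.form v u := fun u v =>
    InnerProductSpace.continuousLinearMapOfBilin_apply B u v
  have hlow : ∀ u : W, c * ‖u‖ ≤ ‖T u‖ := by
    intro u
    rcases eq_or_ne u 0 with rfl | hu
    · simp
    have hpos : 0 < ‖u‖ := norm_pos_iff.2 hu
    have h1 : c * ‖u‖ ^ 2 ≤ ‖T u‖ * ‖u‖ := by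
      calc c * ‖u‖ ^ 2 ≤ (s.form u u).re := hcoer u u.2
        _ ≤ ‖s.form (u : H) u‖ := Complex.re_le_norm _
        _ = ‖⟪T u, u⟫_ℂ‖ := by rw [hT]
        _ ≤ ‖T u‖ * ‖u‖ := norm_inner_le_norm _ _
    nlinarith
  have hanti : AntilipschitzWith (Real.toNNReal c⁻¹) T := by
    refine ContinuousLinearMap.antilipschitz_of_bound T fun u => ?_
    rw [Real.coe_toNNReal _ (inv_pos.2 hc).le, ← div_eq_inv_mul, le_div_iff₀ hc]
    linarith [hlow u]
  have hclosed : IsClosed (T.range : Set W) := hanti.isClosed_range T.uniformContinuous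
  have hrange : T.range = ⊤ := by
    have := hclosed.completeSpace_coe
    rw [← T.range.orthogonal_orthogonal, Submodule.eq_top_iff']
    intro v w hw
    have h0 : s.form (w : H) w = 0 := by
      rw [← hT]
      exact hw _ ⟨w, rfl⟩
    have h1 := hcoer w w.2
    rw [h0, Complex.zero_re] at h1
    have h2 : ‖(w : H)‖ ^ 2 ≤ 0 := by
      by_contra h
      push Not at h
      nlinarith [mul_pos hc h]
    have h3 : (w : H) = 0 := by
      have : ‖(w : H)‖ = 0 := by nlinarith [norm_nonneg (w : H)]
      exact norm_eq_zero.1 this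
    have h4 : w = 0 := Subtype.ext h3
    simp [h4]
  -- the right-hand side, by the Riesz representation theorem
  let l0 : W →ₗ[ℂ] ℂ :=
    { toFun := fun x => (starRingEnd ℂ) (l x)
      map_add' := by intros; simp
      map_smul' := by intros; simp }
  let l1 : W →L[ℂ] ℂ := l0.mkContinuous D (by
    intro x
    change ‖(starRingEnd ℂ) (l x)‖ ≤ D * ‖(x : H)‖
    rw [RCLike.norm_conj]
    exact hl x)
  obtain ⟨w, hw⟩ : ∃ w, T w = (InnerProductSpace.toDual ℂ W).symm l1 := by
    have : (InnerProductSpace.toDual ℂ W).symm l1 ∈ T.range := by rw [hrange]; trivial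
    exact this
  have hsol : ∀ x ∈ W, s.form w x = l x := by
    intro x hx
    have h1 : s.form x w = (starRingEnd ℂ) (l x) := by
      have := hT w ⟨x, hx⟩
      rw [hw, InnerProductSpace.toDual_symm_apply] at this
      exact this.symm
    rw [← s.conj_symm, h1, Complex.conj_conj]
  refine ⟨w, hsol, ?_⟩
  intro w' hw'
  have h0 : s.form ((w' - w : W) : H) ((w' - w : W) : H) = 0 := by
    have e1 := hw' _ (w' - w).2
    have e2 := hsol _ (w' - w).2
    have : s.form ((w' - w : W) : H) ((w' - w : W) : H)
        = s.form w' ((w' - w : W) : H) - s.form w ((w' - w : W) : H) := by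
      rw [← LinearMap.sub_apply, ← map_sub]
      rfl
    rw [this, e1, e2, sub_self]
  have h1 := hcoer _ (w' - w).2
  rw [h0, Complex.zero_re] at h1
  have h2 : ‖((w' - w : W) : H)‖ = 0 := by
    by_contra h
    have : 0 < ‖((w' - w : W) : H)‖ ^ 2 := by positivity
    nlinarith [mul_pos hc this]
  exact sub_eq_zero.1 (Subtype.ext (norm_eq_zero.1 h2))

/-! ### Operators generated by forms, their spectra and eigenvalues -/

section FormOperators

variable {Q E : Type*} [AddCommGroup Q] [Module ℂ Q] [NormedAddCommGroup E]
  [InnerProductSpace ℂ E]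

/-- The Hilbert space in which a form with form domain `Q`, placed in `E` by `j`, acts: the
closure of `j(Q)` in `E`. -/
abbrev formSpace (j : Q →ₗ[ℂ] E) : Submodule ℂ E := (LinearMap.range j).topologicalClosure

/-- The graph of the operator generated by a sesquilinear form `s` with form domain `Q`: all pairs
`(j q, f)`, with `f` in the closure of `j(Q)`, such that `s(q, q') = (f, j q')` for all `q' ∈ Q`,
where `(·,·)` is the inner product of `E` (linear in the first argument). -/
def formGraph (j : Q →ₗ[ℂ] E) (s : Q →ₗ[ℂ] Q →ₗ⋆[ℂ] ℂ) :
    Submodule ℂ (formSpace j × formSpace j) where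
  carrier := {p | ∃ q : Q, j q = p.1 ∧ ∀ q' : Q, s q q' = ⟪j q', (p.2 : E)⟫_ℂ}
  zero_mem' := ⟨0, by simp, by simp⟩
  add_mem' := by
    rintro p₁ p₂ ⟨q₁, h₁, k₁⟩ ⟨q₂, h₂, k₂⟩
    refine ⟨q₁ + q₂, by simp [h₁, h₂], fun q' => ?_⟩
    simp [k₁ q', k₂ q']
  smul_mem' := by
    rintro c p ⟨q, h, k⟩
    refine ⟨c • q, by simp [h], fun q' => ?_⟩
    simp [k q']

/-- The operator generated by the sesquilinear form `s` with form domain `Q`, as an unbounded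
operator in the closure of `j(Q)` in `E`. -/
def formOperator (j : Q →ₗ[ℂ] E) (s : Q →ₗ[ℂ] Q →ₗ⋆[ℂ] ℂ) :
    formSpace j →ₗ.[ℂ] formSpace j :=
  (formGraph j s).toLinearPMap

/-- If `j` is injective, then `formGraph` is single-valued, so it is the graph of
`formOperator`. -/
theorem formOperator_graph (j : Q →ₗ[ℂ] E) (hj : Function.Injective j)
    (s : Q →ₗ[ℂ] Q →ₗ⋆[ℂ] ℂ) : (formOperator j s).graph = formGraph j s := by
  refine Submodule.toLinearPMap_graph_eq _ ?_
  rintro ⟨u, f⟩ ⟨q, hq, hs⟩ hu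
  simp only at hq hs hu ⊢
  have hq0 : q = 0 := hj (by rw [hq, hu, map_zero]; rfl)
  have horth : ∀ x ∈ LinearMap.range j, ⟪x, (f : E)⟫_ℂ = 0 := by
    rintro _ ⟨q', rfl⟩
    rw [← hs q', hq0]
    simp
  have hclosed : IsClosed {x : E | ⟪x, (f : E)⟫_ℂ = 0} :=
    isClosed_eq (by fun_prop) continuous_const
  have hf : (f : E) ∈ {x : E | ⟪x, (f : E)⟫_ℂ = 0} :=
    closure_minimal horth hclosed f.2
  exact Subtype.ext (inner_self_eq_zero.1 hf)

end FormOperators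

section Spectrum

variable {E : Type*} [NormedAddCommGroup E] [InnerProductSpace ℂ E]

/-- `R` is the resolvent `(T - μ)⁻¹`: a bounded everywhere defined two-sided inverse. -/
def IsResolventAt (T : E →ₗ.[ℂ] E) (μ : ℂ) (R : E →L[ℂ] E) : Prop :=
  (∀ x : E, ∃ h : R x ∈ T.domain, T ⟨R x, h⟩ - μ • R x = x) ∧
    ∀ y : T.domain, R (T y - μ • (y : E)) = y

/-- The spectrum of an unbounded operator. -/
def opSpectrum (T : E →ₗ.[ℂ] E) : Set ℂ := {μ | ¬ ∃ R : E →L[ℂ] E, IsResolventAt T μ R}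

open Classical in
/-- The resolvent operator `(T - μ)⁻¹` for `μ` outside the spectrum (and `0` otherwise). -/
def opResolvent (T : E →ₗ.[ℂ] E) (μ : ℂ) : E →L[ℂ] E :=
  if h : ∃ R : E →L[ℂ] E, IsResolventAt T μ R then h.choose else 0

/-- The eigenspace `ker (T - μ)`. -/
def opEigenspace (T : E →ₗ.[ℂ] E) (μ : ℂ) : Submodule ℂ T.domain :=
  LinearMap.ker (T.toFun - μ • T.domain.subtype)

/-- The dimension of a vector space, with value `⊤` if it is infinite. -/
def edim (V : Type*) [AddCommGroup V] [Module ℂ V] : ℕ∞ := Cardinal.toENat (Module.rank ℂ V)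

/-- `ev 0 ≤ ev 1 ≤ …` (all `ev k` with `k < N`) are the eigenvalues of `T`, listed in ascending
order and repeated according to multiplicity. -/
structure IsEigenvalueList (T : E →ₗ.[ℂ] E) (N : ℕ∞) (ev : ℕ → ℝ) : Prop where
  mono : ∀ j k : ℕ, j ≤ k → (k : ℕ∞) < N → ev j ≤ ev k
  mult : ∀ μ : ℂ, {k : ℕ | (k : ℕ∞) < N ∧ (ev k : ℂ) = μ}.encard = edim (opEigenspace T μ)

end Spectrum

/-! ### The abstract problem -/

open Classical in
/-- The null spaces `V_θ = {v | a_θ[v] = 0}` for `θ ≠ 0`, continued by `V_⋆` to `θ = 0`. -/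
def starFamily {n : ℕ} {H : Type*} [AddCommGroup H] [Module ℂ H]
    (a : EuclideanSpace ℝ (Fin n) → NonnegForm H) (Vstar : Submodule ℂ H)
    (θ : EuclideanSpace ℝ (Fin n)) : Submodule ℂ H :=
  if θ = 0 then Vstar else (a θ).nullSpace

/-- The data and the standing assumptions of the abstract degenerating problem. The inner product
of `𝓗` is `d₀`, that is `d₀(u, v) = ⟪v, u⟫`. The values of `a θ` and `b θ` for `θ ∉ Θ` play no
role. -/
structure DegenerateProblem (n : ℕ) (H 𝓗 : Type*) [NormedAddCommGroup H] [InnerProductSpace ℂ H]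
    [NormedAddCommGroup 𝓗] [InnerProductSpace ℂ 𝓗] where
  /-- the parameter set -/
  Θ : Set (EuclideanSpace ℝ (Fin n))
  isCompact_Θ : IsCompact Θ
  zero_mem_interior : (0 : EuclideanSpace ℝ (Fin n)) ∈ interior Θ
  /-- the singular forms -/
  a : EuclideanSpace ℝ (Fin n) → NonnegForm H
  /-- the regular forms -/
  b : EuclideanSpace ℝ (Fin n) → NonnegForm H
  /-- `(·,·)_θ = a_θ + b_θ` are uniformly equivalent inner products of the Hilbert space `H` -/
  norm_equiv : ∃ K : ℝ, 0 < K ∧ ∀ θ ∈ Θ, ∀ u : H,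
    ‖u‖ ≤ K * ((a θ).add (b θ)).norm u ∧ ((a θ).add (b θ)).norm u ≤ K * ‖u‖
  /-- Lipschitz continuity of `a` -/
  a_lipschitz : ∃ L : ℝ, 0 < L ∧ ∀ θ₁ ∈ Θ, ∀ θ₂ ∈ Θ, ∀ u v : H,
    ‖(a θ₁).form u v - (a θ₂).form u v‖ ≤
      L * ‖θ₁ - θ₂‖ * ((a θ₁).add (b θ₁)).norm u * ((a θ₁).add (b θ₁)).norm v
  /-- (H1): the gap condition, `W_θ` being the `(·,·)_θ`-orthogonal complement of
  `V_θ = {v | a_θ[v] = 0}` -/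
  gap : ∀ θ ∈ Θ, ∃ ν : ℝ, 0 < ν ∧ ∀ w ∈ ((a θ).add (b θ)).orthCompl (a θ).nullSpace,
    ν * ((a θ).add (b θ)).norm w ^ 2 ≤ ((a θ).form w w).re
  /-- the subspace `V_⋆` -/
  Vstar : Submodule ℂ H
  isClosed_Vstar : IsClosed (Vstar : Set H)
  /-- (H2): `V_θ` for `θ ≠ 0`, continued by `V_⋆` to `θ = 0`, is Lipschitz continuous -/
  removable : ∃ L : ℝ, 0 ≤ L ∧ ∀ θ₁ ∈ Θ, ∀ θ₂ ∈ Θ, ∀ v₁ ∈ starFamily a Vstar θ₁,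
      ⨅ v₂ : starFamily a Vstar θ₂, ((a θ₂).add (b θ₂)).norm (v₁ - v₂) ≤
        L * ‖θ₁ - θ₂‖ * ((a θ₁).add (b θ₁)).norm v₁
  /-- (H3): the gap degenerates at most quadratically -/
  quadratic_gap : ∃ γ : ℝ, 0 < γ ∧ ∀ θ ∈ Θ,
    ∀ w ∈ ((a θ).add (b θ)).orthCompl (a θ).nullSpace,
      γ * ‖θ‖ ^ 2 * ((a θ).add (b θ)).norm w ^ 2 ≤ ((a θ).form w w).re
  /-- the sesquilinear map `a₀' : V₀ × H → ℂⁿ` -/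
  a₁ : (a 0).nullSpace →ₗ[ℂ] H →ₗ⋆[ℂ] (Fin n → ℂ)
  /-- the sesquilinear map `a₀'' : V₀ × V₀ → ℂⁿˣⁿ` -/
  a₂ : (a 0).nullSpace →ₗ[ℂ] (a 0).nullSpace →ₗ⋆[ℂ] Matrix (Fin n) (Fin n) ℂ
  /-- (H4), first order -/
  diff_one : ∃ K : ℝ, 0 ≤ K ∧ ∀ (v : (a 0).nullSpace) (u : H), ∀ θ ∈ Θ,
    ‖(a θ).form v u - ∑ i, a₁ v u i * (θ i : ℂ)‖ ≤
      K * ‖θ‖ ^ 2 * ((a 0).add (b 0)).norm v * ((a 0).add (b 0)).norm u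
  /-- (H4), second order -/
  diff_two : ∃ K : ℝ, 0 ≤ K ∧ ∀ v w : (a 0).nullSpace, ∀ θ ∈ Θ,
    ‖(a θ).form v w - ∑ i, ∑ j, a₂ v w i j * (θ j : ℂ) * (θ i : ℂ)‖ ≤
      K * ‖θ‖ ^ 3 * ((a 0).add (b 0)).norm v * ((a 0).add (b 0)).norm w
  /-- the defect subspace -/
  Z : Submodule ℂ H
  isClosed_Z : IsClosed (Z : Set H)
  /-- `V₀` is the direct sum of `V_⋆` and `Z` -/
  sup_eq : Vstar ⊔ Z = (a 0).nullSpace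
  inf_eq : Vstar ⊓ Z = ⊥
  /-- the sum is transversal -/
  transversal : ∃ K : ℝ, 0 ≤ K ∧ K < 1 ∧ ∀ v ∈ Vstar, ∀ z ∈ Z,
    ‖((a 0).add (b 0)).form v z‖ ≤
      K * ((a 0).add (b 0)).norm v * ((a 0).add (b 0)).norm z
  /-- the compact dense embedding of `H` into `𝓗` -/
  emb : H →L[ℂ] 𝓗
  emb_injective : Function.Injective emb
  emb_denseRange : DenseRange emb
  emb_compact : IsCompactOperator emb
  /-- `d₀[u] ≤ b₀[u]` -/
  d_le_b : ∀ u : H, ‖emb u‖ ^ 2 ≤ ((b 0).form u u).re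

namespace DegenerateProblem

variable {n : ℕ} {H 𝓗 : Type*} [NormedAddCommGroup H] [InnerProductSpace ℂ H]
  [NormedAddCommGroup 𝓗] [InnerProductSpace ℂ 𝓗] (P : DegenerateProblem n H 𝓗)

/-- `V₀ = {v | a₀[v] = 0}`. -/
abbrev V₀ : Submodule ℂ H := (P.a 0).nullSpace

/-- The inner product `(·,·)₀ = a₀ + b₀`. -/
abbrev ip₀ : NonnegForm H := (P.a 0).add (P.b 0)

/-- `W₀`, the `(·,·)₀`-orthogonal complement of `V₀`. -/
abbrev W₀ : Submodule ℂ H := P.ip₀.orthCompl P.V₀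

theorem zero_mem : (0 : EuclideanSpace ℝ (Fin n)) ∈ P.Θ := interior_subset P.zero_mem_interior

theorem exists_bound : ∃ K : ℝ, 0 < K ∧ ∀ θ ∈ P.Θ, ∀ u v : H,
    ‖(P.a θ).form u v‖ ≤ K * ‖u‖ * ‖v‖ ∧ ‖((P.a θ).add (P.b θ)).form u v‖ ≤ K * ‖u‖ * ‖v‖ := by
  obtain ⟨K, hK, h⟩ := P.norm_equiv
  refine ⟨K * K, by positivity, fun θ hθ u v => ?_⟩
  have key : ((P.a θ).add (P.b θ)).norm u * ((P.a θ).add (P.b θ)).norm v ≤ K * K * ‖u‖ * ‖v‖ := by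
    calc _ ≤ (K * ‖u‖) * (K * ‖v‖) :=
          mul_le_mul (h θ hθ u).2 (h θ hθ v).2 (NonnegForm.norm_nonneg' _ _) (by positivity)
      _ = _ := by ring
  refine ⟨?_, (NonnegForm.norm_apply_le _ u v).trans key⟩
  refine ((P.a θ).norm_apply_le u v).trans (le_trans ?_ key)
  exact mul_le_mul (NonnegForm.norm_le_add_norm _ _ _) (NonnegForm.norm_le_add_norm _ _ _)
    (NonnegForm.norm_nonneg' _ _) (NonnegForm.norm_nonneg' _ _)

theorem isClosed_W₀ : IsClosed (P.W₀ : Set H) := by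
  obtain ⟨K, hK, h⟩ := P.exists_bound
  have : (P.W₀ : Set H) = ⋂ v ∈ P.V₀, {w : H | P.ip₀.form w v = 0} := by
    ext w
    simp only [Set.mem_iInter]
    exact Iff.rfl
  rw [this]
  refine isClosed_biInter fun v _ => ?_
  let f : H →L[ℂ] ℂ := (P.ip₀.form.flip v).mkContinuous (K * ‖v‖) (fun w => by
    have := (h 0 P.zero_mem w v).2
    change ‖P.ip₀.form w v‖ ≤ _
    linarith)
  exact isClosed_eq f.continuous continuous_const

/-- The first-order form `a₀'(v, ·) · ξ` as an antilinear functional. -/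
def firstOrder (ξ : EuclideanSpace ℝ (Fin n)) (v : P.V₀) : H →ₗ⋆[ℂ] ℂ where
  toFun u := ∑ i, P.a₁ v u i * (ξ i : ℂ)
  map_add' u w := by simp [add_mul, Finset.sum_add_distrib]
  map_smul' c u := by simp [mul_assoc, Finset.mul_sum]

theorem firstOrder_bound (ξ : EuclideanSpace ℝ (Fin n)) (v : P.V₀) :
    ∃ D : ℝ, ∀ u : H, ‖P.firstOrder ξ v u‖ ≤ D * ‖u‖ := by
  obtain ⟨K, hK, hb⟩ := P.exists_bound
  obtain ⟨M, hM, hn⟩ := P.norm_equiv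
  obtain ⟨C, hC, hd⟩ := P.diff_one
  obtain ⟨t, ht, hmem⟩ : ∃ t : ℝ, 0 < t ∧ t • ξ ∈ P.Θ := by
    have hcont : Filter.Tendsto (fun t : ℝ => t • ξ) (nhdsWithin 0 (Set.Ioi 0)) (nhds 0) := by
      have : Continuous fun t : ℝ => t • ξ := by fun_prop
      have h := this.tendsto 0
      rw [zero_smul] at h
      exact h.mono_left nhdsWithin_le_nhds
    have h1 := hcont.eventually (mem_interior_iff_mem_nhds.1 P.zero_mem_interior)
    obtain ⟨t, h2, h3⟩ := (h1.and self_mem_nhdsWithin).exists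
    exact ⟨t, h3, h2⟩
  refine ⟨t⁻¹ * (K * ‖(v : H)‖ + C * ‖t • ξ‖ ^ 2 * P.ip₀.norm v * M), fun u => ?_⟩
  have h1 := hd v u _ hmem
  have h2 := (hb _ hmem v u).1
  have h3 := (hn 0 P.zero_mem u).2
  have e : ∑ i, P.a₁ v u i * (((t • ξ) i : ℝ) : ℂ) = (t : ℂ) * P.firstOrder ξ v u := by
    simp only [firstOrder, LinearMap.coe_mk, AddHom.coe_mk, Finset.mul_sum]
    refine Finset.sum_congr rfl fun i _ => ?_
    simp
    ring
  rw [e] at h1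
  have h4 : ‖(t : ℂ) * P.firstOrder ξ v u‖ ≤
      K * ‖(v : H)‖ * ‖u‖ + C * ‖t • ξ‖ ^ 2 * P.ip₀.norm v * P.ip₀.norm u := by
    have := norm_sub_norm_le ((t : ℂ) * P.firstOrder ξ v u) ((P.a (t • ξ)).form v u)
    rw [norm_sub_rev] at this
    linarith
  have h5 : C * ‖t • ξ‖ ^ 2 * P.ip₀.norm v * P.ip₀.norm u ≤
      C * ‖t • ξ‖ ^ 2 * P.ip₀.norm v * (M * ‖u‖) := by
    refine mul_le_mul_of_nonneg_left h3 ?_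
    have := P.ip₀.norm_nonneg' v
    positivity
  rw [norm_mul, Complex.norm_real, Real.norm_of_nonneg ht.le] at h4
  rw [mul_assoc, ← div_eq_inv_mul, le_div_iff₀ ht]
  linarith

/-- The linearised cell problem: for `v ∈ V₀` there is a unique `w ∈ W₀` with
`a₀(w, x) = - a₀'(v, x) · ξ` for all `x ∈ W₀`. -/
theorem existsUnique_corrector [CompleteSpace H] (ξ : EuclideanSpace ℝ (Fin n)) (v : P.V₀) :
    ∃! w : P.W₀, ∀ x ∈ P.W₀, (P.a 0).form w x = (-P.firstOrder ξ v) x := by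
  obtain ⟨K, hK, hb⟩ := P.exists_bound
  obtain ⟨M, hM, hn⟩ := P.norm_equiv
  obtain ⟨ν, hν, hg⟩ := P.gap 0 P.zero_mem
  obtain ⟨D, hD⟩ := P.firstOrder_bound ξ v
  refine (P.a 0).existsUnique_solution P.W₀ P.isClosed_W₀ K (ν / M ^ 2) (by positivity)
    (fun u w => (hb 0 P.zero_mem u w).1) (fun w hw => ?_) _ D (fun u => by simpa using hD u)
  refine le_trans ?_ (hg w hw)
  have h1 := (hn 0 P.zero_mem w).1
  rw [div_mul_eq_mul_div, div_le_iff₀ (by positivity)]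
  calc ν * ‖w‖ ^ 2 ≤ ν * (M * P.ip₀.norm w) ^ 2 := by gcongr
    _ = _ := by ring

/-- The corrector `N_ξ : V₀ → W₀`, the solution operator of the linearised cell problem
`a₀(N_ξ v, x) = - a₀'(v, x) · ξ` for all `x ∈ W₀`. -/
def corrector [CompleteSpace H] (ξ : EuclideanSpace ℝ (Fin n)) : P.V₀ →ₗ[ℂ] P.W₀ where
  toFun v := (P.existsUnique_corrector ξ v).choose
  map_add' v w := by
    refine ((P.existsUnique_corrector ξ (v + w)).choose_spec.2 _ fun x hx => ?_).symm
    have h1 := (P.existsUnique_corrector ξ v).choose_spec.1 x hx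
    have h2 := (P.existsUnique_corrector ξ w).choose_spec.1 x hx
    simp only [Submodule.coe_add, map_add, LinearMap.add_apply, h1, h2]
    simp [firstOrder, add_mul, Finset.sum_add_distrib]
    ring
  map_smul' c v := by
    refine ((P.existsUnique_corrector ξ (c • v)).choose_spec.2 _ fun x hx => ?_).symm
    have h1 := (P.existsUnique_corrector ξ v).choose_spec.1 x hx
    simp only [Submodule.coe_smul, map_smul, LinearMap.smul_apply, h1, RingHom.id_apply]
    simp [firstOrder, mul_assoc, Finset.mul_sum]

theorem corrector_spec [CompleteSpace H] (ξ : EuclideanSpace ℝ (Fin n)) (v : P.V₀) :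
    ∀ x ∈ P.W₀, (P.a 0).form (P.corrector ξ v) x = -∑ i, P.a₁ v x i * (ξ i : ℂ) :=
  (P.existsUnique_corrector ξ v).choose_spec.1

/-- The homogenised form `a^h_ξ(v, w) = a₀''(v, w) ξ · ξ - a₀(N_ξ v, N_ξ w)` on `V₀`. -/
def homForm [CompleteSpace H] (ξ : EuclideanSpace ℝ (Fin n)) : P.V₀ →ₗ[ℂ] P.V₀ →ₗ⋆[ℂ] ℂ :=
  LinearMap.mk₂'ₛₗ (RingHom.id ℂ) (starRingEnd ℂ)
    (fun v w => ∑ i, ∑ j, P.a₂ v w i j * (ξ j : ℂ) * (ξ i : ℂ) -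
      (P.a 0).form (P.corrector ξ v) (P.corrector ξ w))
    (by intros; simp [add_mul, Finset.sum_add_distrib]; ring)
    (by intros; simp [mul_assoc, Finset.mul_sum, mul_sub])
    (by intros; simp [add_mul, Finset.sum_add_distrib]; ring)
    (by intros; simp [mul_assoc, Finset.mul_sum, mul_sub])

theorem Z_le : P.Z ≤ P.V₀ := le_sup_right.trans P.sup_eq.le

/-- The operator `𝐁₀` generated by `b₀` with form domain `V₀`, in the closure of `V₀` in `𝓗`. -/
def B₀ : formSpace (P.emb.toLinearMap ∘ₗ P.V₀.subtype) →ₗ.[ℂ]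
    formSpace (P.emb.toLinearMap ∘ₗ P.V₀.subtype) :=
  formOperator _ ((P.b 0).form.domRestrict₁₂ P.V₀ P.V₀)

/-- The closure of `V_⋆` in `𝓗`. -/
abbrev Vbar : Submodule ℂ 𝓗 := formSpace (P.emb.toLinearMap ∘ₗ P.Vstar.subtype)

/-- The closure of `Z` in `𝓗`. -/
abbrev Zbar : Submodule ℂ 𝓗 := formSpace (P.emb.toLinearMap ∘ₗ P.Z.subtype)

/-- The operator `𝐁_⋆` generated by `b₀` with form domain `V_⋆`, in the closure of `V_⋆`. -/
def Bstar : P.Vbar →ₗ.[ℂ] P.Vbar :=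
  formOperator _ ((P.b 0).form.domRestrict₁₂ P.Vstar P.Vstar)

/-- The map `(v, z) ↦ v + z` from `V_⋆ × Z` to `𝓗`; it identifies the form domain `V_⋆ ∔ Z` with
`V_⋆ × Z`. -/
def sumMap : P.Vstar × P.Z →ₗ[ℂ] 𝓗 :=
  P.emb.toLinearMap ∘ₗ (P.Vstar.subtype.coprod P.Z.subtype)

/-- The form `𝕊_ξ(v + z, v' + z') = a^h_ξ(z, z') + b₀(v + z, v' + z')` on `V_⋆ ∔ Z`. -/
def limitForm [CompleteSpace H] (ξ : EuclideanSpace ℝ (Fin n)) :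
    P.Vstar × P.Z →ₗ[ℂ] P.Vstar × P.Z →ₗ⋆[ℂ] ℂ :=
  LinearMap.mk₂'ₛₗ (RingHom.id ℂ) (starRingEnd ℂ)
    (fun p q => P.homForm ξ (Submodule.inclusion P.Z_le p.2) (Submodule.inclusion P.Z_le q.2) +
      (P.b 0).form ((p.1 : H) + p.2) ((q.1 : H) + q.2))
    (by intros; simp; ring)
    (by intros; simp; ring)
    (by intros; simp; ring)
    (by intros; simp; ring)

/-- The operator `𝕃_ξ` generated by `𝕊_ξ` in the closure of `V_⋆ ∔ Z` in `𝓗`. -/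
def limitOp [CompleteSpace H] (ξ : EuclideanSpace ℝ (Fin n)) :
    formSpace P.sumMap →ₗ.[ℂ] formSpace P.sumMap :=
  formOperator P.sumMap (P.limitForm ξ)

/-- The limit collective spectrum: the closure of the union of the spectra of all `𝕃_ξ`. -/
def limitSpectrum [CompleteSpace H] : Set ℂ := closure (⋃ ξ, opSpectrum (P.limitOp ξ))

/-- An element of `Z` as an element of the closure of `Z` in `𝓗`. -/
def toZbar (z : P.Z) : P.Zbar :=
  ⟨P.emb z, Submodule.le_topologicalClosure _ ⟨z, rfl⟩⟩

/-- The operator-valued `β`-function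
`β(λ) = λ I + (λ - 1)² 𝒫_Z (𝐁_⋆ - λ I)⁻¹ 𝒫_{V_⋆}` on the closure of `Z`, for `λ` outside the
spectrum of `𝐁_⋆`; the projections are the orthogonal ones of `𝓗` onto the closures of `Z` and
`V_⋆`. -/
def betaOp [CompleteSpace 𝓗] (lam : ℝ) : P.Zbar →L[ℂ] P.Zbar :=
  (lam : ℂ) • ContinuousLinearMap.id ℂ P.Zbar +
    ((lam : ℂ) - 1) ^ 2 • (P.Zbar.orthogonalProjectionOnto ∘L P.Vbar.subtypeL ∘L
      opResolvent P.Bstar (lam : ℂ) ∘L P.Vbar.orthogonalProjectionOnto ∘L P.Zbar.subtypeL)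

/-- The form `β_λ(z, z') = - b₀(z, z') + d₀(β(λ) z, z')` on `Z`. -/
def betaForm [CompleteSpace 𝓗] (lam : ℝ) (z z' : P.Z) : ℂ :=
  -(P.b 0).form z z' + ⟪(P.toZbar z'), P.betaOp lam (P.toZbar z)⟫_ℂ

end DegenerateProblem

end

/-! Every operator here is generated by a form bounded below by `d₀` and compactly embedded. Its
spectrum is therefore a list of eigenvalues, each described by the minimax principle
(`CompactForm.opSpectrum_eq_of_list`, `CompactForm.list_le_iff`).

Along a ray `ξ = √τ η` with `η ≠ 0`, the form of `𝕃_ξ` is `b₀` plus `τ` times the homogenised form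
of the `Z`-component, hence affine and nondecreasing in `τ`. At `τ = 0` it is `b₀` on `V₀`, which
gives the lower ends of the bands. As `τ → ∞` the extra term penalises `Z` and only `V_⋆` survives:
the `k`-th eigenvalue climbs past every number below the `k`-th eigenvalue of `𝐁_⋆`, or past every
number if there is none (`exists_lt_limit`). It is continuous in `τ`, so it sweeps the interior of
the band. Minimax confines all eigenvalues to the bands, and the closure supplies upper ends that
are not attained (`limitSpectrum_eq_bands`).

The penalisation needs the homogenised form to be coercive on `Z` for `η ≠ 0` (`le_homForm_re`).
That form is the limit of `t⁻² a_{tη}[z + t N_η z]`. By (H3) this quotient controls the squared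
distance of `z + t N_η z` from `V_{tη}`; by (H2) that space lies within `O(t)` of `V_⋆`; and by
transversality `z` stays at a distance from `V_⋆` proportional to its norm.

For the `β`-function, put `q = b₀ - λ d₀`. The form `β_λ` is minus the Schur complement of `q` with
respect to `V_⋆`: its value at `z` is `-q[v + z]`, where `v ∈ V_⋆` makes `v + z` `q`-orthogonal to
`V_⋆` (`exists_schur`). If `m` eigenvalues of `𝐁_⋆` are at most `λ`, then `q ≤ 0` on an
`m`-dimensional subspace of `V_⋆`, and a nonzero `z` with `β_λ[z] ≥ 0` contributes exactly the extra
dimension that puts `λ` into the next band. The converse is the same count read backwards. -/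

open scoped ComplexOrder InnerProductSpace

noncomputable section

/-! ### Operators generated by forms with compact embedding -/

section CompactForms

variable {Q E : Type*} [AddCommGroup Q] [Module ℂ Q] [NormedAddCommGroup E]
  [InnerProductSpace ℂ E]

/-- A non-negative form `s` on `Q`, with `Q` placed in `E` by an injective map `j`, which bounds
the norm of `E`, is solvable for right-hand sides in `E`, and has sublevel sets that are totally
bounded in `E`. -/
structure CompactForm (j : Q →ₗ[ℂ] E) (s : NonnegForm Q) : Prop where
  inj : Function.Injective j
  norm_sq_le : ∀ q, ‖j q‖ ^ 2 ≤ (s.form q q).re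
  solve : ∀ f : E, ∃ q, ∀ q', s.form q q' = ⟪j q', f⟫_ℂ
  totallyBounded : ∀ r : ℝ, TotallyBounded (j '' {q | (s.form q q).re ≤ r})

/-- A family of eigenvectors `q i` of the operator generated by `s`, with eigenvalues `x i`, whose
images are an orthonormal basis of `formSpace j`. -/
structure IsEigenbasis (j : Q →ₗ[ℂ] E) (s : NonnegForm Q) {ι : Type*} (x : ι → ℝ) (q : ι → Q) :
    Prop where
  eig : ∀ i q', s.form (q i) q' = x i * ⟪j q', j (q i)⟫_ℂ
  orthonormal : Orthonormal ℂ fun i => j (q i)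
  complete : ∀ f ∈ formSpace j, (∀ i, ⟪j (q i), f⟫_ℂ = 0) → f = 0

theorem NonnegForm.ofReal_re (s : NonnegForm Q) (q : Q) :
    ((s.form q q).re : ℂ) = s.form q q :=
  Complex.ext (Complex.ofReal_re _) (Complex.nonneg_iff.1 (s.nonneg q)).2

theorem mem_formSpace (j : Q →ₗ[ℂ] E) (q : Q) : j q ∈ formSpace j :=
  Submodule.le_topologicalClosure _ ⟨q, rfl⟩

theorem eq_zero_of_mem_formSpace {j : Q →ₗ[ℂ] E} {f : E} (hf : f ∈ formSpace j)
    (h : ∀ q, ⟪j q, f⟫_ℂ = 0) : f = 0 := by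
  have hclosed : IsClosed {x : E | ⟪x, f⟫_ℂ = 0} := isClosed_eq (by fun_prop) continuous_const
  have : f ∈ {x : E | ⟪x, f⟫_ℂ = 0} :=
    closure_minimal (by rintro _ ⟨q, rfl⟩; exact h q) hclosed hf
  exact inner_self_eq_zero.1 this

namespace CompactForm

variable {j : Q →ₗ[ℂ] E} {s : NonnegForm Q}

theorem eq_zero (h : CompactForm j s) {q : Q} (hq : (s.form q q).re ≤ 0) : q = 0 := by
  have h1 := h.norm_sq_le q
  have h2 : ‖j q‖ = 0 := by nlinarith [norm_nonneg (j q)]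
  exact h.inj (by rw [norm_eq_zero.1 h2, map_zero])

theorem ext (h : CompactForm j s) {q₁ q₂ : Q} (he : ∀ q', s.form q₁ q' = s.form q₂ q') :
    q₁ = q₂ := by
  refine sub_eq_zero.1 (h.eq_zero ?_)
  rw [map_sub s.form, LinearMap.sub_apply, he, sub_self, Complex.zero_re]

/-- The solution operator `f ↦ q` of `s(q, ·) = (f, j ·)`. -/
def sol (h : CompactForm j s) : E →ₗ[ℂ] Q where
  toFun f := (h.solve f).choose
  map_add' f g := by
    refine h.ext fun q' => ?_
    rw [map_add, LinearMap.add_apply, (h.solve _).choose_spec, (h.solve _).choose_spec,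
      (h.solve _).choose_spec, inner_add_right]
  map_smul' c f := by
    refine h.ext fun q' => ?_
    rw [map_smul, LinearMap.smul_apply, (h.solve _).choose_spec, (h.solve _).choose_spec,
      inner_smul_right, RingHom.id_apply, smul_eq_mul]

theorem sol_spec (h : CompactForm j s) (f : E) (q' : Q) :
    s.form (h.sol f) q' = ⟪j q', f⟫_ℂ :=
  (h.solve f).choose_spec q'

theorem sol_unique (h : CompactForm j s) {f : E} {q : Q}
    (hq : ∀ q', s.form q q' = ⟪j q', f⟫_ℂ) : h.sol f = q := by
  exact h.ext fun q' => by rw [sol_spec, hq]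

theorem norm_sol_le (h : CompactForm j s) (f : E) : ‖j (h.sol f)‖ ≤ ‖f‖ := by
  have h1 := h.norm_sq_le (h.sol f)
  rw [sol_spec] at h1
  have h2 := (Complex.re_le_norm _).trans (norm_inner_le_norm (𝕜 := ℂ) (j (h.sol f)) f)
  by_contra hc
  push Not at hc
  nlinarith [norm_nonneg f, norm_nonneg (j (h.sol f))]

theorem form_sol_le (h : CompactForm j s) (f : E) :
    (s.form (h.sol f) (h.sol f)).re ≤ ‖f‖ ^ 2 := by
  rw [sol_spec]
  have h2 := (Complex.re_le_norm _).trans (norm_inner_le_norm (𝕜 := ℂ) (j (h.sol f)) f)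
  nlinarith [norm_nonneg f, h.norm_sol_le f]

/-- The bounded inverse of the operator generated by `s`. -/
def inv (h : CompactForm j s) : formSpace j →L[ℂ] formSpace j :=
  LinearMap.mkContinuous
    (LinearMap.codRestrict (formSpace j) (j ∘ₗ h.sol ∘ₗ (formSpace j).subtype)
      fun _ => mem_formSpace j _) 1
    fun f => by
      rw [one_mul]
      exact h.norm_sol_le f

theorem coe_inv (h : CompactForm j s) (f : formSpace j) : (h.inv f : E) = j (h.sol f) := rfl

theorem inv_injective (h : CompactForm j s) {f : formSpace j} (hf : h.inv f = 0) : f = 0 := by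
  have h1 : h.sol (f : E) = 0 := h.inj (by rw [← coe_inv, hf]; simp)
  refine Subtype.ext (eq_zero_of_mem_formSpace f.2 fun q => ?_)
  rw [← h.sol_spec, h1]
  simp

theorem inv_isSymmetric (h : CompactForm j s) :
    (h.inv : formSpace j →ₗ[ℂ] formSpace j).IsSymmetric := by
  intro f g
  change ⟪j (h.sol f), (g : E)⟫_ℂ = ⟪(f : E), j (h.sol g)⟫_ℂ
  rw [← h.sol_spec, ← s.conj_symm, h.sol_spec, inner_conj_symm]

/-- The energy of a solution is at most the square of the norm of its right-hand side, so the unit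
ball is mapped into a sublevel set of `s`. -/
theorem inv_isCompactOperator [CompleteSpace E] (h : CompactForm j s) :
    IsCompactOperator h.inv := by
  let g : formSpace j →L[ℂ] E := (formSpace j).subtypeL ∘L h.inv
  have hg : IsCompactOperator (g : formSpace j →ₗ[ℂ] E) := by
    rw [isCompactOperator_iff_image_closedBall_subset_compact _ one_pos]
    refine ⟨closure (j '' {q | (s.form q q).re ≤ 1}),
      (h.totallyBounded 1).closure.isCompact_of_isClosed isClosed_closure, ?_⟩
    rintro _ ⟨f, hf, rfl⟩
    refine subset_closure ⟨h.sol f, ?_, rfl⟩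
    have h1 : ‖(f : E)‖ ≤ 1 := by simpa using hf
    have := h.form_sol_le f
    simp only [Set.mem_ofPred_eq]
    nlinarith [norm_nonneg (f : E)]
  exact hg.codRestrict (V := formSpace j) (fun f => (h.inv f).2)
    (Submodule.isClosed_topologicalClosure _)

/-- The spectral theorem is applied to the inverse, which is compact, symmetric and injective.
Injectivity excludes the eigenvalue `0`, so orthonormal bases of the finite-dimensional eigenspaces
together exhaust `formSpace j`. -/
theorem exists_isEigenbasis [CompleteSpace E] (h : CompactForm j s) :
    ∃ (ι : Type) (x : ι → ℝ) (q : ι → Q), IsEigenbasis j s x q := by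
  have hfin : ∀ μ : ℂ, μ ≠ 0 →
      FiniteDimensional ℂ (Module.End.eigenspace (h.inv : formSpace j →ₗ[ℂ] formSpace j) μ) :=
    fun μ hμ => ContinuousLinearMap.finite_dimensional_eigenspace h.inv_isCompactOperator μ hμ
  have hfin' : ∀ μ : ℂ,
      FiniteDimensional ℂ (Module.End.eigenspace (h.inv : formSpace j →ₗ[ℂ] formSpace j) μ) := by
    intro μ
    rcases eq_or_ne μ 0 with rfl | hμ
    · have : Module.End.eigenspace (h.inv : formSpace j →ₗ[ℂ] formSpace j) 0 = ⊥ := by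
        rw [Submodule.eq_bot_iff]
        intro f hf
        rw [Module.End.mem_eigenspace_iff, zero_smul] at hf
        exact h.inv_injective hf
      rw [this]
      infer_instance
    · exact hfin μ hμ
  let B := fun μ : ℂ => stdOrthonormalBasis ℂ
    (Module.End.eigenspace (h.inv : formSpace j →ₗ[ℂ] formSpace j) μ)
  let e : (Σ μ : ℂ, Fin (Module.finrank ℂ
      (Module.End.eigenspace (h.inv : formSpace j →ₗ[ℂ] formSpace j) μ))) → formSpace j :=
    fun p => (B p.1 p.2 : formSpace j)
  have he : Orthonormal ℂ e :=
    (h.inv_isSymmetric.orthogonalFamily_eigenspaces).orthonormal_sigma_orthonormal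
      fun μ => (B μ).orthonormal
  have heig : ∀ p, h.inv (e p) = p.1 • e p := fun p =>
    Module.End.mem_eigenspace_iff.1 (B p.1 p.2).2
  have hμ : ∀ p : (Σ μ : ℂ, Fin (Module.finrank ℂ
      (Module.End.eigenspace (h.inv : formSpace j →ₗ[ℂ] formSpace j) μ))), p.1 ≠ 0 := by
    intro p hp
    have h1 := heig p
    rw [hp, zero_smul] at h1
    exact he.ne_zero p (h.inv_injective h1)
  -- Eigenvectors for `μ ≠ 0` lie in the range of the inverse, hence come from the form domain; this
  -- is the preimage of `e p` under `j`.
  let q := fun p => p.1⁻¹ • h.sol (e p : E)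
  have hjq : ∀ p, j (q p) = e p := by
    intro p
    simp only [q, map_smul]
    rw [← h.coe_inv, heig, Submodule.coe_smul, inv_smul_smul₀ (hμ p)]
  have hs : ∀ p q', s.form (q p) q' = p.1⁻¹ * ⟪j q', j (q p)⟫_ℂ := by
    intro p q'
    rw [hjq]
    simp only [q, map_smul, LinearMap.smul_apply, h.sol_spec, smul_eq_mul]
  have hone : ∀ p, ⟪j (q p), j (q p)⟫_ℂ = 1 := by
    intro p
    rw [hjq, inner_self_eq_norm_sq_to_K]
    have : ‖(e p : E)‖ = 1 := he.norm_eq_one p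
    simp [this]
  -- The eigenvalue `μ⁻¹` is recorded as the energy of a normalised eigenvector, which is real by
  -- construction.
  refine ⟨_, fun p => (s.form (q p) (q p)).re, q, ⟨fun p q' => ?_, ?_, ?_⟩⟩
  · rw [s.ofReal_re, hs p (q p), hone, mul_one, hs]
  · simp only [hjq]
    exact he.comp_linearIsometry (formSpace j).subtypeₗᵢ
  · intro f hf h0
    have hbot := ContinuousLinearMap.orthogonalComplement_iSup_eigenspaces_eq_bot
      h.inv_isCompactOperator h.inv_isSymmetric
    have hmem : (⟨f, hf⟩ : formSpace j) ∈ (⨆ μ, Module.End.eigenspace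
        (h.inv : formSpace j →ₗ[ℂ] formSpace j) μ)ᗮ := by
      rw [← Submodule.iInf_orthogonal, Submodule.mem_iInf]
      intro μ y hy
      have hy' : y = ∑ i, ⟪B μ i, (⟨y, hy⟩ : Module.End.eigenspace _ μ)⟫_ℂ • (B μ i : formSpace j) := by
        have := congrArg Subtype.val ((B μ).sum_repr' ⟨y, hy⟩)
        simpa using this.symm
      rw [hy', sum_inner]
      refine Finset.sum_eq_zero fun i _ => ?_
      rw [inner_smul_left]
      have h1 := h0 ⟨μ, i⟩
      rw [hjq] at h1
      have h2 : ⟪(B μ i : formSpace j), (⟨f, hf⟩ : formSpace j)⟫_ℂ = 0 := h1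
      rw [h2, mul_zero]
    rw [hbot] at hmem
    exact congrArg Subtype.val ((Submodule.mem_bot ℂ).1 hmem)

end CompactForm

end CompactForms

/-! ### Multiplicities, and the spectrum as the set of eigenvalues -/

section CompactForms

variable {Q E : Type*} [AddCommGroup Q] [Module ℂ Q] [NormedAddCommGroup E]
  [InnerProductSpace ℂ E]

theorem edim_congr {V W : Type*} [AddCommGroup V] [Module ℂ V] [AddCommGroup W] [Module ℂ W]
    (e : V ≃ₗ[ℂ] W) : edim V = edim W := by
  have h := congrArg Cardinal.toENat e.lift_rank_eq
  rwa [Cardinal.toENat_lift, Cardinal.toENat_lift] at h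

theorem edim_mono {V : Type*} [AddCommGroup V] [Module ℂ V] {U W : Submodule ℂ V} (h : U ≤ W) :
    edim U ≤ edim W :=
  OrderHomClass.mono Cardinal.toENat (Submodule.rank_mono h)

theorem edim_eq_card {V ι : Type*} [AddCommGroup V] [Module ℂ V] [Fintype ι]
    (b : Module.Basis ι ℂ V) : edim V = Fintype.card ι := by
  rw [edim, rank_eq_card_basis b, map_natCast]

theorem edim_eq_top {V ι : Type*} [AddCommGroup V] [Module ℂ V] [Infinite ι] {v : ι → V}
    (hv : LinearIndependent ℂ v) : edim V = ⊤ := by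
  rw [edim, Cardinal.toENat_eq_top]
  have h := hv.cardinal_lift_le_rank
  have h2 : Cardinal.aleph0 ≤ Cardinal.lift (Cardinal.mk ι) := by
    rw [Cardinal.aleph0_le_lift]
    exact Cardinal.aleph0_le_mk ι
  exact Cardinal.aleph0_le_lift.1 (h2.trans h)

theorem exists_linearIndependent_of_le_edim {V : Type*} [AddCommGroup V] [Module ℂ V] {k : ℕ}
    (h : (k : ℕ∞) ≤ edim V) : ∃ v : Fin k → V, LinearIndependent ℂ v := by
  have : (k : Cardinal) ≤ Module.rank ℂ V := Cardinal.natCast_le_toENat.1 h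
  obtain ⟨s, hs, hli⟩ := le_rank_iff_exists_linearIndependent.1 this
  have e : Nonempty (s ≃ Fin k) := by
    rw [Cardinal.mk_eq_nat_iff] at hs
    exact hs
  exact ⟨_, hli.comp _ e.some.symm.injective⟩

theorem orthonormal_norm_sub {ι : Type*} {e : ι → E} (he : Orthonormal ℂ e) {i k : ι}
    (hik : i ≠ k) : 1 ≤ ‖e i - e k‖ := by
  have h := @norm_sub_sq ℂ E _ _ _ (e i) (e k)
  rw [he.norm_eq_one, he.norm_eq_one, he.inner_eq_zero hik] at h
  simp only [map_zero] at h
  nlinarith [norm_nonneg (e i - e k)]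

/-- Distinct orthonormal vectors are at distance at least `1`, so a ball of radius `1/2` contains at
most one of them. -/
theorem Orthonormal.finite_of_totallyBounded {ι : Type*} {e : ι → E} (he : Orthonormal ℂ e)
    {A : Set E} (hA : TotallyBounded A) : {i | e i ∈ A}.Finite := by
  obtain ⟨t, ht, hcov⟩ := Metric.totallyBounded_iff.1 hA (1 / 2) (by norm_num)
  have hc : ∀ i ∈ {i | e i ∈ A}, ∃ y ∈ t, dist (e i) y < 1 / 2 := by
    intro i hi
    simpa using hcov hi
  choose! c hct hcd using hc
  refine Set.Finite.of_finite_image (f := c) (ht.subset ?_) ?_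
  · rintro _ ⟨i, hi, rfl⟩
    exact hct i hi
  · intro i hi k hk hik
    by_contra hne
    have h1 := hcd i hi
    have h2 := hcd k hk
    rw [← hik] at h2
    have h3 := dist_triangle_right (e i) (e k) (c i)
    have h4 := orthonormal_norm_sub he hne
    rw [dist_eq_norm] at h3
    linarith

/-- The eigenvectors of the operator generated by a form, as elements of the form domain. -/
def formEigenvectors (j : Q →ₗ[ℂ] E) (s : Q →ₗ[ℂ] Q →ₗ⋆[ℂ] ℂ) (μ : ℂ) : Submodule ℂ Q where
  carrier := {q | ∀ q', s q q' = μ * ⟪j q', j q⟫_ℂ}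
  zero_mem' := by simp
  add_mem' := by
    intro u v hu hv q'
    simp [hu q', hv q', mul_add]
  smul_mem' := by
    intro c u hu q'
    simp [hu q']
    ring

theorem mem_formOperator_graph {j : Q →ₗ[ℂ] E} (hj : Function.Injective j)
    {s : Q →ₗ[ℂ] Q →ₗ⋆[ℂ] ℂ} {p : formSpace j × formSpace j} :
    p ∈ (formOperator j s).graph ↔ ∃ q, j q = p.1 ∧ ∀ q', s q q' = ⟪j q', (p.2 : E)⟫_ℂ := by
  rw [formOperator_graph j hj]
  exact Iff.rfl

/-- Multiplicities are moved from the operator domain to weak eigenvectors in the form domain, so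
that domains of unbounded operators play no further part in counting. -/
theorem edim_opEigenspace {j : Q →ₗ[ℂ] E} (hj : Function.Injective j)
    (s : Q →ₗ[ℂ] Q →ₗ⋆[ℂ] ℂ) (μ : ℂ) :
    edim (opEigenspace (formOperator j s) μ) = edim (formEigenvectors j s μ) := by
  set T := formOperator j s with hT
  have hg : ∀ q : formEigenvectors j s μ,
      ((⟨j q, mem_formSpace j q⟩ : formSpace j), μ • (⟨j q, mem_formSpace j q⟩ : formSpace j)) ∈
        T.graph := by
    intro q
    rw [hT, mem_formOperator_graph hj]
    refine ⟨q, rfl, fun q' => ?_⟩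
    rw [q.2 q', Submodule.coe_smul, inner_smul_right]
  have hdom : ∀ q : formEigenvectors j s μ, (⟨j q, mem_formSpace j q⟩ : formSpace j) ∈ T.domain :=
    fun q => LinearPMap.mem_domain_of_mem_graph (hg q)
  have happ : ∀ q : formEigenvectors j s μ,
      T ⟨_, hdom q⟩ = μ • (⟨j q, mem_formSpace j q⟩ : formSpace j) := fun q =>
    LinearPMap.mem_graph_snd_inj T (LinearPMap.mem_graph T ⟨_, hdom q⟩) (hg q) rfl
  let φ : formEigenvectors j s μ →ₗ[ℂ] opEigenspace T μ :=
    { toFun := fun q => ⟨⟨_, hdom q⟩, by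
        rw [opEigenspace, LinearMap.mem_ker, LinearMap.sub_apply, sub_eq_zero]
        exact happ q⟩
      map_add' := fun u v => by
        ext
        simp
      map_smul' := fun c u => by
        ext
        simp }
  refine (edim_congr (LinearEquiv.ofBijective φ ⟨?_, ?_⟩)).symm
  · intro u v huv
    refine Subtype.ext (hj ?_)
    exact congrArg (fun w : opEigenspace T μ => ((w : T.domain) : E)) huv
  · rintro ⟨f, hf⟩
    have hf' : T f = μ • (f : formSpace j) := by
      rw [opEigenspace, LinearMap.mem_ker, LinearMap.sub_apply, sub_eq_zero] at hf
      exact hf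
    have h1 := LinearPMap.mem_graph T f
    obtain ⟨q, hq, hs⟩ := (mem_formOperator_graph hj).1 h1
    refine ⟨⟨q, fun q' => ?_⟩, ?_⟩
    · rw [hs q', hf', Submodule.coe_smul, inner_smul_right, ← hq]
    · exact Subtype.ext (Subtype.ext (Subtype.ext hq))

theorem isEigenvalueList_iff {j : Q →ₗ[ℂ] E} (hj : Function.Injective j)
    {s : Q →ₗ[ℂ] Q →ₗ⋆[ℂ] ℂ} {N : ℕ∞} {ev : ℕ → ℝ} :
    IsEigenvalueList (formOperator j s) N ev ↔
      (∀ i k : ℕ, i ≤ k → (k : ℕ∞) < N → ev i ≤ ev k) ∧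
      ∀ μ : ℂ, {k : ℕ | (k : ℕ∞) < N ∧ (ev k : ℂ) = μ}.encard = edim (formEigenvectors j s μ) := by
  constructor
  · rintro ⟨h1, h2⟩
    exact ⟨h1, fun μ => by rw [h2, edim_opEigenspace hj]⟩
  · rintro ⟨h1, h2⟩
    exact ⟨h1, fun μ => by rw [h2, edim_opEigenspace hj]⟩

namespace IsEigenbasis

variable {j : Q →ₗ[ℂ] E} {s : NonnegForm Q} {ι : Type*} {x : ι → ℝ} {q : ι → Q}

theorem inner_self_eq_one (h : IsEigenbasis j s x q) (i : ι) : ⟪j (q i), j (q i)⟫_ℂ = 1 := by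
  rw [inner_self_eq_norm_sq_to_K, h.orthonormal.norm_eq_one]
  simp

theorem form_self (h : IsEigenbasis j s x q) (i : ι) : s.form (q i) (q i) = x i := by
  rw [h.eig, h.inner_self_eq_one, mul_one]

theorem eig' (h : IsEigenbasis j s x q) (i : ι) (u : Q) :
    s.form u (q i) = x i * ⟪j (q i), j u⟫_ℂ := by
  rw [← s.conj_symm, h.eig, map_mul, inner_conj_symm, Complex.conj_ofReal]

theorem linearIndependent (h : IsEigenbasis j s x q) : LinearIndependent ℂ q :=
  LinearIndependent.of_comp j h.orthonormal.linearIndependent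

theorem comp_equiv (h : IsEigenbasis j s x q) {κ : Type*} (e : κ ≃ ι) :
    IsEigenbasis j s (x ∘ e) (q ∘ e) where
  eig k := h.eig (e k)
  orthonormal := h.orthonormal.comp e e.injective
  complete f hf h0 := h.complete f hf fun i => by simpa using h0 (e.symm i)

theorem one_le (h : IsEigenbasis j s x q) (hs : CompactForm j s) (i : ι) : 1 ≤ x i := by
  have h1 := hs.norm_sq_le (q i)
  rw [h.form_self, h.orthonormal.norm_eq_one] at h1
  simpa using h1

theorem finite_le (h : IsEigenbasis j s x q) (hs : CompactForm j s) (r : ℝ) :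
    {i | x i ≤ r}.Finite := by
  refine (h.orthonormal.finite_of_totallyBounded (hs.totallyBounded r)).subset fun i hi => ?_
  refine ⟨q i, ?_, rfl⟩
  simp only [Set.mem_ofPred_eq] at hi ⊢
  rwa [h.form_self, Complex.ofReal_re]

/-- With finitely many nonzero coefficients no convergence is involved: the difference is orthogonal
to the whole basis, and `j` is injective. -/
theorem eq_sum (h : IsEigenbasis j s x q) (hj : Function.Injective j) (S : Finset ι) {u : Q}
    (hu : ∀ i ∉ S, ⟪j (q i), j u⟫_ℂ = 0) : u = ∑ i ∈ S, ⟪j (q i), j u⟫_ℂ • q i := by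
  classical
  refine hj (sub_eq_zero.1 (h.complete _ ?_ fun i => ?_))
  · exact sub_mem (mem_formSpace j u) (mem_formSpace j _)
  · rw [inner_sub_right, map_sum, inner_sum]
    simp only [map_smul, inner_smul_right, orthonormal_iff_ite.1 h.orthonormal]
    by_cases hi : i ∈ S
    · simp [hi]
    · simp [hi, hu i hi]

/-- A single count serves both for eigenspaces and for the whole form domain. When `S` is infinite
both sides are `⊤`, so linear independence suffices and spanning is needed only for finite `S`. -/
theorem edim_eq_encard (h : IsEigenbasis j s x q) (hj : Function.Injective j) (S : Set ι)
    (U : Submodule ℂ Q) (hU : ∀ i ∈ S, q i ∈ U)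
    (hS : ∀ u ∈ U, ∀ i ∉ S, ⟪j (q i), j u⟫_ℂ = 0) : edim U = S.encard := by
  have hli : LinearIndependent ℂ fun i : S => (⟨q i, hU i i.2⟩ : U) :=
    LinearIndependent.of_comp U.subtype (h.linearIndependent.comp _ Subtype.val_injective)
  rcases S.finite_or_infinite with hfin | hinf
  · have := hfin.fintype
    rw [edim_eq_card (Module.Basis.mk hli ?_), Set.encard_eq_coe_toFinset_card, Set.toFinset_card]
    rintro ⟨u, hu⟩ -
    have h1 := h.eq_sum hj S.toFinset (u := u) fun i hi => hS u hu i (by simpa using hi)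
    have h2 : (⟨u, hu⟩ : U) = ∑ i : S, ⟪j (q i), j u⟫_ℂ • (⟨q i, hU i i.2⟩ : U) := by
      refine Subtype.ext ?_
      rw [Submodule.coe_sum]
      refine h1.trans ?_
      rw [← Finset.sum_coe_sort]
      exact (Fintype.sum_equiv (Equiv.subtypeEquivRight (by simp)) _ _ fun i => by simp)
    rw [h2]
    exact sum_mem fun i _ => Submodule.smul_mem _ _ (Submodule.subset_span ⟨i, rfl⟩)
  · have := hinf.to_subtype
    rw [edim_eq_top hli, hinf.encard_eq]

theorem edim_eq (h : IsEigenbasis j s x q) (hj : Function.Injective j) :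
    edim Q = ENat.card ι := by
  rw [← edim_congr (Submodule.topEquiv (R := ℂ) (M := Q)),
    h.edim_eq_encard hj Set.univ ⊤ (by simp) (by simp), Set.encard_univ]

/-- Pairing a weak eigenvector for `μ` with `q i` in two ways shows that its `i`-th coefficient
vanishes unless `x i = μ`. -/
theorem edim_formEigenvectors (h : IsEigenbasis j s x q) (hj : Function.Injective j) (μ : ℂ) :
    edim (formEigenvectors j s.form μ) = {i | (x i : ℂ) = μ}.encard := by
  refine h.edim_eq_encard hj _ _ (fun i hi q' => ?_) fun u hu i hi => ?_
  · rw [h.eig, hi]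
  · have h1 := h.eig' i u
    rw [hu (q i)] at h1
    by_contra h0
    exact hi (mul_right_cancel₀ h0 h1).symm

end IsEigenbasis

namespace CompactForm

variable {j : Q →ₗ[ℂ] E} {s : NonnegForm Q} {ι : Type*} {x : ι → ℝ} {q : ι → Q}

theorem mem_graph (h : CompactForm j s) (f : formSpace j) :
    (h.inv f, f) ∈ (formOperator j s.form).graph :=
  (mem_formOperator_graph h.inj).2 ⟨h.sol f, rfl, h.sol_spec f⟩

theorem inv_apply (h : CompactForm j s) (y : (formOperator j s.form).domain) :
    h.inv (formOperator j s.form y) = y := by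
  obtain ⟨p, hp, hs⟩ := (mem_formOperator_graph h.inj).1 (LinearPMap.mem_graph _ y)
  refine Subtype.ext ?_
  rw [h.coe_inv, h.sol_unique hs, hp]

theorem inv_mem_domain (h : CompactForm j s) (f : formSpace j) :
    h.inv f ∈ (formOperator j s.form).domain :=
  LinearPMap.mem_domain_of_mem_graph (h.mem_graph f)

theorem apply_inv (h : CompactForm j s) (f : formSpace j) :
    formOperator j s.form ⟨h.inv f, h.inv_mem_domain f⟩ = f :=
  LinearPMap.mem_graph_snd_inj _ (LinearPMap.mem_graph _ _) (h.mem_graph f) rfl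

/-- The spectrum of the operator generated by a form with compact embedding consists of its
eigenvalues. -/
theorem opSpectrum_eq [CompleteSpace E] (h : CompactForm j s) (hb : IsEigenbasis j s x q) :
    opSpectrum (formOperator j s.form) = Set.range fun i => (x i : ℂ) := by
  ext μ
  constructor
  · intro hμ
    by_contra hno
    refine hμ ?_
    rcases eq_or_ne μ 0 with rfl | h0
    · refine ⟨h.inv, fun f => ⟨h.inv_mem_domain f, ?_⟩, fun y => ?_⟩
      · rw [zero_smul, sub_zero, h.apply_inv]
      · rw [zero_smul, sub_zero, h.inv_apply]
    have hne : ¬ Module.End.HasEigenvalue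
        (h.inv : Module.End ℂ (formSpace j)) μ⁻¹ := by
      intro he
      obtain ⟨f, hf⟩ := he.exists_hasEigenvector
      have hf1 : h.inv f = μ⁻¹ • f := hf.apply_eq_smul
      have hf2 : j (h.sol f) = μ⁻¹ • (f : E) := congrArg Subtype.val hf1
      have hmem : h.sol f ∈ formEigenvectors j s.form μ := by
        intro q'
        rw [h.sol_spec, hf2, inner_smul_right, mul_inv_cancel_left₀ h0]
      refine hf.2 (Subtype.ext (hb.complete _ f.2 fun i => ?_))
      have h1 := hb.eig' i (h.sol f)
      rw [hmem (q i), hf2] at h1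
      by_contra hi
      have h2 : ⟪j (q i), μ⁻¹ • (f : E)⟫_ℂ ≠ 0 := by
        rw [inner_smul_right]
        exact mul_ne_zero (inv_ne_zero h0) hi
      exact hno ⟨i, (mul_right_cancel₀ h2 h1).symm⟩
    -- Fredholm alternative: for the compact inverse, a nonzero number that is not an eigenvalue is
    -- in the resolvent set.
    have hres := (h.inv_isCompactOperator.hasEigenvalue_or_mem_resolventSet
      (inv_ne_zero h0)).resolve_left hne
    rw [spectrum.mem_resolventSet_iff] at hres
    obtain ⟨A, hA⟩ := hres
    let B : formSpace j →L[ℂ] formSpace j := ↑A⁻¹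
    have hAB : ∀ f, μ⁻¹ • B f - h.inv (B f) = f := by
      intro f
      have := congrArg (fun C : formSpace j →L[ℂ] formSpace j => C f) A.mul_inv
      rw [hA] at this
      simpa [Algebra.algebraMap_eq_smul_one] using this
    have hBA : ∀ f, B (μ⁻¹ • f - h.inv f) = f := by
      intro f
      have := congrArg (fun C : formSpace j →L[ℂ] formSpace j => C f) A.inv_mul
      rw [hA] at this
      simpa [Algebra.algebraMap_eq_smul_one] using this
    -- From `T - μ = μ (μ⁻¹ - T⁻¹) T` the resolvent must be `μ⁻¹ T⁻¹ (μ⁻¹ - T⁻¹)⁻¹`.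
    refine ⟨μ⁻¹ • (h.inv ∘L B), fun f => ?_, fun y => ?_⟩
    · have e : (μ⁻¹ • (h.inv ∘L B)) f = h.inv (μ⁻¹ • B f) := by simp
      rw [e]
      refine ⟨h.inv_mem_domain _, ?_⟩
      rw [h.apply_inv, map_smul, smul_inv_smul₀ h0, hAB]
    · have e : formOperator j s.form y - μ • (y : formSpace j) =
          μ • (μ⁻¹ • formOperator j s.form y - h.inv (formOperator j s.form y)) := by
        rw [h.inv_apply, smul_sub, smul_inv_smul₀ h0]
      rw [e, map_smul, smul_apply, ContinuousLinearMap.comp_apply, hBA,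
        smul_inv_smul₀ h0, h.inv_apply]
  · rintro ⟨i, rfl⟩ ⟨R, -, hR⟩
    have hg : ((⟨j (q i), mem_formSpace j _⟩ : formSpace j),
        (x i : ℂ) • (⟨j (q i), mem_formSpace j _⟩ : formSpace j)) ∈
          (formOperator j s.form).graph :=
      (mem_formOperator_graph h.inj).2 ⟨q i, rfl, fun q' => by
        rw [hb.eig, Submodule.coe_smul, inner_smul_right]⟩
    have hd := LinearPMap.mem_domain_of_mem_graph hg
    have h1 := LinearPMap.mem_graph_snd_inj _ (LinearPMap.mem_graph _ ⟨_, hd⟩) hg rfl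
    have h2 := hR ⟨_, hd⟩
    rw [h1] at h2
    simp only [sub_self, map_zero] at h2
    exact hb.orthonormal.ne_zero i (congrArg Subtype.val h2.symm)

end CompactForm

end CompactForms

/-! ### Ascending enumeration of families with finite sublevel sets -/

section Enumeration

/-- A family of reals with finite sublevel sets can be enumerated in ascending order. -/
theorem exists_monotone_enumeration {ι : Type*} (x : ι → ℝ) (hfin : ∀ r, {i | x i ≤ r}.Finite) :
    ∃ σ : {k : ℕ // (k : ℕ∞) < ENat.card ι} ≃ ι, ∀ k l, k.1 ≤ l.1 → x (σ k) ≤ x (σ l) := by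
  have hcount : Countable ι := by
    have : (Set.univ : Set ι) = ⋃ n : ℕ, {i | x i ≤ n} := by
      ext i
      simpa using exists_nat_ge (x i)
    rw [← Set.countable_univ_iff, this]
    exact Set.countable_iUnion fun n => (hfin n).countable
  obtain ⟨c, hc⟩ := exists_injective_nat ι
  -- Ties between equal values are broken by an injective code, which gives a linear order on `ι`
  -- with finite initial segments.
  let g : ι → ℝ ×ₗ ℕ := fun i => toLex (x i, c i)
  have hg : Function.Injective g := fun i k hik => hc (congrArg (fun p => (ofLex p).2) hik)
  let _ : LinearOrder ι := LinearOrder.lift' g hg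
  have hx : ∀ {i k : ι}, i ≤ k → x i ≤ x k := by
    intro i k hik
    have h : g i ≤ g k := hik
    rcases (Prod.Lex.le_iff (x := g i) (y := g k)).1 h with h | h
    · exact le_of_lt h
    · exact le_of_eq h.1
  have hlt : ∀ i : ι, (Set.Iio i).Finite := fun i =>
    (hfin (x i)).subset fun k hk => hx (le_of_lt hk)
  -- The position of an index is the number of its predecessors, so positions start at `0`.
  let rk : ι → ℕ := fun i => (Set.Iio i).ncard
  have hrk : StrictMono rk := by
    intro i k hik
    refine Set.ncard_lt_ncard ⟨Set.Iio_subset_Iio hik.le, fun h => ?_⟩ (hlt k)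
    exact lt_irrefl i (h hik)
  have hcard : ∀ i, (rk i : ℕ∞) < ENat.card ι := by
    intro i
    have h1 : (insert i (Set.Iio i)).encard ≤ (Set.univ : Set ι).encard :=
      Set.encard_le_encard (Set.subset_univ _)
    rw [Set.encard_univ, Set.encard_insert_of_notMem (by simp), ← (hlt i).cast_ncard_eq] at h1
    refine lt_of_lt_of_le ?_ h1
    exact_mod_cast Nat.lt_succ_self _
  have hsurj : ∀ k : ℕ, (k : ℕ∞) < ENat.card ι → ∃ i, rk i = k := by
    intro k hk
    have hle : {i | rk i < k}.encard ≤ k := by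
      have h1 := Set.encard_le_encard_of_injOn (s := {i | rk i < k}) (t := Set.Iio k) (f := rk)
        (fun i hi => hi) hrk.injective.injOn
      rwa [← Finset.coe_range, Set.encard_coe_eq_coe_finsetCard, Finset.card_range] at h1
    have hex : ∃ l, k ≤ l ∧ ∃ i, rk i = l := by
      by_contra hno
      push Not at hno
      have : {i | rk i < k} = Set.univ := by
        ext i
        simp only [Set.mem_ofPred_eq, Set.mem_univ, iff_true]
        by_contra h
        exact hno (rk i) (not_lt.1 h) i rfl
      rw [this, Set.encard_univ] at hle
      exact absurd hk (not_lt.2 hle)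
    classical
    -- Take the least attained rank that is at least `k`. All predecessors of its index have rank
    -- below `k`, so there are at most `k` of them and the rank is `k` itself.
    obtain ⟨h1, i, hi⟩ := Nat.find_spec hex
    refine ⟨i, le_antisymm ?_ (hi ▸ h1)⟩
    have hsub : Set.Iio i ⊆ {i | rk i < k} := by
      intro l hl
      simp only [Set.mem_ofPred_eq]
      by_contra h
      exact Nat.find_min hex (m := rk l) (hi ▸ hrk hl) ⟨not_lt.1 h, l, rfl⟩
    have := (Set.encard_le_encard hsub).trans hle
    rw [← (hlt i).cast_ncard_eq] at this
    exact_mod_cast this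
  let τ : ι → {k : ℕ // (k : ℕ∞) < ENat.card ι} := fun i => ⟨rk i, hcard i⟩
  have hτ : Function.Bijective τ := by
    refine ⟨fun i k h => hrk.injective (congrArg Subtype.val h), fun k => ?_⟩
    obtain ⟨i, hi⟩ := hsurj k k.2
    exact ⟨i, Subtype.ext hi⟩
  refine ⟨(Equiv.ofBijective τ hτ).symm, fun k l hkl => hx ?_⟩
  have e : ∀ k, rk ((Equiv.ofBijective τ hτ).symm k) = k.1 := fun k =>
    congrArg Subtype.val ((Equiv.ofBijective τ hτ).apply_symm_apply k)
  rw [← hrk.le_iff_le, e, e]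
  exact hkl

theorem nonempty_equiv_of_encard_eq {α β : Type*} {A : Set α} {B : Set β} (hB : B.Finite)
    (h : A.encard = B.encard) : Nonempty (A ≃ B) := by
  have hA : A.Finite := by
    rw [← Set.encard_lt_top_iff, h]
    exact hB.encard_lt_top
  have := hA.to_subtype
  have := hB.to_subtype
  exact Finite.card_eq.1 (congrArg ENat.toNat h)

theorem encard_setOf_equiv {α β : Type*} (e : α ≃ β) (p : β → Prop) :
    {a | p (e a)}.encard = {b | p b}.encard :=
  ENat.card_congr (e.subtypeEquiv fun _ => Iff.rfl)

theorem encard_setOf_subtype {α : Type*} (p r : α → Prop) :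
    {a : {a // p a} | r a}.encard = {a | p a ∧ r a}.encard :=
  ENat.card_congr (Equiv.subtypeSubtypeEquivSubtypeInter p r)

end Enumeration

/-! ### Eigenvalue lists and Rayleigh quotients -/

section CompactForms

variable {Q E : Type*} [AddCommGroup Q] [Module ℂ Q] [NormedAddCommGroup E]
  [InnerProductSpace ℂ E]

theorem CompactForm.exists_isEigenvalueList [CompleteSpace E] {j : Q →ₗ[ℂ] E} {s : NonnegForm Q}
    (h : CompactForm j s) :
    ∃ ev : ℕ → ℝ, IsEigenvalueList (formOperator j s.form) (edim Q) ev := by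
  classical
  obtain ⟨ι, x, q, hb⟩ := h.exists_isEigenbasis
  obtain ⟨σ, hσ⟩ := exists_monotone_enumeration x (hb.finite_le h)
  rw [hb.edim_eq h.inj]
  let ev : ℕ → ℝ := fun k => if hk : (k : ℕ∞) < ENat.card ι then x (σ ⟨k, hk⟩) else 0
  have hev : ∀ k : {k : ℕ // (k : ℕ∞) < ENat.card ι}, ev k = x (σ k) := fun k => dif_pos k.2
  refine ⟨ev, (isEigenvalueList_iff h.inj).2 ⟨fun i k hik hk => ?_, fun μ => ?_⟩⟩
  · have hi : (i : ℕ∞) < ENat.card ι := lt_of_le_of_lt (by exact_mod_cast hik) hk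
    rw [hev ⟨i, hi⟩, hev ⟨k, hk⟩]
    exact hσ _ _ hik
  · rw [hb.edim_formEigenvectors h.inj, ← encard_setOf_equiv σ, ← encard_setOf_subtype]
    simp only [hev]

/-- Over each real value, the given list and any eigenbasis have the same finite number of indices;
gluing bijections of these fibres reindexes the basis. Statements about an arbitrary list can thus
be proved with eigenvectors in hand. -/
theorem CompactForm.exists_isEigenbasis_of_list [CompleteSpace E] {j : Q →ₗ[ℂ] E}
    {s : NonnegForm Q} (h : CompactForm j s) {ev : ℕ → ℝ}
    (hl : IsEigenvalueList (formOperator j s.form) (edim Q) ev) :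
    ∃ q : ℕ → Q, IsEigenbasis j s (ι := {k : ℕ // (k : ℕ∞) < edim Q}) (fun k => ev k)
      (fun k => q k) := by
  classical
  obtain ⟨ι, x, q, hb⟩ := h.exists_isEigenbasis
  have hmult := ((isEigenvalueList_iff h.inj).1 hl).2
  have hfib : ∀ r : ℝ, Nonempty ({k : {k : ℕ // (k : ℕ∞) < edim Q} // ev k = r} ≃
      {i // x i = r}) := by
    intro r
    refine nonempty_equiv_of_encard_eq (A := {k : {k : ℕ // (k : ℕ∞) < edim Q} | ev k = r})
      (B := {i | x i = r}) ((hb.finite_le h r).subset fun i hi => le_of_eq hi) ?_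
    have h1 := hmult r
    rw [hb.edim_formEigenvectors h.inj] at h1
    simp only [Complex.ofReal_inj] at h1
    rw [← h1, ← encard_setOf_subtype]
  let σ := Equiv.ofFiberEquiv (f := fun k : {k : ℕ // (k : ℕ∞) < edim Q} => ev k) (g := x)
    fun r => (hfib r).some
  have hσ : ∀ k, x (σ k) = ev k := fun k => Equiv.ofFiberEquiv_map _ k
  refine ⟨fun k => if hk : (k : ℕ∞) < edim Q then q (σ ⟨k, hk⟩) else 0, ?_⟩
  have h1 := hb.comp_equiv σ
  convert! h1 using 1
  · ext k
    exact (hσ k).symm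
  · ext k
    simp [k.2]

/-- On some subspace of dimension `k`, the form is bounded by `r` times the norm of `E`. -/
def FormLeOn (j : Q →ₗ[ℂ] E) (s : Q →ₗ[ℂ] Q →ₗ⋆[ℂ] ℂ) (k : ℕ) (r : ℝ) : Prop :=
  ∃ u : Fin k → Q, LinearIndependent ℂ u ∧
    ∀ w ∈ Submodule.span ℂ (Set.range u), (s w w).re ≤ r * ‖j w‖ ^ 2

/-- This is the dimension count behind minimax, the penalisation argument and the
`β`-representation. -/
theorem LinearIndependent.exists_mem_span_apply_eq_zero {k m : ℕ} {u : Fin k → Q}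
    (hu : LinearIndependent ℂ u) (hm : m < k) (l : Fin m → Q →ₗ[ℂ] ℂ) :
    ∃ w ∈ Submodule.span ℂ (Set.range u), w ≠ 0 ∧ ∀ i, l i w = 0 := by
  let f : (Fin k → ℂ) →ₗ[ℂ] Fin m → ℂ := (LinearMap.pi l) ∘ₗ Fintype.linearCombination ℂ u
  have hk : LinearMap.ker f ≠ ⊥ := LinearMap.ker_ne_bot_of_finrank_lt (by simpa using hm)
  obtain ⟨c, hc, hc0⟩ := (Submodule.ne_bot_iff _).1 hk
  refine ⟨Fintype.linearCombination ℂ u c, ?_, fun h0 => hc0 ?_, fun i => ?_⟩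
  · rw [← Fintype.range_linearCombination ℂ u]
    exact ⟨c, rfl⟩
  · exact (LinearMap.ker_eq_bot'.1 (LinearMap.ker_eq_bot.2
      hu.fintypeLinearCombination_injective)) c h0
  · exact congrFun (LinearMap.mem_ker.1 hc) i

namespace IsEigenbasis

variable {j : Q →ₗ[ℂ] E} {s : NonnegForm Q} {ι : Type*} {x : ι → ℝ} {q : ι → Q}

theorem form_sum (h : IsEigenbasis j s x q) (S : Finset ι) (c : ι → ℂ) :
    s.form (∑ i ∈ S, c i • q i) (∑ i ∈ S, c i • q i) = ((∑ i ∈ S, x i * ‖c i‖ ^ 2 : ℝ) : ℂ) := by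
  classical
  simp only [map_sum, LinearMap.sum_apply, map_smul, LinearMap.smul_apply,
    LinearMap.map_smulₛₗ, h.eig, orthonormal_iff_ite.1 h.orthonormal]
  rw [Complex.ofReal_sum]
  refine Finset.sum_congr rfl fun i hi => ?_
  simp only [smul_eq_mul, mul_ite, mul_one, mul_zero, Finset.sum_ite_eq, hi, if_true]
  push_cast
  rw [← Complex.mul_conj']
  ring

theorem norm_sq_sum (h : IsEigenbasis j s x q) (S : Finset ι) (c : ι → ℂ) :
    ‖j (∑ i ∈ S, c i • q i)‖ ^ 2 = ∑ i ∈ S, ‖c i‖ ^ 2 := by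
  have h1 := h.orthonormal.inner_sum c c S
  have h2 : j (∑ i ∈ S, c i • q i) = ∑ i ∈ S, c i • j (q i) := by simp
  rw [h2, @norm_sq_eq_re_inner ℂ, h1]
  simp only [← Complex.normSq_eq_conj_mul_self, ← Complex.ofReal_sum, Complex.normSq_eq_norm_sq]
  exact Complex.ofReal_re _

theorem form_le_of_mem_span (h : IsEigenbasis j s x q) {m : ℕ} (e : Fin m → ι)
    (he : Function.Injective e) {r : ℝ} (hr : ∀ i, x (e i) ≤ r) {w : Q}
    (hw : w ∈ Submodule.span ℂ (Set.range (q ∘ e))) :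
    (s.form w w).re ≤ r * ‖j w‖ ^ 2 := by
  rw [← Fintype.range_linearCombination ℂ (q ∘ e)] at hw
  obtain ⟨c, rfl⟩ := hw
  -- Coefficients are extended by zero to all of `ι`, so that the formulas for finite sums over `ι`
  -- apply.
  have h2 : ∀ c : Fin m → ℂ, Fintype.linearCombination ℂ (q ∘ e) c =
      ∑ i ∈ Finset.univ.map ⟨e, he⟩, (Function.extend e c 0) i • q i := by
    intro c
    rw [Finset.sum_map, Fintype.linearCombination_apply]
    simp [he.extend_apply]
  rw [h2, h.form_sum, h.norm_sq_sum, Complex.ofReal_re, Finset.mul_sum]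
  refine Finset.sum_le_sum fun i hi => ?_
  obtain ⟨k, -, rfl⟩ := Finset.mem_map.1 hi
  exact mul_le_mul_of_nonneg_right (hr k) (by positivity)

/-- Bessel's inequality in the energy form: expand `0 ≤ s[u - w]`, where `w` is the partial sum of
the expansion of `u`. -/
theorem sum_mul_le (h : IsEigenbasis j s x q) (S : Finset ι) (u : Q) :
    ∑ i ∈ S, x i * ‖⟪j (q i), j u⟫_ℂ‖ ^ 2 ≤ (s.form u u).re := by
  set c : ι → ℂ := fun i => ⟪j (q i), j u⟫_ℂ with hc
  set w := ∑ i ∈ S, c i • q i with hw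
  have h1 : s.form u w = ((∑ i ∈ S, x i * ‖c i‖ ^ 2 : ℝ) : ℂ) := by
    rw [hw, map_sum, Complex.ofReal_sum]
    refine Finset.sum_congr rfl fun i _ => ?_
    rw [LinearMap.map_smulₛₗ, h.eig', smul_eq_mul]
    push_cast
    rw [← Complex.mul_conj']
    simp only [hc]
    ring
  have h2 : s.form w u = ((∑ i ∈ S, x i * ‖c i‖ ^ 2 : ℝ) : ℂ) := by
    rw [← s.conj_symm, h1, Complex.conj_ofReal]
  have h3 := h.form_sum S c
  rw [← hw] at h3
  have h4 := (Complex.nonneg_iff.1 (s.nonneg (u - w))).1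
  have h5 : s.form (u - w) (u - w) =
      s.form u u - s.form u w - (s.form w u - s.form w w) := by
    rw [map_sub s.form, LinearMap.sub_apply, map_sub, map_sub]
  rw [h5, h1, h2, h3] at h4
  simp only [Complex.sub_re, Complex.ofReal_re] at h4
  linarith

theorem hasSum_norm_sq [CompleteSpace E] (h : IsEigenbasis j s x q) (u : Q) :
    HasSum (fun i => ‖⟪j (q i), j u⟫_ℂ‖ ^ 2) (‖j u‖ ^ 2) := by
  let v : ι → formSpace j := fun i => ⟨j (q i), mem_formSpace j _⟩
  have hv : Orthonormal ℂ v := by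
    classical
    rw [orthonormal_iff_ite]
    exact orthonormal_iff_ite.1 h.orthonormal
  have hbot : (Submodule.span ℂ (Set.range v))ᗮ = ⊥ := by
    rw [Submodule.eq_bot_iff]
    intro f hf
    refine Subtype.ext (h.complete f f.2 fun i => ?_)
    exact (Submodule.mem_orthogonal _ f).1 hf (v i) (Submodule.subset_span ⟨i, rfl⟩)
  let B := HilbertBasis.mkOfOrthogonalEqBot hv hbot
  have h1 := B.hasSum_inner_mul_inner ⟨j u, mem_formSpace j u⟩ ⟨j u, mem_formSpace j u⟩
  have h2 := Complex.hasSum_re h1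
  have e1 : (⟪(⟨j u, mem_formSpace j u⟩ : formSpace j),
      (⟨j u, mem_formSpace j u⟩ : formSpace j)⟫_ℂ).re = ‖j u‖ ^ 2 :=
    (@norm_sq_eq_re_inner ℂ _ _ _ _ (j u)).symm
  rw [e1] at h2
  convert h2 using 2 with i
  have e2 : (B i : formSpace j) = v i := congrFun (HilbertBasis.coe_mkOfOrthogonalEqBot hv hbot) i
  rw [e2]
  change _ = (⟪j u, j (q i)⟫_ℂ * ⟪j (q i), j u⟫_ℂ).re
  rw [← inner_conj_symm (j u), Complex.conj_mul']
  norm_cast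

/-- A vector orthogonal to all eigenvectors with eigenvalue below `r` has Rayleigh quotient at
least `r`. -/
theorem le_form_of_orthogonal [CompleteSpace E] (h : IsEigenbasis j s x q) {r : ℝ} {u : Q}
    (hu : ∀ i, x i < r → ⟪j (q i), j u⟫_ℂ = 0) : r * ‖j u‖ ^ 2 ≤ (s.form u u).re := by
  refine hasSum_le_of_sum_le ((h.hasSum_norm_sq u).mul_left r) fun S => ?_
  refine le_trans (Finset.sum_le_sum fun i _ => ?_) (h.sum_mul_le S u)
  rcases lt_or_ge (x i) r with hi | hi
  · rw [hu i hi]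
    simp
  · exact mul_le_mul_of_nonneg_right hi (by positivity)

end IsEigenbasis

end CompactForms

/-! ### Minimax and spectral cuts -/

section CompactForms

variable {Q E : Type*} [AddCommGroup Q] [Module ℂ Q] [NormedAddCommGroup E]
  [InnerProductSpace ℂ E] [CompleteSpace E] {j : Q →ₗ[ℂ] E} {s : NonnegForm Q} {ev : ℕ → ℝ}

namespace CompactForm

theorem opSpectrum_eq_of_list (h : CompactForm j s)
    (hl : IsEigenvalueList (formOperator j s.form) (edim Q) ev) :
    opSpectrum (formOperator j s.form) =
      Complex.ofReal '' {r | ∃ k : ℕ, (k : ℕ∞) < edim Q ∧ ev k = r} := by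
  obtain ⟨q, hb⟩ := h.exists_isEigenbasis_of_list hl
  rw [h.opSpectrum_eq hb]
  ext μ
  constructor
  · rintro ⟨k, rfl⟩
    exact ⟨_, ⟨k, k.2, rfl⟩, rfl⟩
  · rintro ⟨_, ⟨k, hk, rfl⟩, rfl⟩
    exact ⟨⟨k, hk⟩, rfl⟩

theorem finite_list_le (h : CompactForm j s)
    (hl : IsEigenvalueList (formOperator j s.form) (edim Q) ev) (r : ℝ) :
    {k : ℕ | (k : ℕ∞) < edim Q ∧ ev k ≤ r}.Finite := by
  obtain ⟨q, hb⟩ := h.exists_isEigenbasis_of_list hl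
  refine ((hb.finite_le h r).image Subtype.val).subset ?_
  rintro k ⟨hk, hr⟩
  exact ⟨⟨k, hk⟩, hr, rfl⟩

theorem one_le_list (h : CompactForm j s)
    (hl : IsEigenvalueList (formOperator j s.form) (edim Q) ev) {k : ℕ} (hk : (k : ℕ∞) < edim Q) :
    1 ≤ ev k := by
  obtain ⟨q, hb⟩ := h.exists_isEigenbasis_of_list hl
  exact hb.one_le h ⟨k, hk⟩

/-- The minimax principle. -/
theorem list_le_iff (h : CompactForm j s)
    (hl : IsEigenvalueList (formOperator j s.form) (edim Q) ev) {k : ℕ} (hk : (k : ℕ∞) < edim Q)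
    {r : ℝ} : ev k ≤ r ↔ FormLeOn j s.form (k + 1) r := by
  obtain ⟨q, hb⟩ := h.exists_isEigenbasis_of_list hl
  have hlt : ∀ i : ℕ, i ≤ k → (i : ℕ∞) < edim Q := fun i hi =>
    lt_of_le_of_lt (by exact_mod_cast hi) hk
  constructor
  · intro hr
    let e : Fin (k + 1) → {k : ℕ // (k : ℕ∞) < edim Q} := fun i =>
      ⟨i, hlt i (Nat.lt_succ_iff.1 i.2)⟩
    have he : Function.Injective e := fun a b hab => Fin.ext (congrArg (fun z => z.1) hab)
    refine ⟨_, hb.linearIndependent.comp e he, fun w hw => ?_⟩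
    exact hb.form_le_of_mem_span e he
      (fun i => (hl.mono i k (Nat.lt_succ_iff.1 i.2) hk).trans hr) hw
  · rintro ⟨u, hu, hle⟩
    -- Indices start at `0`, so the trial space has dimension `k + 1` and orthogonality to the `k`
    -- eigenvectors before `q k` leaves a nonzero vector.
    obtain ⟨w, hw, hw0, hl0⟩ := hu.exists_mem_span_apply_eq_zero (Nat.lt_succ_self k)
      fun i => (innerₛₗ ℂ (j (q i))) ∘ₗ j
    have h1 : ev k * ‖j w‖ ^ 2 ≤ (s.form w w).re := by
      refine hb.le_form_of_orthogonal fun i hi => ?_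
      have hik : i.1 < k := by
        by_contra hc
        exact absurd hi (not_lt.2 (hl.mono k i (not_lt.1 hc) i.2))
      exact hl0 ⟨i, hik⟩
    have h2 := hle w hw
    have h3 : 0 < ‖j w‖ := by
      rw [norm_pos_iff]
      exact fun h0 => hw0 (h.inj (by rw [h0, map_zero]))
    have h4 : 0 < ‖j w‖ ^ 2 := by positivity
    exact le_of_mul_le_mul_right (h1.trans h2) h4

/-- Separation of the eigenvalues `≤ r` from the others. -/
theorem exists_spectral_cut (h : CompactForm j s)
    (hl : IsEigenvalueList (formOperator j s.form) (edim Q) ev) (r : ℝ) :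
    ∃ (m : ℕ) (e : Fin m → Q) (r' : ℝ), (m : ℕ∞) ≤ edim Q ∧ (∀ k < m, ev k ≤ r) ∧
      ((m : ℕ∞) < edim Q → r < ev m) ∧ LinearIndependent ℂ e ∧
      (∀ w ∈ Submodule.span ℂ (Set.range e), (s.form w w).re ≤ r * ‖j w‖ ^ 2) ∧
      (∀ i q', s.form (e i) q' = ev i * ⟪j q', j (e i)⟫_ℂ) ∧
      r < r' ∧ ∀ u, (∀ i, ⟪j (e i), j u⟫_ℂ = 0) → r' * ‖j u‖ ^ 2 ≤ (s.form u u).re := by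
  classical
  obtain ⟨q, hb⟩ := h.exists_isEigenbasis_of_list hl
  obtain ⟨b, hbnd⟩ := (h.finite_list_le hl r).bddAbove
  -- The cut is the first index at which the list stops or exceeds `r`; it exists because only
  -- finitely many eigenvalues are at most `r`.
  have hex : ∃ m : ℕ, ¬ ((m : ℕ∞) < edim Q ∧ ev m ≤ r) :=
    ⟨b + 1, fun hc => absurd (hbnd hc) (by simp)⟩
  obtain ⟨m, hm, hmin⟩ : ∃ m : ℕ, ¬ ((m : ℕ∞) < edim Q ∧ ev m ≤ r) ∧
      ∀ k < m, (k : ℕ∞) < edim Q ∧ ev k ≤ r :=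
    ⟨Nat.find hex, Nat.find_spec hex, fun k hk => not_not.1 (Nat.find_min hex hk)⟩
  let e : Fin m → {k : ℕ // (k : ℕ∞) < edim Q} := fun i => ⟨i, (hmin i i.2).1⟩
  have he : Function.Injective e := fun a b hab => Fin.ext (congrArg (fun z => z.1) hab)
  have hm' : (m : ℕ∞) < edim Q → r < ev m := fun h1 => by
    by_contra hc
    exact hm ⟨h1, not_lt.1 hc⟩
  -- The gap value `r'` is the next eigenvalue. If there is none, the chosen vectors are the whole
  -- eigenbasis, only `u = 0` is orthogonal to them, and any `r' > r` would do.
  refine ⟨m, fun i => q i, if (m : ℕ∞) < edim Q then ev m else r + 1, ?_,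
    fun k hk => (hmin k hk).2, hm', hb.linearIndependent.comp e he,
    fun w hw => hb.form_le_of_mem_span e he (fun i => (hmin i i.2).2) hw,
    fun i => hb.eig (e i), ?_, fun u hu => ?_⟩
  · rcases Nat.eq_zero_or_pos m with rfl | hpos
    · simp
    · have := Order.add_one_le_of_lt (hmin (m - 1) (by lia)).1
      refine le_trans (le_of_eq ?_) this
      exact_mod_cast (Nat.sub_add_cancel hpos).symm
  · split_ifs with h1
    · exact hm' h1
    · linarith
  · refine hb.le_form_of_orthogonal fun i hi => ?_
    have hik : i.1 < m := by
      by_contra hc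
      have h1 : (m : ℕ∞) < edim Q := lt_of_le_of_lt (by exact_mod_cast not_lt.1 hc) i.2
      rw [if_pos h1] at hi
      exact absurd hi (not_lt.2 (hl.mono m i (not_lt.1 hc) i.2))
    exact hu ⟨i, hik⟩

end CompactForm

end CompactForms

/-! ### Comparison of forms and geometry of semi-inner products -/

section FormComparison

variable {Q E : Type*} [AddCommGroup Q] [Module ℂ Q] [NormedAddCommGroup E]
  [InnerProductSpace ℂ E] {j : Q →ₗ[ℂ] E}

theorem FormLeOn.le_edim {k : ℕ} {r : ℝ} {t : Q →ₗ[ℂ] Q →ₗ⋆[ℂ] ℂ} (h : FormLeOn j t k r) :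
    (k : ℕ∞) ≤ edim Q := by
  obtain ⟨u, hu, -⟩ := h
  have := hu.cardinal_lift_le_rank
  simp only [Cardinal.mk_fin, Cardinal.lift_natCast, Cardinal.lift_id'] at this
  exact Cardinal.natCast_le_toENat.2 (by simpa using this)

/-- Comparison of forms through an injective linear map. -/
theorem FormLeOn.map {Q' E' : Type*} [AddCommGroup Q'] [Module ℂ Q'] [NormedAddCommGroup E']
    [InnerProductSpace ℂ E'] {j' : Q' →ₗ[ℂ] E'} {t' : Q' →ₗ[ℂ] Q' →ₗ⋆[ℂ] ℂ} {k : ℕ} {r r' : ℝ}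
    {t : Q →ₗ[ℂ] Q →ₗ⋆[ℂ] ℂ} (h : FormLeOn j t k r) (f : Q →ₗ[ℂ] Q') (hf : Function.Injective f)
    (hle : ∀ w, (t w w).re ≤ r * ‖j w‖ ^ 2 → (t' (f w) (f w)).re ≤ r' * ‖j' (f w)‖ ^ 2) :
    FormLeOn j' t' k r' := by
  obtain ⟨u, hu, hw⟩ := h
  refine ⟨f ∘ u, hu.map' f (LinearMap.ker_eq_bot.2 hf), ?_⟩
  rw [Set.range_comp, ← Submodule.map_span]
  rintro _ ⟨w, hws, rfl⟩
  exact hle w (hw w hws)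

end FormComparison

namespace NonnegForm

variable {H : Type*} [AddCommGroup H] [Module ℂ H] (s : NonnegForm H)

theorem re_nonneg (u : H) : 0 ≤ (s.form u u).re := (Complex.nonneg_iff.1 (s.nonneg u)).1

theorem form_add_self_re (u v : H) :
    (s.form (u + v) (u + v)).re =
      (s.form u u).re + 2 * (s.form u v).re + (s.form v v).re := by
  have h : (s.form v u).re = (s.form u v).re := by rw [← s.conj_symm, Complex.conj_re]
  simp only [map_add, LinearMap.add_apply, Complex.add_re, h]
  ring

theorem re_apply_le (u v : H) : |(s.form u v).re| ≤ s.norm u * s.norm v :=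
  (Complex.abs_re_le_norm _).trans (s.norm_apply_le u v)

theorem norm_add_le (u v : H) : s.norm (u + v) ≤ s.norm u + s.norm v := by
  have hu := s.norm_nonneg' u
  have hv := s.norm_nonneg' v
  refine abs_le_of_sq_le_sq' ?_ (by positivity) |>.2
  rw [s.norm_sq, s.form_add_self_re, ← s.norm_sq, ← s.norm_sq]
  linarith [le_of_abs_le (s.re_apply_le u v)]

theorem norm_le_of_mem_orthCompl {V : Submodule ℂ H} {u p : H} (hp : p ∈ V)
    (hw : u - p ∈ s.orthCompl V) : s.norm p ≤ s.norm u := by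
  refine abs_le_of_sq_le_sq' ?_ (s.norm_nonneg' u) |>.2
  have h := s.form_add_self_re (u - p) p
  rw [sub_add_cancel, hw p hp, Complex.zero_re] at h
  rw [s.norm_sq, s.norm_sq, h]
  linarith [s.re_nonneg (u - p)]

theorem form_eq_of_sub_mem_nullSpace {u w : H} (h : u - w ∈ s.nullSpace) :
    s.form u u = s.form w w := by
  have h1 : ∀ x, s.form (u - w) x = 0 := s.apply_eq_zero h
  have h2 : ∀ x, s.form x (u - w) = 0 := fun x => by rw [← s.conj_symm, h1, map_zero]
  have e : u = w + (u - w) := by abel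
  rw [e]
  simp only [map_add, LinearMap.add_apply, h1, h2, add_zero]

end NonnegForm

/-! ### The homogenised form: limit representation, bounds, coercivity on `Z` -/

namespace DegenerateProblem

open Filter Topology

variable {n : ℕ} {H 𝓗 : Type*} [NormedAddCommGroup H] [InnerProductSpace ℂ H]
  [NormedAddCommGroup 𝓗] [InnerProductSpace ℂ 𝓗] (P : DegenerateProblem n H 𝓗)

theorem isClosed_nullSpace {θ : EuclideanSpace ℝ (Fin n)} (hθ : θ ∈ P.Θ) :
    IsClosed ((P.a θ).nullSpace : Set H) := by
  obtain ⟨K, hK, h⟩ := P.exists_bound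
  have : ((P.a θ).nullSpace : Set H) = ⋂ u : H, {v : H | (P.a θ).form v u = 0} := by
    ext v
    simp only [Set.mem_iInter]
    exact ⟨fun hv u => (P.a θ).apply_eq_zero hv u, fun hv => hv v⟩
  rw [this]
  refine isClosed_iInter fun u => ?_
  let f : H →L[ℂ] ℂ := ((P.a θ).form.flip u).mkContinuous (K * ‖u‖) (fun w => by
    have := (h θ hθ w u).1
    change ‖(P.a θ).form w u‖ ≤ _
    linarith)
  exact isClosed_eq f.continuous continuous_const

/-- The projection is obtained by solving `(p, x)_θ = (u, x)_θ` for all `x` in the null space, since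
the ambient norm of `H` need not be the one of `(·,·)_θ`. -/
theorem exists_projection [CompleteSpace H] {θ : EuclideanSpace ℝ (Fin n)} (hθ : θ ∈ P.Θ) (u : H) :
    ∃ p ∈ (P.a θ).nullSpace, u - p ∈ ((P.a θ).add (P.b θ)).orthCompl (P.a θ).nullSpace := by
  obtain ⟨K, hK, hb⟩ := P.exists_bound
  obtain ⟨M, hM, hn⟩ := P.norm_equiv
  obtain ⟨p, hp, -⟩ := ((P.a θ).add (P.b θ)).existsUnique_solution (P.a θ).nullSpace
    (P.isClosed_nullSpace hθ) K (1 / M ^ 2) (by positivity) (fun u w => (hb θ hθ u w).2)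
    (fun w _ => by
      rw [← NonnegForm.norm_sq, one_div_mul_eq_div, div_le_iff₀ (by positivity)]
      have h1 := (hn θ hθ w).1
      calc ‖w‖ ^ 2 ≤ (M * ((P.a θ).add (P.b θ)).norm w) ^ 2 := by gcongr
        _ = _ := by ring) (((P.a θ).add (P.b θ)).form u) (K * ‖u‖) (fun x => (hb θ hθ u x).2)
  refine ⟨p, p.2, fun v hv => ?_⟩
  rw [map_sub, LinearMap.sub_apply, hp v hv, sub_self]

theorem eventually_smul_mem (ξ : EuclideanSpace ℝ (Fin n)) : ∀ᶠ t : ℝ in 𝓝[>] 0, t • ξ ∈ P.Θ := by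
  have hcont : Tendsto (fun t : ℝ => t • ξ) (𝓝[>] 0) (𝓝 0) := by
    have : Continuous fun t : ℝ => t • ξ := by fun_prop
    have h := this.tendsto 0
    rw [zero_smul] at h
    exact h.mono_left nhdsWithin_le_nhds
  exact hcont.eventually (mem_interior_iff_mem_nhds.1 P.zero_mem_interior)

theorem tendsto_of_norm_sub_le {f : ℝ → ℂ} {g : ℂ} {C : ℝ}
    (h : ∀ᶠ t in 𝓝[>] (0 : ℝ), ‖f t - g‖ ≤ C * t) : Tendsto f (𝓝[>] 0) (𝓝 g) := by
  rw [tendsto_iff_norm_sub_tendsto_zero]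
  refine squeeze_zero' (Eventually.of_forall fun _ => norm_nonneg _) h ?_
  have : Continuous fun t : ℝ => C * t := by fun_prop
  have h1 := this.tendsto 0
  rw [mul_zero] at h1
  exact h1.mono_left nhdsWithin_le_nhds

/-- The second-order form `a₀''(v, w) ξ · ξ`. -/
def secondOrder (ξ : EuclideanSpace ℝ (Fin n)) (v w : P.V₀) : ℂ :=
  ∑ i, ∑ k, P.a₂ v w i k * (ξ k : ℂ) * (ξ i : ℂ)

theorem secondOrder_smul (t : ℝ) (ξ : EuclideanSpace ℝ (Fin n)) (v w : P.V₀) :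
    P.secondOrder (t • ξ) v w = (t : ℂ) ^ 2 * P.secondOrder ξ v w := by
  simp only [secondOrder, Finset.mul_sum]
  refine Finset.sum_congr rfl fun i _ => Finset.sum_congr rfl fun k _ => ?_
  simp
  ring

theorem firstOrder_smul (t : ℝ) (ξ : EuclideanSpace ℝ (Fin n)) (v : P.V₀) (u : H) :
    P.firstOrder (t • ξ) v u = (t : ℂ) * P.firstOrder ξ v u := by
  simp only [firstOrder, LinearMap.coe_mk, AddHom.coe_mk, Finset.mul_sum]
  refine Finset.sum_congr rfl fun i _ => ?_
  simp
  ring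

theorem tendsto_secondOrder (ξ : EuclideanSpace ℝ (Fin n)) (v w : P.V₀) :
    Tendsto (fun t : ℝ => ((t : ℂ) ^ 2)⁻¹ * (P.a (t • ξ)).form v w) (𝓝[>] 0)
      (𝓝 (P.secondOrder ξ v w)) := by
  obtain ⟨K, hK, hd⟩ := P.diff_two
  refine tendsto_of_norm_sub_le (C := K * ‖ξ‖ ^ 3 * P.ip₀.norm v * P.ip₀.norm w) ?_
  filter_upwards [P.eventually_smul_mem ξ, self_mem_nhdsWithin] with t ht ht0
  have ht0 : 0 < t := ht0
  have h := hd v w _ ht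
  change ‖(P.a (t • ξ)).form v w - P.secondOrder (t • ξ) v w‖ ≤ _ at h
  have ht' : (t : ℂ) ^ 2 ≠ 0 := by simp [ht0.ne']
  have e : ((t : ℂ) ^ 2)⁻¹ * (P.a (t • ξ)).form v w - P.secondOrder ξ v w =
      ((t : ℂ) ^ 2)⁻¹ * ((P.a (t • ξ)).form v w - P.secondOrder (t • ξ) v w) := by
    rw [secondOrder_smul, mul_sub, inv_mul_cancel_left₀ ht']
  rw [e, norm_mul, norm_inv, norm_pow, Complex.norm_real, Real.norm_of_nonneg ht0.le,
    inv_mul_le_iff₀ (by positivity)]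
  refine h.trans (le_of_eq ?_)
  rw [norm_smul, Real.norm_of_nonneg ht0.le]
  ring

theorem tendsto_firstOrder (ξ : EuclideanSpace ℝ (Fin n)) (v : P.V₀) (u : H) :
    Tendsto (fun t : ℝ => (t : ℂ)⁻¹ * (P.a (t • ξ)).form v u) (𝓝[>] 0)
      (𝓝 (P.firstOrder ξ v u)) := by
  obtain ⟨K, hK, hd⟩ := P.diff_one
  refine tendsto_of_norm_sub_le (C := K * ‖ξ‖ ^ 2 * P.ip₀.norm v * P.ip₀.norm u) ?_
  filter_upwards [P.eventually_smul_mem ξ, self_mem_nhdsWithin] with t ht ht0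
  have ht0 : 0 < t := ht0
  have h := hd v u _ ht
  change ‖(P.a (t • ξ)).form v u - P.firstOrder (t • ξ) v u‖ ≤ _ at h
  have ht' : (t : ℂ) ≠ 0 := by simp [ht0.ne']
  have e : (t : ℂ)⁻¹ * (P.a (t • ξ)).form v u - P.firstOrder ξ v u =
      (t : ℂ)⁻¹ * ((P.a (t • ξ)).form v u - P.firstOrder (t • ξ) v u) := by
    rw [firstOrder_smul, mul_sub, inv_mul_cancel_left₀ ht']
  rw [e, norm_mul, norm_inv, Complex.norm_real, Real.norm_of_nonneg ht0.le,
    inv_mul_le_iff₀ (by positivity)]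
  refine h.trans (le_of_eq ?_)
  rw [norm_smul, Real.norm_of_nonneg ht0.le]
  ring

theorem tendsto_form (ξ : EuclideanSpace ℝ (Fin n)) (u w : H) :
    Tendsto (fun t : ℝ => (P.a (t • ξ)).form u w) (𝓝[>] 0) (𝓝 ((P.a 0).form u w)) := by
  obtain ⟨L, hL, hlip⟩ := P.a_lipschitz
  refine tendsto_of_norm_sub_le (C := L * ‖ξ‖ * P.ip₀.norm u * P.ip₀.norm w) ?_
  filter_upwards [P.eventually_smul_mem ξ, self_mem_nhdsWithin] with t ht ht0
  have ht0 : 0 < t := ht0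
  have h := hlip 0 P.zero_mem _ ht u w
  rw [norm_sub_rev] at h
  refine h.trans (le_of_eq ?_)
  rw [zero_sub, norm_neg, norm_smul, Real.norm_of_nonneg ht0.le]
  ring

/-- Since `2‖v‖‖z‖ ≤ ‖v‖² + ‖z‖²`, one has `‖z - v‖² ≥ (1 - K)(‖v‖² + ‖z‖²)`, and `1 - K ≥ (1 -
K)²`. -/
theorem transversal_le : ∃ c : ℝ, 0 < c ∧ ∀ v ∈ P.Vstar, ∀ z ∈ P.Z,
    c * P.ip₀.norm z ≤ P.ip₀.norm (z - v) := by
  obtain ⟨K, hK0, hK1, hK⟩ := P.transversal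
  refine ⟨1 - K, by linarith, fun v hv z hz => ?_⟩
  refine abs_le_of_sq_le_sq' ?_ (P.ip₀.norm_nonneg' _) |>.2
  have h1 := hK v hv z hz
  have h2 := P.ip₀.form_add_self_re (-v) z
  have h3 := (Complex.re_le_norm _).trans h1
  have e : -v + z = z - v := by abel
  rw [e] at h2
  simp only [map_neg, LinearMap.neg_apply, neg_neg, Complex.neg_re] at h2
  rw [P.ip₀.norm_sq, h2, ← P.ip₀.norm_sq, ← P.ip₀.norm_sq]
  change (P.ip₀.form v z).re ≤ K * P.ip₀.norm v * P.ip₀.norm z at h3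
  have hv := P.ip₀.norm_nonneg' v
  have hz := P.ip₀.norm_nonneg' z
  nlinarith [mul_nonneg hK0 (sq_nonneg (P.ip₀.norm v - P.ip₀.norm z)),
    mul_nonneg (sub_nonneg.2 hK1.le) (sq_nonneg (P.ip₀.norm v)),
    mul_nonneg (mul_nonneg hK0 (sub_nonneg.2 hK1.le)) (sq_nonneg (P.ip₀.norm z))]

section Complete

variable [CompleteSpace H]

theorem homForm_apply (ξ : EuclideanSpace ℝ (Fin n)) (v w : P.V₀) :
    P.homForm ξ v w = P.secondOrder ξ v w -
      (P.a 0).form (P.corrector ξ v) (P.corrector ξ w) := rfl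

theorem corrector_apply (ξ : EuclideanSpace ℝ (Fin n)) (v : P.V₀) (x : H) (hx : x ∈ P.W₀) :
    (P.a 0).form (P.corrector ξ v) x = -P.firstOrder ξ v x := P.corrector_spec ξ v x hx

theorem corrector_smul (t : ℝ) (ξ : EuclideanSpace ℝ (Fin n)) (v : P.V₀) :
    P.corrector (t • ξ) v = (t : ℂ) • P.corrector ξ v := by
  refine (P.existsUnique_corrector (t • ξ) v).unique (P.corrector_apply _ v) fun x hx => ?_
  rw [Submodule.coe_smul, map_smul, LinearMap.smul_apply, P.corrector_apply ξ v x hx,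
    LinearMap.neg_apply,
    firstOrder_smul, smul_eq_mul, mul_neg]

theorem homForm_smul (t : ℝ) (ξ : EuclideanSpace ℝ (Fin n)) (v w : P.V₀) :
    P.homForm (t • ξ) v w = (t : ℂ) ^ 2 * P.homForm ξ v w := by
  rw [homForm_apply, homForm_apply, secondOrder_smul, corrector_smul, corrector_smul]
  simp only [Submodule.coe_smul, map_smul, LinearMap.smul_apply, LinearMap.map_smulₛₗ,
    Complex.conj_ofReal, smul_eq_mul]
  ring

/-- The homogenised form is the rescaled limit of `a_θ[v + N_θ v]`. -/
theorem tendsto_homForm (ξ : EuclideanSpace ℝ (Fin n)) (v : P.V₀) :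
    Tendsto (fun t : ℝ => ((t : ℂ) ^ 2)⁻¹ *
      (P.a (t • ξ)).form (v + (t : ℂ) • (P.corrector ξ v : H))
        (v + (t : ℂ) • (P.corrector ξ v : H))) (𝓝[>] 0) (𝓝 (P.homForm ξ v v)) := by
  set N : H := ((P.corrector ξ v : P.W₀) : H) with hN
  have h1 := P.tendsto_secondOrder ξ v v
  have h2 := P.tendsto_firstOrder ξ v N
  have h3 := (Complex.continuous_conj.tendsto _).comp h2
  have h4 := P.tendsto_form ξ N N
  have h5 := ((h1.add h2).add h3).add h4
  -- Testing the cell problem with `N` itself gives `a₀'(v, N) · ξ = -a₀[N]`. The two mixed terms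
  -- contribute `-2 a₀[N]`, the quadratic one `+a₀[N]`.
  have e : P.homForm ξ v v = P.secondOrder ξ v v + P.firstOrder ξ v N +
      (starRingEnd ℂ) (P.firstOrder ξ v N) + (P.a 0).form N N := by
    have hF : P.firstOrder ξ v N = -(P.a 0).form N N := by
      rw [hN, P.corrector_apply ξ v _ (P.corrector ξ v).2, neg_neg]
    rw [homForm_apply, hF, map_neg, (P.a 0).conj_symm, ← hN]
    ring
  rw [e]
  refine h5.congr' ?_
  filter_upwards [self_mem_nhdsWithin] with t ht0
  have ht' : (t : ℂ) ≠ 0 := by simp [(show (0 : ℝ) < t from ht0).ne']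
  simp only [Function.comp_apply, map_mul, map_inv₀, Complex.conj_ofReal, NonnegForm.conj_symm,
    map_add, LinearMap.add_apply, map_smul, LinearMap.smul_apply, LinearMap.map_smulₛₗ, smul_eq_mul]
  field_simp
  ring

/-- The definition is a difference and shows no sign; non-negativity is inherited from `a_θ` through
the limit. -/
theorem homForm_nonneg (ξ : EuclideanSpace ℝ (Fin n)) (v : P.V₀) : 0 ≤ P.homForm ξ v v := by
  refine ge_of_tendsto (P.tendsto_homForm ξ v) ?_
  filter_upwards [self_mem_nhdsWithin] with t ht0
  refine mul_nonneg ?_ ((P.a _).nonneg _)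
  have : (0 : ℝ) ≤ (t ^ 2)⁻¹ := by positivity
  exact_mod_cast this

/-- Dropping the subtracted corrector energy leaves the second-order term. It is estimated at one
admissible parameter `t • ξ` and rescaled by homogeneity. -/
theorem homForm_re_le (ξ : EuclideanSpace ℝ (Fin n)) :
    ∃ C : ℝ, 0 ≤ C ∧ ∀ v : P.V₀, (P.homForm ξ v v).re ≤ C * ‖(v : H)‖ ^ 2 := by
  obtain ⟨K, hK, hb⟩ := P.exists_bound
  obtain ⟨M, hM, hn⟩ := P.norm_equiv
  obtain ⟨C, hC, hd⟩ := P.diff_two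
  obtain ⟨t, ht, ht0⟩ := ((P.eventually_smul_mem ξ).and self_mem_nhdsWithin).exists
  have ht0 : 0 < t := ht0
  refine ⟨(K + C * ‖t • ξ‖ ^ 3 * M ^ 2) / t ^ 2, by positivity, fun v => ?_⟩
  have h1 := hd v v _ ht
  change ‖(P.a (t • ξ)).form v v - P.secondOrder (t • ξ) v v‖ ≤ _ at h1
  have h2 := (hb _ ht (v : H) v).1
  have h3 := (hn 0 P.zero_mem (v : H)).2
  have h4 : ‖P.secondOrder (t • ξ) v v‖ ≤
      K * ‖(v : H)‖ * ‖(v : H)‖ + C * ‖t • ξ‖ ^ 3 * (M * ‖(v : H)‖) * (M * ‖(v : H)‖) := by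
    have h5 := norm_sub_norm_le (P.secondOrder (t • ξ) v v) ((P.a (t • ξ)).form v v)
    rw [norm_sub_rev] at h5
    have h6 : C * ‖t • ξ‖ ^ 3 * P.ip₀.norm v * P.ip₀.norm v ≤
        C * ‖t • ξ‖ ^ 3 * (M * ‖(v : H)‖) * (M * ‖(v : H)‖) := by
      have := P.ip₀.norm_nonneg' v
      gcongr
    linarith
  rw [secondOrder_smul, norm_mul, norm_pow, Complex.norm_real, Real.norm_of_nonneg ht0.le] at h4
  have h7 := (P.a 0).re_nonneg (P.corrector ξ v)
  have h8 := Complex.re_le_norm (P.secondOrder ξ v v)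
  rw [homForm_apply, Complex.sub_re, div_mul_eq_mul_div, le_div_iff₀ (by positivity)]
  have h9 : ((P.secondOrder ξ v v).re - ((P.a 0).form (P.corrector ξ v) (P.corrector ξ v)).re) *
      t ^ 2 ≤ ‖P.secondOrder ξ v v‖ * t ^ 2 := by
    gcongr
    linarith
  refine h9.trans ?_
  rw [mul_comm]
  refine h4.trans (le_of_eq ?_)
  ring

/-- Quantitative form of the coercivity of the homogenised form on `Z`, before passing to the
limit. -/
theorem exists_le_sqrt {ξ : EuclideanSpace ℝ (Fin n)} (hξ : ξ ≠ 0) :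
    ∃ c : ℝ, 0 < c ∧ ∀ z : P.V₀, (z : H) ∈ P.Z → ∃ D : ℝ, ∀ᶠ t : ℝ in 𝓝[>] 0,
      c * ‖(z : H)‖ - D * t ≤ √(((t : ℂ) ^ 2)⁻¹ *
        (P.a (t • ξ)).form (z + (t : ℂ) • (P.corrector ξ z : H))
          (z + (t : ℂ) • (P.corrector ξ z : H))).re := by
  obtain ⟨M, hM, hn⟩ := P.norm_equiv
  obtain ⟨c, hc, htr⟩ := P.transversal_le
  obtain ⟨γ, hγ, hgap⟩ := P.quadratic_gap
  obtain ⟨L, hL, hrem⟩ := P.removable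
  have hξ0 : 0 < ‖ξ‖ := norm_pos_iff.2 hξ
  refine ⟨√γ * ‖ξ‖ / M ^ 2 * (c / M), by positivity, fun z hz => ?_⟩
  set N : H := ((P.corrector ξ z : P.W₀) : H) with hN
  -- Three errors of order `t` are collected: replacing `z` by `u`, moving `p` from the null space
  -- at `θ` to `V_⋆`, and the slack in the infimum.
  refine ⟨√γ * ‖ξ‖ / M ^ 2 * (M * ‖N‖ + L * ‖ξ‖ * (M * (‖(z : H)‖ + ‖N‖)) + 1), ?_⟩
  filter_upwards [P.eventually_smul_mem ξ, self_mem_nhdsWithin,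
    nhdsWithin_le_nhds (Iio_mem_nhds one_pos)] with t ht ht0 ht1
  have ht0 : 0 < t := ht0
  have ht1 : t < 1 := ht1
  set θ := t • ξ with hθ
  have hθ0 : θ ≠ 0 := smul_ne_zero ht0.ne' hξ
  have hθn : ‖θ‖ = t * ‖ξ‖ := by rw [hθ, norm_smul, Real.norm_of_nonneg ht0.le]
  set u : H := z + (t : ℂ) • N with hu
  obtain ⟨p, hp, hw⟩ := P.exists_projection ht u
  set s := (P.a θ).add (P.b θ) with hs
  -- the energy of `u` bounds its distance from the null space
  have h1 : γ * ‖θ‖ ^ 2 * s.norm (u - p) ^ 2 ≤ ((P.a θ).form u u).re := by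
    have := hgap θ ht (u - p) hw
    rwa [← (P.a θ).form_eq_of_sub_mem_nullSpace (u := u) (w := u - p) (by simpa using hp)] at this
  have h2 : √γ * ‖ξ‖ * s.norm (u - p) ≤ √(((t : ℂ) ^ 2)⁻¹ * (P.a θ).form u u).re := by
    have hsn := s.norm_nonneg' (u - p)
    refine Real.le_sqrt_of_sq_le ?_
    have e : (((t : ℂ) ^ 2)⁻¹ * (P.a θ).form u u).re = (t ^ 2)⁻¹ * ((P.a θ).form u u).re := by
      rw [← Complex.re_ofReal_mul]
      push_cast
      rfl
    rw [e, le_inv_mul_iff₀ (by positivity)]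
    refine le_trans (le_of_eq ?_) h1
    rw [hθn, mul_pow, mul_pow, Real.sq_sqrt hγ.le]
    ring
  -- the distance of `z` from `V_⋆`
  have hzn : ‖u‖ ≤ ‖(z : H)‖ + ‖N‖ := by
    refine (_root_.norm_add_le _ _).trans ?_
    rw [norm_smul, Complex.norm_real, Real.norm_of_nonneg ht0.le]
    nlinarith [_root_.norm_nonneg N]
  have hpn : s.norm p ≤ M * (‖(z : H)‖ + ‖N‖) :=
    (s.norm_le_of_mem_orthCompl hp hw).trans
      ((hn θ ht u).2.trans (by gcongr))
  have h3 := hrem θ ht 0 P.zero_mem p (by rw [starFamily, if_neg hθ0]; exact hp)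
  -- The infimum in (H2) is approached only up to a positive slack; taking it equal to `t` keeps the
  -- error of order `t`.
  obtain ⟨⟨v, hv⟩, h4⟩ := exists_lt_of_ciInf_lt (lt_of_le_of_lt h3 (lt_add_of_pos_right _ ht0))
  rw [starFamily, if_pos rfl] at hv
  change P.ip₀.norm (p - v) < L * ‖θ - 0‖ * s.norm p + t at h4
  have h5 : P.ip₀.norm (p - v) ≤ t * (L * ‖ξ‖ * (M * (‖(z : H)‖ + ‖N‖)) + 1) := by
    rw [sub_zero, hθn] at h4
    have : L * (t * ‖ξ‖) * s.norm p ≤ L * (t * ‖ξ‖) * (M * (‖(z : H)‖ + ‖N‖)) := by gcongr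
    linarith
  have h6 : P.ip₀.norm (u - p) ≤ M ^ 2 * s.norm (u - p) := by
    have e1 := (hn 0 P.zero_mem (u - p)).2
    have e2 := (hn θ ht (u - p)).1
    calc P.ip₀.norm (u - p) ≤ M * ‖u - p‖ := e1
      _ ≤ M * (M * s.norm (u - p)) := by gcongr
      _ = _ := by ring
  have h7 : P.ip₀.norm (z - u) ≤ t * (M * ‖N‖) := by
    have e1 := (hn 0 P.zero_mem (z - u)).2
    have e2 : (z : H) - u = -((t : ℂ) • N) := by rw [hu]; abel
    have e3 : ‖(z : H) - u‖ = t * ‖N‖ := by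
      rw [e2, _root_.norm_neg, norm_smul, Complex.norm_real, Real.norm_of_nonneg ht0.le]
    rw [e3] at e1
    linarith
  have h8 : P.ip₀.norm (z - v) ≤ P.ip₀.norm (z - u) + P.ip₀.norm (u - p) + P.ip₀.norm (p - v) := by
    have e1 : (z : H) - v = (z - u) + (u - p) + (p - v) := by abel
    rw [e1]
    exact (P.ip₀.norm_add_le _ _).trans (by linarith [P.ip₀.norm_add_le (z - u) (u - p)])
  have h9 := htr v hv z hz
  have h10 : c / M * ‖(z : H)‖ ≤ c * P.ip₀.norm z := by
    have := (hn 0 P.zero_mem z).1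
    calc c / M * ‖(z : H)‖ ≤ c / M * (M * P.ip₀.norm z) := by gcongr
      _ = _ := by field_simp
  refine le_trans ?_ h2
  have h11 : c / M * ‖(z : H)‖ - t * (M * ‖N‖ + L * ‖ξ‖ * (M * (‖(z : H)‖ + ‖N‖)) + 1) ≤
      M ^ 2 * s.norm (u - p) := by linarith
  have h12 := mul_le_mul_of_nonneg_left h11 (show 0 ≤ √γ * ‖ξ‖ / M ^ 2 by positivity)
  have e : √γ * ‖ξ‖ / M ^ 2 * (M ^ 2 * s.norm (u - p)) = √γ * ‖ξ‖ * s.norm (u - p) := by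
    field_simp
  rw [e] at h12
  linarith

/-- The error constant in `exists_le_sqrt` depends on `z` but `c` does not, so letting `t → 0` for
each fixed `z` gives a uniform bound. -/
theorem le_homForm_re {ξ : EuclideanSpace ℝ (Fin n)} (hξ : ξ ≠ 0) :
    ∃ c : ℝ, 0 < c ∧ ∀ z : P.V₀, (z : H) ∈ P.Z → c * ‖(z : H)‖ ^ 2 ≤ (P.homForm ξ z z).re := by
  obtain ⟨c, hc, h⟩ := P.exists_le_sqrt hξ
  refine ⟨c ^ 2, by positivity, fun z hz => ?_⟩
  obtain ⟨D, hD⟩ := h z hz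
  have h1 : Tendsto (fun t : ℝ => c * ‖(z : H)‖ - D * t) (𝓝[>] 0) (𝓝 (c * ‖(z : H)‖)) := by
    have : Continuous fun t : ℝ => c * ‖(z : H)‖ - D * t := by fun_prop
    have h1 := this.tendsto 0
    rw [mul_zero, sub_zero] at h1
    exact h1.mono_left nhdsWithin_le_nhds
  have h2 := ((Real.continuous_sqrt.comp Complex.continuous_re).tendsto _).comp
    (P.tendsto_homForm ξ z)
  have h3 := le_of_tendsto_of_tendsto h1 h2 hD
  have h5 : (c * ‖(z : H)‖) ^ 2 ≤ √(P.homForm ξ z z).re ^ 2 :=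
    pow_le_pow_left₀ (by positivity) h3 2
  rw [Real.sq_sqrt (Complex.nonneg_iff.1 (P.homForm_nonneg ξ z)).1, mul_pow] at h5
  exact h5

end Complete

end DegenerateProblem

/-! ### The forms of the problem as compact forms -/

/-- The restriction of a non-negative form to a subspace. -/
def NonnegForm.restrict {H : Type*} [AddCommGroup H] [Module ℂ H] (s : NonnegForm H)
    (U : Submodule ℂ H) : NonnegForm U where
  form := s.form.domRestrict₁₂ U U
  nonneg u := s.nonneg u

/-- `G` lends `Q` a Hilbert space structure equivalent to the energy norm: coercivity then yields
solvability, and compactness of `J` yields total boundedness of sublevel sets. -/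
theorem CompactForm.of_linearEquiv {G Q E : Type*} [NormedAddCommGroup G] [InnerProductSpace ℂ G]
    [CompleteSpace G] [AddCommGroup Q] [Module ℂ Q] [NormedAddCommGroup E] [InnerProductSpace ℂ E]
    [CompleteSpace E] {j : Q →ₗ[ℂ] E} {s : NonnegForm Q} (e : G ≃ₗ[ℂ] Q)
    (hj : Function.Injective j) (hle : ∀ q, ‖j q‖ ^ 2 ≤ (s.form q q).re) {c C : ℝ} (hc : 0 < c)
    (hlow : ∀ g, c * ‖g‖ ^ 2 ≤ (s.form (e g) (e g)).re)
    (hup : ∀ g, (s.form (e g) (e g)).re ≤ C * ‖g‖ ^ 2)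
    (J : G →L[ℂ] E) (hJ : ∀ g, J g = j (e g)) (hcomp : IsCompactOperator J) :
    CompactForm j s where
  inj := hj
  norm_sq_le := hle
  solve f := by
    let t : NonnegForm G :=
      ⟨LinearMap.mk₂'ₛₗ (RingHom.id ℂ) (starRingEnd ℂ) (fun u v => s.form (e u) (e v))
        (by intros; simp) (by intros; simp) (by intros; simp) (by intros; simp),
        fun u => s.nonneg (e u)⟩
    have ht : ∀ u v, t.form u v = s.form (e u) (e v) := fun _ _ => rfl
    have hb : ∀ u v, ‖t.form u v‖ ≤ |C| * ‖u‖ * ‖v‖ := by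
      intro u v
      refine abs_le_of_sq_le_sq' ?_ (by positivity) |>.2
      refine (t.norm_sq_le u v).trans ?_
      have h1 : ∀ w, (t.form w w).re ≤ |C| * ‖w‖ ^ 2 := fun w =>
        (hup w).trans (mul_le_mul_of_nonneg_right (le_abs_self C) (by positivity))
      calc _ ≤ (|C| * ‖u‖ ^ 2) * (|C| * ‖v‖ ^ 2) :=
            mul_le_mul (h1 u) (h1 v) (t.re_nonneg v) (by positivity)
        _ = _ := by ring
    let l : G →ₗ⋆[ℂ] ℂ :=
      { toFun := fun x => ⟪J x, f⟫_ℂ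
        map_add' := fun x y => by rw [map_add, inner_add_left]
        map_smul' := fun a x => by rw [map_smul, inner_smul_left, smul_eq_mul] }
    have hl : ∀ u, ‖l u‖ ≤ (‖J‖ * ‖f‖) * ‖u‖ := by
      intro u
      calc ‖⟪J u, f⟫_ℂ‖ ≤ ‖J u‖ * ‖f‖ := norm_inner_le_norm _ _
        _ ≤ (‖J‖ * ‖u‖) * ‖f‖ := by gcongr; exact J.le_opNorm u
        _ = _ := by ring
    obtain ⟨w, hw, -⟩ := t.existsUnique_solution ⊤ isClosed_univ |C| c hc hb (fun w _ => hlow w)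
      l _ hl
    refine ⟨e w, fun q' => ?_⟩
    have h1 := hw (e.symm q') trivial
    rw [ht, e.apply_symm_apply] at h1
    rw [h1]
    change ⟪J (e.symm q'), f⟫_ℂ = _
    rw [hJ, e.apply_symm_apply]
  totallyBounded r := by
    obtain ⟨K, hK, hsub⟩ := hcomp.image_closedBall_subset_compact (f := (J : G →ₗ[ℂ] E)) √(r / c)
    refine hK.totallyBounded.subset ?_
    rintro _ ⟨q, hq, rfl⟩
    refine hsub ⟨e.symm q, ?_, ?_⟩
    · have h1 := hlow (e.symm q)
      rw [e.apply_symm_apply] at h1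
      have hq' : (s.form q q).re ≤ r := hq
      rw [mem_closedBall_zero_iff]
      refine Real.le_sqrt_of_sq_le ?_
      rw [le_div_iff₀ hc]
      linarith
    · change J _ = _
      rw [hJ, e.apply_symm_apply]

theorem edim_formEigenvectors_congr {Q Q' E : Type*} [AddCommGroup Q] [Module ℂ Q]
    [AddCommGroup Q'] [Module ℂ Q'] [NormedAddCommGroup E] [InnerProductSpace ℂ E]
    {j : Q →ₗ[ℂ] E} {j' : Q' →ₗ[ℂ] E} {s : Q →ₗ[ℂ] Q →ₗ⋆[ℂ] ℂ} {s' : Q' →ₗ[ℂ] Q' →ₗ⋆[ℂ] ℂ}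
    (e : Q ≃ₗ[ℂ] Q') (hj : ∀ q, j' (e q) = j q) (hs : ∀ p q, s' (e p) (e q) = s p q) (μ : ℂ) :
    edim (formEigenvectors j s μ) = edim (formEigenvectors j' s' μ) := by
  have h : formEigenvectors j s μ = (formEigenvectors j' s' μ).comap (e : Q →ₗ[ℂ] Q') := by
    ext q
    constructor
    · intro h q'
      have := h (e.symm q')
      rw [← hs, ← hj, ← hj, e.apply_symm_apply] at this
      exact this
    · intro h q'
      have := h (e q')
      change s' (e q) (e q') = μ * ⟪j' (e q'), j' (e q)⟫_ℂ at this
      rwa [hs, hj, hj] at this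
  rw [h]
  exact edim_congr (e.ofSubmodule' _)

namespace DegenerateProblem

variable {n : ℕ} {H 𝓗 : Type*} [NormedAddCommGroup H] [InnerProductSpace ℂ H]
  [NormedAddCommGroup 𝓗] [InnerProductSpace ℂ 𝓗] (P : DegenerateProblem n H 𝓗)

theorem Vstar_le : P.Vstar ≤ P.V₀ := le_sup_left.trans P.sup_eq.le

theorem ip₀_apply_of_mem {v : H} (hv : v ∈ P.V₀) (u : H) : P.ip₀.form v u = (P.b 0).form v u := by
  change (P.a 0).form v u + (P.b 0).form v u = _
  rw [(P.a 0).apply_eq_zero hv, zero_add]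

theorem norm_b_of_mem {v : H} (hv : v ∈ P.V₀) : (P.b 0).norm v = P.ip₀.norm v := by
  rw [NonnegForm.norm, NonnegForm.norm, P.ip₀_apply_of_mem hv]

theorem norm_emb_le (u : H) : ‖P.emb u‖ ≤ (P.b 0).norm u :=
  Real.le_sqrt_of_sq_le (P.d_le_b u)

theorem exists_norm_b_equiv : ∃ M : ℝ, 0 < M ∧ ∀ v ∈ P.V₀,
    ‖v‖ ≤ M * (P.b 0).norm v ∧ (P.b 0).norm v ≤ M * ‖v‖ := by
  obtain ⟨M, hM, h⟩ := P.norm_equiv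
  refine ⟨M, hM, fun v hv => ?_⟩
  rw [P.norm_b_of_mem hv]
  exact h 0 P.zero_mem v

/-- On `V₀` the form `a₀` vanishes, so transversality is a statement about `b₀`; it makes `V_⋆ ∔ Z`
a topological sum in the energy norm. -/
theorem exists_transversal_b : ∃ c : ℝ, 0 < c ∧ ∀ v ∈ P.Vstar, ∀ z ∈ P.Z,
    c * ((P.b 0).norm v ^ 2 + (P.b 0).norm z ^ 2) ≤ (P.b 0).norm (v + z) ^ 2 := by
  obtain ⟨K, hK0, hK1, hK⟩ := P.transversal
  refine ⟨1 - K, by linarith, fun v hv z hz => ?_⟩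
  have h1 := hK v hv z hz
  have hv' := P.Vstar_le hv
  have hz' := P.Z_le hz
  have h2 := (P.b 0).form_add_self_re v z
  change ‖P.ip₀.form v z‖ ≤ K * P.ip₀.norm v * P.ip₀.norm z at h1
  rw [P.ip₀_apply_of_mem hv', ← P.norm_b_of_mem hv', ← P.norm_b_of_mem hz'] at h1
  rw [(P.b 0).norm_sq (v + z), h2, ← NonnegForm.norm_sq, ← NonnegForm.norm_sq]
  have h3 := (neg_le_abs _).trans ((Complex.abs_re_le_norm _).trans h1)
  nlinarith [mul_nonneg hK0 (sq_nonneg ((P.b 0).norm v - (P.b 0).norm z))]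

theorem emb_comp_subtype_injective (U : Submodule ℂ H) :
    Function.Injective (P.emb.toLinearMap ∘ₗ U.subtype) :=
  P.emb_injective.comp Subtype.val_injective

theorem compactForm_restrict [CompleteSpace H] [CompleteSpace 𝓗] {U : Submodule ℂ H}
    (hU : IsClosed (U : Set H)) (hle : U ≤ P.V₀) :
    CompactForm (P.emb.toLinearMap ∘ₗ U.subtype) ((P.b 0).restrict U) := by
  have : CompleteSpace U := hU.completeSpace_coe
  obtain ⟨M, hM, h⟩ := P.exists_norm_b_equiv
  refine CompactForm.of_linearEquiv (G := U) (c := 1 / M ^ 2) (C := M ^ 2)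
    (LinearEquiv.refl ℂ U) (P.emb_comp_subtype_injective U) (fun q => P.d_le_b q) (by positivity)
    (fun g => ?_) (fun g => ?_) (P.emb ∘L U.subtypeL) (fun g => rfl)
    (P.emb_compact.comp_clm U.subtypeL)
  · change 1 / M ^ 2 * ‖(g : H)‖ ^ 2 ≤ ((P.b 0).form g g).re
    rw [← NonnegForm.norm_sq, one_div_mul_eq_div, div_le_iff₀ (by positivity)]
    calc ‖(g : H)‖ ^ 2 ≤ (M * (P.b 0).norm g) ^ 2 := by gcongr; exact (h g (hle g.2)).1
      _ = _ := by ring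
  · change ((P.b 0).form g g).re ≤ M ^ 2 * ‖(g : H)‖ ^ 2
    rw [← NonnegForm.norm_sq]
    calc (P.b 0).norm g ^ 2 ≤ (M * ‖(g : H)‖) ^ 2 := by
          have := (P.b 0).norm_nonneg' g
          gcongr
          exact (h g (hle g.2)).2
      _ = _ := by ring

/-- The identification of `V_⋆ × Z` with `V₀`. -/
def sumEquiv : (P.Vstar × P.Z) ≃ₗ[ℂ] P.V₀ :=
  LinearEquiv.ofBijective
    ((P.Vstar.subtype.coprod P.Z.subtype).codRestrict P.V₀ fun p =>
      add_mem (P.Vstar_le p.1.2) (P.Z_le p.2.2)) (by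
    constructor
    · rw [← LinearMap.ker_eq_bot, LinearMap.ker_eq_bot']
      rintro ⟨v, z⟩ h
      have h1 : (v : H) + z = 0 := congrArg Subtype.val h
      have h2 : (v : H) ∈ P.Vstar ⊓ P.Z :=
        ⟨v.2, by rw [eq_neg_of_add_eq_zero_left h1]; exact neg_mem z.2⟩
      rw [P.inf_eq, Submodule.mem_bot] at h2
      rw [h2, zero_add] at h1
      exact Prod.ext (Subtype.ext h2) (Subtype.ext h1)
    · rintro ⟨u, hu⟩
      have hu' : u ∈ P.Vstar ⊔ P.Z := P.sup_eq ▸ hu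
      obtain ⟨v, hv, z, hz, h⟩ := Submodule.mem_sup.1 hu'
      exact ⟨(⟨v, hv⟩, ⟨z, hz⟩), Subtype.ext h⟩)

theorem coe_sumEquiv (p : P.Vstar × P.Z) : (P.sumEquiv p : H) = p.1 + p.2 := rfl

theorem sumMap_apply (p : P.Vstar × P.Z) : P.sumMap p = P.emb ((p.1 : H) + p.2) := rfl

theorem sumMap_injective : Function.Injective P.sumMap :=
  P.emb_injective.comp (Subtype.val_injective.comp P.sumEquiv.injective)

theorem edim_prod : edim (P.Vstar × P.Z) = edim P.V₀ := edim_congr P.sumEquiv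

section Complete

variable [CompleteSpace H]

theorem limitForm_apply (ξ : EuclideanSpace ℝ (Fin n)) (p q : P.Vstar × P.Z) :
    P.limitForm ξ p q =
      P.homForm ξ (Submodule.inclusion P.Z_le p.2) (Submodule.inclusion P.Z_le q.2) +
        (P.b 0).form ((p.1 : H) + p.2) ((q.1 : H) + q.2) := rfl

/-- The form `𝕊_ξ` as a non-negative form. -/
def limitNonneg (ξ : EuclideanSpace ℝ (Fin n)) : NonnegForm (P.Vstar × P.Z) where
  form := P.limitForm ξ
  nonneg _ := add_nonneg (P.homForm_nonneg ξ _) ((P.b 0).nonneg _)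

theorem homForm_zero (v w : P.V₀) : P.homForm 0 v w = 0 := by
  have h := P.homForm_smul 0 0 v w
  rwa [zero_smul, Complex.ofReal_zero, zero_pow two_ne_zero, zero_mul] at h

theorem limitForm_zero (p q : P.Vstar × P.Z) :
    P.limitForm 0 p q = (P.b 0).form (P.sumEquiv p) (P.sumEquiv q) := by
  rw [limitForm_apply, homForm_zero, zero_add]
  rfl

theorem limitForm_smul_re (t : ℝ) (η : EuclideanSpace ℝ (Fin n)) (p : P.Vstar × P.Z) :
    ((P.limitNonneg (t • η)).form p p).re =
      t ^ 2 * (P.homForm η (Submodule.inclusion P.Z_le p.2) (Submodule.inclusion P.Z_le p.2)).re +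
        ((P.b 0).form (p.1 + p.2 : H) (p.1 + p.2)).re := by
  change (P.limitForm (t • η) p p).re = _
  rw [limitForm_apply, homForm_smul, Complex.add_re, ← Complex.re_ofReal_mul]
  push_cast
  rfl

/-- Bounds of the homogenised form on `Z` by `b₀` on `V_⋆ ∔ Z`. -/
theorem exists_homForm_le (ξ : EuclideanSpace ℝ (Fin n)) : ∃ C : ℝ, 0 ≤ C ∧
    ∀ p : P.Vstar × P.Z, (P.homForm ξ (Submodule.inclusion P.Z_le p.2)
      (Submodule.inclusion P.Z_le p.2)).re ≤ C * ((P.b 0).form (p.1 + p.2 : H) (p.1 + p.2)).re := by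
  obtain ⟨C, hC, h⟩ := P.homForm_re_le ξ
  obtain ⟨M, hM, hn⟩ := P.exists_norm_b_equiv
  obtain ⟨c, hc, ht⟩ := P.exists_transversal_b
  refine ⟨C * M ^ 2 / c, by positivity, fun p => (h _).trans ?_⟩
  rw [← NonnegForm.norm_sq, div_mul_eq_mul_div, le_div_iff₀ hc]
  have h1 := (hn p.2 (P.Z_le p.2.2)).1
  have h2 := ht p.1 p.1.2 p.2 p.2.2
  have h3 : ‖(p.2 : H)‖ ^ 2 ≤ (M * (P.b 0).norm p.2) ^ 2 := by gcongr
  have h4 : c * (P.b 0).norm p.2 ^ 2 ≤ (P.b 0).norm (p.1 + p.2 : H) ^ 2 :=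
    le_trans (by gcongr; nlinarith) h2
  calc C * ‖(p.2 : H)‖ ^ 2 * c ≤ C * (M * (P.b 0).norm p.2) ^ 2 * c := by gcongr
    _ = C * M ^ 2 * (c * (P.b 0).norm p.2 ^ 2) := by ring
    _ ≤ _ := by gcongr

theorem compactForm_limit [CompleteSpace 𝓗] (ξ : EuclideanSpace ℝ (Fin n)) :
    CompactForm P.sumMap (P.limitNonneg ξ) := by
  have : CompleteSpace P.Vstar := P.isClosed_Vstar.completeSpace_coe
  have : CompleteSpace P.Z := P.isClosed_Z.completeSpace_coe
  obtain ⟨M, hM, hn⟩ := P.exists_norm_b_equiv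
  obtain ⟨c, hc, ht⟩ := P.exists_transversal_b
  obtain ⟨C, hC, hh⟩ := P.exists_homForm_le ξ
  -- The product type carries the supremum norm, which is not Hilbertian; its `ℓ²` version is used
  -- instead.
  let e := WithLp.linearEquiv 2 ℂ (P.Vstar × P.Z)
  have hre : ∀ p : P.Vstar × P.Z, ((P.b 0).form (p.1 + p.2 : H) (p.1 + p.2)).re ≤
      ((P.limitNonneg ξ).form p p).re := by
    intro p
    change _ ≤ (P.limitForm ξ p p).re
    rw [limitForm_apply, Complex.add_re]
    linarith [(Complex.nonneg_iff.1 (P.homForm_nonneg ξ (Submodule.inclusion P.Z_le p.2))).1]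
  have hnorm : ∀ g : WithLp 2 (P.Vstar × P.Z),
      ‖g‖ ^ 2 = ‖((e g).1 : H)‖ ^ 2 + ‖((e g).2 : H)‖ ^ 2 := WithLp.prod_norm_sq_eq_of_L2
  let A : WithLp 2 (P.Vstar × P.Z) →L[ℂ] H :=
    (P.Vstar.subtypeL.coprod P.Z.subtypeL) ∘L
      (WithLp.prodContinuousLinearEquiv 2 ℂ P.Vstar P.Z : _ →L[ℂ] _)
  refine CompactForm.of_linearEquiv (G := WithLp 2 (P.Vstar × P.Z)) (c := c / M ^ 2)
    (C := (1 + C) * (2 * M ^ 2)) e P.sumMap_injective (fun q => (P.d_le_b _).trans (hre q))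
    (by positivity) (fun g => ?_) (fun g => ?_) (P.emb ∘L A) (fun g => rfl)
    (P.emb_compact.comp_clm A)
  · refine le_trans ?_ (hre _)
    rw [hnorm, ← NonnegForm.norm_sq, div_mul_eq_mul_div, div_le_iff₀ (by positivity)]
    have h1 : ‖((e g).1 : H)‖ ^ 2 ≤ (M * (P.b 0).norm (e g).1) ^ 2 := by
      gcongr
      exact (hn _ (P.Vstar_le (e g).1.2)).1
    have h2 : ‖((e g).2 : H)‖ ^ 2 ≤ (M * (P.b 0).norm (e g).2) ^ 2 := by
      gcongr
      exact (hn _ (P.Z_le (e g).2.2)).1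
    have h3 := ht _ (e g).1.2 _ (e g).2.2
    calc _ ≤ c * ((M * (P.b 0).norm (e g).1) ^ 2 + (M * (P.b 0).norm (e g).2) ^ 2) := by gcongr
      _ = c * ((P.b 0).norm (e g).1 ^ 2 + (P.b 0).norm (e g).2 ^ 2) * M ^ 2 := by ring
      _ ≤ _ := by gcongr
  · change (P.limitForm ξ (e g) (e g)).re ≤ _
    rw [limitForm_apply, Complex.add_re]
    have h1 := hh (e g)
    have h2 : ((P.b 0).form ((e g).1 + (e g).2 : H) ((e g).1 + (e g).2)).re ≤
        2 * M ^ 2 * ‖g‖ ^ 2 := by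
      rw [← NonnegForm.norm_sq, hnorm]
      have h3 := (hn _ (add_mem (P.Vstar_le (e g).1.2) (P.Z_le (e g).2.2))).2
      have h4 := norm_add_le ((e g).1 : H) (e g).2
      have h5 := (P.b 0).norm_nonneg' ((e g).1 + (e g).2 : H)
      calc _ ≤ (M * (‖((e g).1 : H)‖ + ‖((e g).2 : H)‖)) ^ 2 := by
            gcongr
            exact h3.trans (by gcongr)
        _ ≤ _ := by
          nlinarith [mul_nonneg (sq_nonneg M) (sq_nonneg (‖((e g).1 : H)‖ - ‖((e g).2 : H)‖))]
    nlinarith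

theorem isEigenvalueList_limitOp_zero {ev : ℕ → ℝ} (h : IsEigenvalueList P.B₀ (edim P.V₀) ev) :
    IsEigenvalueList (P.limitOp 0) (edim P.V₀) ev := by
  rw [B₀, isEigenvalueList_iff (P.emb_comp_subtype_injective _)] at h
  rw [limitOp, isEigenvalueList_iff P.sumMap_injective]
  refine ⟨h.1, fun μ => ?_⟩
  rw [h.2]
  exact (edim_formEigenvectors_congr P.sumEquiv (fun q => rfl)
    (fun p q => (P.limitForm_zero p q).symm) μ).symm

end Complete

end DegenerateProblem

/-! ### The band representation -/

theorem pos_of_penalized {ε B β ζ T c : ℝ} (hε : 0 < ε) (hT : B ^ 2 / ε + 1 ≤ T * c + (1 - B))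
    (hpos : β ≠ 0 ∨ ζ ≠ 0) :
    0 < ε * β ^ 2 - 2 * B * β * ζ + (T * c + (1 - B)) * ζ ^ 2 := by
  have h1 : (B ^ 2 / ε + 1) * ζ ^ 2 ≤ (T * c + (1 - B)) * ζ ^ 2 := by gcongr
  -- Completing the square in `β` costs exactly `B² / ε` of the coefficient of `ζ²`; the extra `1`
  -- gives strict positivity when `ζ ≠ 0`.
  have h2 : ε * β ^ 2 - 2 * B * β * ζ + (B ^ 2 / ε + 1) * ζ ^ 2 =
      (ε * β - B * ζ) ^ 2 / ε + ζ ^ 2 := by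
    field_simp
    ring
  have h3 : 0 < (ε * β - B * ζ) ^ 2 / ε + ζ ^ 2 := by
    rcases eq_or_ne ζ 0 with rfl | h
    · have hβ' : β ≠ 0 := by simpa using hpos
      have : ε * β - B * 0 ≠ 0 := by simp [hε.ne', hβ']
      positivity
    · positivity
  linarith

namespace DegenerateProblem

open Filter Topology

variable {n : ℕ} {H 𝓗 : Type*} [NormedAddCommGroup H] [InnerProductSpace ℂ H]
  [NormedAddCommGroup 𝓗] [InnerProductSpace ℂ 𝓗] (P : DegenerateProblem n H 𝓗)

/-- The union of the bands `[ev₀ k, evs k]`, the `k`-th band being unbounded if `evs k` does not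
exist. -/
def bands (ev₀ evs : ℕ → ℝ) : Set ℝ :=
  {r | ∃ k : ℕ, (k : ℕ∞) < edim P.V₀ ∧ ev₀ k ≤ r ∧ ((k : ℕ∞) < edim P.Vstar → r ≤ evs k)}

variable {P}
variable {ev₀ evs ev : ℕ → ℝ} {ξ η : EuclideanSpace ℝ (Fin n)}

theorem bands_of_edim_eq_top (htop : edim P.Vstar = ⊤) :
    P.bands ev₀ evs = ⋃ k : ℕ, Set.Icc (ev₀ k) (evs k) := by
  have htop' : edim P.V₀ = ⊤ := top_le_iff.1 (htop ▸ edim_mono P.Vstar_le)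
  ext r
  simp [bands, htop, htop']

theorem bands_of_edim_eq (h₀ : IsEigenvalueList P.B₀ (edim P.V₀) ev₀) (hZ : P.Z ≠ ⊥) {N : ℕ}
    (hN : edim P.Vstar = N) :
    P.bands ev₀ evs = (⋃ k ∈ Set.Iio N, Set.Icc (ev₀ k) (evs k)) ∪ Set.Ici (ev₀ N) := by
  -- A nonzero element of `Z` is independent of `V_⋆`, so `V₀` has dimension at least `N + 1` and
  -- the unbounded band does occur.
  have hN' : (N : ℕ∞) < edim P.V₀ := by
    obtain ⟨z, hz, hz0⟩ := (Submodule.ne_bot_iff _).1 hZ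
    obtain ⟨u, hu⟩ := exists_linearIndependent_of_le_edim (V := P.Vstar) hN.ge
    have h1 : LinearIndependent ℂ (Fin.cons z fun i => (u i : H) : Fin (N + 1) → H) := by
      refine LinearIndependent.finCons (hu.map' P.Vstar.subtype (Submodule.ker_subtype _)) ?_
      intro hmem
      have h2 : z ∈ P.Vstar := (Submodule.span_le.2 (by rintro _ ⟨i, rfl⟩; exact (u i).2)) hmem
      have h3 : z ∈ P.Vstar ⊓ P.Z := ⟨h2, hz⟩
      rw [P.inf_eq, Submodule.mem_bot] at h3
      exact hz0 h3
    have h2 : ∀ i, (Fin.cons z fun i => (u i : H) : Fin (N + 1) → H) i ∈ P.V₀ := by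
      intro i
      refine Fin.cases ?_ (fun i => ?_) i
      · exact P.Z_le hz
      · exact P.Vstar_le (u i).2
    have h3 : LinearIndependent ℂ fun i => (⟨_, h2 i⟩ : P.V₀) :=
      LinearIndependent.of_comp P.V₀.subtype h1
    have h4 := h3.cardinal_lift_le_rank
    simp only [Cardinal.mk_fin, Cardinal.lift_natCast] at h4
    have h5 : ((N + 1 : ℕ) : ℕ∞) ≤ edim P.V₀ := Cardinal.natCast_le_toENat.2 (by simpa using h4)
    exact lt_of_lt_of_le (by exact_mod_cast Nat.lt_succ_self N) h5
  ext r
  simp only [bands, hN, Set.mem_ofPred_eq, Set.mem_union, Set.mem_iUnion, Set.mem_Iio, Set.mem_Icc,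
    Set.mem_Ici, Nat.cast_lt, exists_prop]
  constructor
  · rintro ⟨k, hk, h1, h2⟩
    rcases lt_or_ge k N with hkN | hkN
    · exact Or.inl ⟨k, hkN, h1, h2 hkN⟩
    -- All bands with index at least `N` are half-lines, contained in the one with index `N`.
    · exact Or.inr ((h₀.mono N k hkN hk).trans h1)
  · rintro (⟨k, hkN, h1, h2⟩ | h1)
    · exact ⟨k, lt_trans (by exact_mod_cast hkN) hN', h1, fun _ => h2⟩
    · exact ⟨N, hN', h1, fun h => absurd h (lt_irrefl _)⟩

variable (P) [CompleteSpace H] [CompleteSpace 𝓗]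

theorem compactForm_V₀ :
    CompactForm (P.emb.toLinearMap ∘ₗ P.V₀.subtype) ((P.b 0).restrict P.V₀) :=
  P.compactForm_restrict (P.isClosed_nullSpace P.zero_mem) le_rfl

theorem compactForm_Vstar :
    CompactForm (P.emb.toLinearMap ∘ₗ P.Vstar.subtype) ((P.b 0).restrict P.Vstar) :=
  P.compactForm_restrict P.isClosed_Vstar P.Vstar_le

variable {P}

/-- Every trial space in `V_⋆` is also one in `V₀`. -/
theorem ev₀_le_evs (h₀ : IsEigenvalueList P.B₀ (edim P.V₀) ev₀)
    (hs : IsEigenvalueList P.Bstar (edim P.Vstar) evs) {k : ℕ} (hk : (k : ℕ∞) < edim P.Vstar) :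
    ev₀ k ≤ evs k := by
  have hk' := lt_of_lt_of_le hk (edim_mono P.Vstar_le)
  rw [P.compactForm_V₀.list_le_iff h₀ hk']
  exact ((P.compactForm_Vstar.list_le_iff hs hk).1 le_rfl).map
    (Submodule.inclusion P.Vstar_le) (Submodule.inclusion_injective _) fun w h => h

theorem ev₀_le_limit (h₀ : IsEigenvalueList P.B₀ (edim P.V₀) ev₀)
    (h : IsEigenvalueList (P.limitOp ξ) (edim P.V₀) ev) {k : ℕ} (hk : (k : ℕ∞) < edim P.V₀) :
    ev₀ k ≤ ev k := by
  rw [P.compactForm_V₀.list_le_iff h₀ hk]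
  rw [← P.edim_prod] at h hk
  refine (((P.compactForm_limit ξ).list_le_iff h hk).1 le_rfl).map
    (P.sumEquiv : _ →ₗ[ℂ] _) P.sumEquiv.injective fun w hw => le_trans ?_ hw
  change ((P.b 0).form (w.1 + w.2 : H) (w.1 + w.2)).re ≤ (P.limitForm ξ w w).re
  rw [limitForm_apply, Complex.add_re]
  linarith [(Complex.nonneg_iff.1 (P.homForm_nonneg ξ (Submodule.inclusion P.Z_le w.2))).1]

/-- The homogenised form sees only the `Z`-component, so on `V_⋆` the form of `𝕃_ξ` is `b₀` for
every `ξ`. -/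
theorem limit_le_evs (hs : IsEigenvalueList P.Bstar (edim P.Vstar) evs)
    (h : IsEigenvalueList (P.limitOp ξ) (edim P.V₀) ev) {k : ℕ} (hk : (k : ℕ∞) < edim P.Vstar) :
    ev k ≤ evs k := by
  have hk' := lt_of_lt_of_le hk (edim_mono P.Vstar_le)
  rw [← P.edim_prod] at h hk'
  rw [(P.compactForm_limit ξ).list_le_iff h hk']
  refine ((P.compactForm_Vstar.list_le_iff hs hk).1 le_rfl).map
    (LinearMap.inl ℂ P.Vstar P.Z) LinearMap.inl_injective fun w hw => ?_
  have e1 : (P.limitNonneg ξ).form (LinearMap.inl ℂ P.Vstar P.Z w) (LinearMap.inl ℂ P.Vstar P.Z w) =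
      (P.b 0).form w w := by
    change P.limitForm ξ (w, 0) (w, 0) = _
    rw [limitForm_apply]
    simp
  have e2 : P.sumMap (LinearMap.inl ℂ P.Vstar P.Z w) = P.emb w := by
    simp [sumMap_apply]
  rw [e1, e2]
  exact hw

theorem exists_limit_list (ξ : EuclideanSpace ℝ (Fin n)) :
    ∃ ev : ℕ → ℝ, IsEigenvalueList (P.limitOp ξ) (edim P.V₀) ev := by
  have := (P.compactForm_limit ξ).exists_isEigenvalueList
  rwa [P.edim_prod] at this

theorem opSpectrum_limitOp (h : IsEigenvalueList (P.limitOp ξ) (edim P.V₀) ev) :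
    opSpectrum (P.limitOp ξ) = Complex.ofReal '' {r | ∃ k : ℕ, (k : ℕ∞) < edim P.V₀ ∧ ev k = r} := by
  rw [← P.edim_prod] at h ⊢
  exact (P.compactForm_limit ξ).opSpectrum_eq_of_list h

theorem opSpectrum_limitOp_subset (h₀ : IsEigenvalueList P.B₀ (edim P.V₀) ev₀)
    (hs : IsEigenvalueList P.Bstar (edim P.Vstar) evs) (ξ : EuclideanSpace ℝ (Fin n)) :
    opSpectrum (P.limitOp ξ) ⊆ Complex.ofReal '' P.bands ev₀ evs := by
  obtain ⟨ev, h⟩ := P.exists_limit_list ξ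
  rw [opSpectrum_limitOp h]
  refine Set.image_mono ?_
  rintro _ ⟨k, hk, rfl⟩
  exact ⟨k, hk, ev₀_le_limit h₀ h hk, fun hk' => limit_le_evs hs h hk'⟩

/-- An infinite union of closed bands is closed because it is locally finite: only finitely many
lower ends lie below any given number. -/
theorem isClosed_bands (h₀ : IsEigenvalueList P.B₀ (edim P.V₀) ev₀) :
    IsClosed (P.bands ev₀ evs) := by
  have e : P.bands ev₀ evs = ⋃ k : {k : ℕ // (k : ℕ∞) < edim P.V₀},
      {r | ev₀ k ≤ r ∧ (((k : ℕ) : ℕ∞) < edim P.Vstar → r ≤ evs k)} := by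
    ext r
    simp [bands, and_left_comm]
  rw [e]
  refine LocallyFinite.isClosed_iUnion (fun r => ?_) fun k => ?_
  · refine ⟨Set.Iio (r + 1), Iio_mem_nhds (by linarith), ?_⟩
    refine ((P.compactForm_V₀.finite_list_le h₀ (r + 1)).preimage
      Subtype.val_injective.injOn).subset ?_
    rintro k ⟨x, ⟨hx, -⟩, hxr⟩
    exact ⟨k.2, hx.trans (le_of_lt hxr)⟩
  · by_cases hk : ((k : ℕ) : ℕ∞) < edim P.Vstar
    · simp only [hk, forall_const]
      exact isClosed_Icc (a := ev₀ k) (b := evs k)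
    · simp only [hk, false_imp_iff, and_true]
      exact isClosed_Ici (a := ev₀ k)

/-- For large parameters the `k`-th eigenvalue of `𝕃_ξ` exceeds every number that is less than
`evs k`. -/
theorem exists_lt_limit (h₀ : IsEigenvalueList P.B₀ (edim P.V₀) ev₀)
    (hs : IsEigenvalueList P.Bstar (edim P.Vstar) evs) (hη : η ≠ 0) {k : ℕ}
    (hk : (k : ℕ∞) < edim P.V₀) {r : ℝ} (hr₀ : ev₀ k < r)
    (hrs : (k : ℕ∞) < edim P.Vstar → r < evs k) :
    ∃ T : ℝ, 0 ≤ T ∧ ∀ ev, IsEigenvalueList (P.limitOp (√T • η)) (edim P.V₀) ev → r < ev k := by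
  obtain ⟨m, e, r', hm, hle, hgt, -, -, -, hr', horth⟩ :=
    P.compactForm_Vstar.exists_spectral_cut hs r
  have hr1 : 1 < r := (P.compactForm_V₀.one_le_list h₀ hk).trans_lt hr₀
  have hmk : m ≤ k := by
    by_contra hc
    push Not at hc
    have h1 : (k : ℕ∞) < edim P.Vstar := lt_of_lt_of_le (by exact_mod_cast hc) hm
    exact absurd (hle k hc) (not_le.2 (hrs h1))
  obtain ⟨c, hc, hcoer⟩ := P.le_homForm_re hη
  obtain ⟨M, hM, hn⟩ := P.exists_norm_b_equiv
  -- This is the fraction of `b₀[v]` left after subtracting `r d₀[v]`, for `v ∈ V_⋆` orthogonal to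
  -- the eigenvectors below the cut.
  set ε : ℝ := 1 - r / r' with hε
  have hεpos : 0 < ε := by
    rw [hε, sub_pos, div_lt_one (by linarith)]
    exact hr'
  set B : ℝ := 1 + r with hB
  set c' : ℝ := c / M ^ 2 with hc'
  have hc'pos : 0 < c' := by positivity
  -- Chosen so that the hypothesis of `pos_of_penalized` holds with equality; `B = 1 + r` bounds the
  -- cross terms of `b₀` and of `r d₀`.
  set T : ℝ := (B ^ 2 / ε + 1 + r) / c' with hT
  have hT0 : 0 ≤ T := by positivity
  have hTc : B ^ 2 / ε + 1 ≤ T * c' + (1 - B) := by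
    have : T * c' = B ^ 2 / ε + 1 + r := by rw [hT, div_mul_cancel₀ _ hc'pos.ne']
    rw [this]
    linarith
  refine ⟨T, hT0, fun ev h => ?_⟩
  by_contra hcon
  push Not at hcon
  rw [← P.edim_prod] at h hk
  obtain ⟨u, hu, hform⟩ := ((P.compactForm_limit _).list_le_iff h hk).1 hcon
  -- Only the `V_⋆`-component is made orthogonal to the `m ≤ k` low eigenvectors; the `Z`-component
  -- is left to the penalty.
  obtain ⟨w, hw, hw0, hl⟩ := hu.exists_mem_span_apply_eq_zero (Nat.lt_succ_of_le hmk)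
    fun i => (innerₛₗ ℂ (P.emb (e i))) ∘ₗ P.emb.toLinearMap ∘ₗ P.Vstar.subtype ∘ₗ
      LinearMap.fst ℂ P.Vstar P.Z
  have h1 := hform w hw
  rw [limitForm_smul_re, Real.sq_sqrt hT0, sumMap_apply] at h1
  obtain ⟨v, z⟩ := w
  simp only at h1
  have hv : r' * ‖P.emb v‖ ^ 2 ≤ (P.b 0).norm v ^ 2 := by
    rw [NonnegForm.norm_sq]
    exact horth v hl
  have hz := hcoer (Submodule.inclusion P.Z_le z) z.2
  have hz' : c' * (P.b 0).norm z ^ 2 ≤ c * ‖(z : H)‖ ^ 2 := by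
    have h2 := (hn z (P.Z_le z.2)).2
    have h3 := (P.b 0).norm_nonneg' z
    calc c' * (P.b 0).norm z ^ 2 ≤ c' * (M * ‖(z : H)‖) ^ 2 := by gcongr
      _ = _ := by rw [hc']; field_simp
  have hb := (P.b 0).form_add_self_re v z
  rw [← NonnegForm.norm_sq (P.b 0) v, ← NonnegForm.norm_sq (P.b 0) z] at hb
  have hb2 := (neg_le_abs _).trans ((P.b 0).re_apply_le v z)
  have hd : ‖P.emb (v + z : H)‖ ^ 2 ≤ ‖P.emb v‖ ^ 2 +
      2 * ((P.b 0).norm v * (P.b 0).norm z) + (P.b 0).norm z ^ 2 := by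
    have e1 := P.norm_emb_le v
    have e2 := P.norm_emb_le z
    have e3 : ‖P.emb (v + z : H)‖ ≤ ‖P.emb v‖ + ‖P.emb z‖ := by
      rw [map_add]
      exact norm_add_le _ _
    calc ‖P.emb (v + z : H)‖ ^ 2 ≤ (‖P.emb v‖ + ‖P.emb z‖) ^ 2 := by gcongr
      _ = ‖P.emb v‖ ^ 2 + 2 * (‖P.emb v‖ * ‖P.emb z‖) + ‖P.emb z‖ ^ 2 := by ring
      _ ≤ _ := by
        have := (P.b 0).norm_nonneg' v
        gcongr
  have hne : (P.b 0).norm v ≠ 0 ∨ (P.b 0).norm z ≠ 0 := by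
    by_contra hno
    push Not at hno
    refine hw0 (Prod.ext (Subtype.ext ?_) (Subtype.ext ?_))
    · have := (hn v (P.Vstar_le v.2)).1
      rw [hno.1, mul_zero] at this
      exact norm_le_zero_iff.1 this
    · have := (hn z (P.Z_le z.2)).1
      rw [hno.2, mul_zero] at this
      exact norm_le_zero_iff.1 this
  have hpos := pos_of_penalized hεpos hTc hne
  have hv2 : r * ‖P.emb v‖ ^ 2 ≤ r / r' * (P.b 0).norm v ^ 2 := by
    have hr'0 : 0 < r' := by linarith
    calc r * ‖P.emb v‖ ^ 2 = r / r' * (r' * ‖P.emb v‖ ^ 2) := by field_simp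
      _ ≤ _ := by gcongr
  have hz2 : T * (c' * (P.b 0).norm z ^ 2) ≤
      T * (P.homForm η (Submodule.inclusion P.Z_le z) (Submodule.inclusion P.Z_le z)).re := by
    gcongr
    exact hz'.trans hz
  have hd2 := mul_le_mul_of_nonneg_left hd (show (0 : ℝ) ≤ r by linarith)
  have key : ε * (P.b 0).norm v ^ 2 = (P.b 0).norm v ^ 2 - r / r' * (P.b 0).norm v ^ 2 := by
    rw [hε]
    ring
  rw [hB] at hpos
  nlinarith

/-- Since the form is affine in `τ` and its slope is at most `C b₀`, the form at `τ` is at most `1 +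
C a` times the form at `σ`. With `a = 0` this gives monotonicity of eigenvalues, with `a = |τ - σ|`
a Lipschitz bound. -/
theorem limit_le_of_le {σ τ C a : ℝ} (hC : 0 ≤ C) (hσ : 0 ≤ σ) (hτ : 0 ≤ τ)
    (hbound : ∀ p : P.Vstar × P.Z, (P.homForm η (Submodule.inclusion P.Z_le p.2)
      (Submodule.inclusion P.Z_le p.2)).re ≤ C * ((P.b 0).form (p.1 + p.2 : H) (p.1 + p.2)).re)
    (ha : 0 ≤ a) (hστ : τ - σ ≤ a) {f g : ℕ → ℝ}
    (hf : IsEigenvalueList (P.limitOp (√σ • η)) (edim P.V₀) f)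
    (hg : IsEigenvalueList (P.limitOp (√τ • η)) (edim P.V₀) g) {k : ℕ}
    (hk : (k : ℕ∞) < edim P.V₀) : g k ≤ (1 + C * a) * f k := by
  rw [← P.edim_prod] at hf hg hk
  rw [(P.compactForm_limit _).list_le_iff hg hk]
  refine (((P.compactForm_limit _).list_le_iff hf hk).1 le_rfl).map LinearMap.id
    Function.injective_id fun w hw => ?_
  have h1 := hbound w
  have h2 := (Complex.nonneg_iff.1 (P.homForm_nonneg η (Submodule.inclusion P.Z_le w.2))).1
  rw [limitForm_smul_re, Real.sq_sqrt hσ] at hw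
  rw [LinearMap.id_apply, limitForm_smul_re, Real.sq_sqrt hτ]
  set A := (P.homForm η (Submodule.inclusion P.Z_le w.2) (Submodule.inclusion P.Z_le w.2)).re
  set b := ((P.b 0).form (w.1 + w.2 : H) (w.1 + w.2)).re
  have h3 : (τ - σ) * A ≤ a * A := by gcongr
  have h4 : a * A ≤ a * (C * b) := by gcongr
  have h5 : 0 ≤ C * a * (σ * A) := by positivity
  calc τ * A + b ≤ (1 + C * a) * (σ * A + b) := by nlinarith
    _ ≤ (1 + C * a) * (f k * ‖P.sumMap w‖ ^ 2) := by gcongr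
    _ = _ := by ring

/-- Every point in the interior of a band is an eigenvalue of some `𝕃_ξ`. -/
theorem exists_mem_opSpectrum (hn : 1 ≤ n) (h₀ : IsEigenvalueList P.B₀ (edim P.V₀) ev₀)
    (hs : IsEigenvalueList P.Bstar (edim P.Vstar) evs) {k : ℕ} (hk : (k : ℕ∞) < edim P.V₀)
    {r : ℝ} (hr₀ : ev₀ k < r) (hrs : (k : ℕ∞) < edim P.Vstar → r < evs k) :
    ∃ ξ, (r : ℂ) ∈ opSpectrum (P.limitOp ξ) := by
  obtain ⟨η, hη⟩ : ∃ η : EuclideanSpace ℝ (Fin n), η ≠ 0 :=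
    ⟨EuclideanSpace.single ⟨0, hn⟩ 1, by simp⟩
  -- The square root turns the quadratic dependence on `ξ` into an affine one in `τ`.
  choose f hf using fun τ : ℝ => P.exists_limit_list (√τ • η)
  obtain ⟨C, hC, hbound⟩ := P.exists_homForm_le η
  obtain ⟨T, hT, hTr⟩ := exists_lt_limit h₀ hs hη hk hr₀ hrs
  have hmono : ∀ σ τ : ℝ, 0 ≤ τ → τ ≤ σ → f τ k ≤ f σ k := by
    intro σ τ hτ hle
    have := limit_le_of_le hC (hτ.trans hle) hτ hbound le_rfl (sub_nonpos.2 hle) (hf σ) (hf τ) hk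
    simpa using this
  have hnn : ∀ τ, 0 ≤ f τ k := by
    intro τ
    have := ev₀_le_limit h₀ (hf τ) hk
    linarith [P.compactForm_V₀.one_le_list h₀ hk]
  have hlip : ∀ σ ∈ Set.Icc 0 T, ∀ τ ∈ Set.Icc 0 T, f τ k - f σ k ≤ C * f T k * |τ - σ| := by
    intro σ hσ τ hτ
    have h1 := limit_le_of_le hC hσ.1 hτ.1 hbound (abs_nonneg _) (le_abs_self (τ - σ))
      (hf σ) (hf τ) hk
    have h2 : C * |τ - σ| * f σ k ≤ C * |τ - σ| * f T k := by
      gcongr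
      exact hmono _ _ hσ.1 hσ.2
    linarith
  have hcont : ContinuousOn (fun τ => f τ k) (Set.Icc 0 T) := by
    refine (LipschitzOnWith.of_dist_le_mul (K := ⟨C * f T k, mul_nonneg hC (hnn T)⟩)
      fun σ hσ τ hτ => ?_).continuousOn
    rw [Real.dist_eq, Real.dist_eq, abs_le]
    have h1 := hlip σ hσ τ hτ
    have h2 := hlip τ hτ σ hσ
    rw [abs_sub_comm] at h1
    constructor
    · exact neg_le.1 (by rw [neg_sub]; exact h1)
    · exact h2
  -- The chosen list at `τ = 0` and `ev₀` belong to the same operator; minimax identifies their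
  -- entries.
  have h0 : f 0 k ≤ r := by
    have h1 := hf 0
    rw [Real.sqrt_zero, zero_smul, ← P.edim_prod] at h1
    have h2 := P.isEigenvalueList_limitOp_zero h₀
    rw [← P.edim_prod] at h2 hk
    refine le_trans ?_ hr₀.le
    rw [(P.compactForm_limit 0).list_le_iff h1 hk]
    exact ((P.compactForm_limit 0).list_le_iff h2 hk).1 le_rfl
  obtain ⟨τ, -, hτ⟩ := intermediate_value_Icc hT hcont ⟨h0, (hTr _ (hf T)).le⟩
  refine ⟨√τ • η, ?_⟩
  rw [opSpectrum_limitOp (hf τ)]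
  exact ⟨r, ⟨k, hk, hτ⟩, rfl⟩

/-- This holds without assuming `Z ≠ 0`: the bands of `bands` are indexed by the dimension of `V₀`,
so no unbounded band appears when `Z = 0`. -/
theorem limitSpectrum_eq_bands (hn : 1 ≤ n) (h₀ : IsEigenvalueList P.B₀ (edim P.V₀) ev₀)
    (hs : IsEigenvalueList P.Bstar (edim P.Vstar) evs) :
    P.limitSpectrum = Complex.ofReal '' P.bands ev₀ evs := by
  refine Set.Subset.antisymm ?_ ?_
  · refine closure_minimal (Set.iUnion_subset fun ξ => opSpectrum_limitOp_subset h₀ hs ξ) ?_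
    exact Complex.isometry_ofReal.isClosedEmbedding.isClosedMap _ (isClosed_bands h₀)
  · rintro _ ⟨r, ⟨k, hk, hr₀, hrs⟩, rfl⟩
    -- Lower ends are eigenvalues of `𝕃_0`.
    rcases hr₀.eq_or_lt with rfl | hlt
    · refine subset_closure (Set.mem_iUnion.2 ⟨0, ?_⟩)
      rw [opSpectrum_limitOp (P.isEigenvalueList_limitOp_zero h₀)]
      exact ⟨_, ⟨k, hk, rfl⟩, rfl⟩
    by_cases hlt' : (k : ℕ∞) < edim P.Vstar → r < evs k
    · exact subset_closure (Set.mem_iUnion.2 (exists_mem_opSpectrum hn h₀ hs hk hlt hlt'))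
    · push Not at hlt'
      obtain ⟨hk', hge⟩ := hlt'
      have hr : r = evs k := le_antisymm (hrs hk') hge
      -- An upper end may be reached only as `ξ → ∞`; it is a limit of interior points of its band.
      have h1 : r ∈ closure (Set.Ioo (ev₀ k) r) := by
        rw [closure_Ioo hlt.ne]
        exact ⟨hlt.le, le_rfl⟩
      have h2 := image_closure_subset_closure_image Complex.continuous_ofReal ⟨r, h1, rfl⟩
      refine closure_mono ?_ h2
      rintro _ ⟨x, hx, rfl⟩
      exact Set.mem_iUnion.2 (exists_mem_opSpectrum hn h₀ hs hk hx.1 fun _ => hr ▸ hx.2)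

end DegenerateProblem

/-! ### The `β`-function as a Schur complement -/

namespace DegenerateProblem

variable {n : ℕ} {H 𝓗 : Type*} [NormedAddCommGroup H] [InnerProductSpace ℂ H]
  [NormedAddCommGroup 𝓗] [InnerProductSpace ℂ 𝓗] (P : DegenerateProblem n H 𝓗)

/-- The form `b₀ - λ d₀`. -/
def shiftedForm (lam : ℝ) : H →ₗ[ℂ] H →ₗ⋆[ℂ] ℂ :=
  LinearMap.mk₂'ₛₗ (RingHom.id ℂ) (starRingEnd ℂ)
    (fun u w => (P.b 0).form u w - lam * ⟪P.emb w, P.emb u⟫_ℂ)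
    (by intros; simp; ring)
    (by intros; simp; ring)
    (by intros; simp; ring)
    (by intros; simp; ring)

theorem shiftedForm_apply (lam : ℝ) (u w : H) :
    P.shiftedForm lam u w = (P.b 0).form u w - lam * ⟪P.emb w, P.emb u⟫_ℂ := rfl

theorem shiftedForm_conj (lam : ℝ) (u w : H) :
    (starRingEnd ℂ) (P.shiftedForm lam u w) = P.shiftedForm lam w u := by
  rw [shiftedForm_apply, shiftedForm_apply, map_sub, map_mul, NonnegForm.conj_symm,
    Complex.conj_ofReal, inner_conj_symm]

theorem shiftedForm_self_re (lam : ℝ) (u : H) :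
    (P.shiftedForm lam u u).re = ((P.b 0).form u u).re - lam * ‖P.emb u‖ ^ 2 := by
  rw [shiftedForm_apply, Complex.sub_re, Complex.re_ofReal_mul]
  congr 2
  exact (@norm_sq_eq_re_inner ℂ _ _ _ _ (P.emb u)).symm

theorem shiftedForm_self_im (lam : ℝ) (u : H) : (P.shiftedForm lam u u).im = 0 :=
  Complex.conj_eq_iff_im.1 (P.shiftedForm_conj lam u u)

variable {P} in
theorem shiftedForm_add_self {lam : ℝ} {u v : H} (h : P.shiftedForm lam u v = 0) :
    (P.shiftedForm lam (u + v) (u + v)).re =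
      (P.shiftedForm lam u u).re + (P.shiftedForm lam v v).re := by
  have h' : P.shiftedForm lam v u = 0 := by rw [← shiftedForm_conj, h, map_zero]
  simp only [map_add, LinearMap.add_apply, h, h', add_zero, zero_add, Complex.add_re]

variable [CompleteSpace 𝓗]

/-- The resolvent of `𝐁_⋆` in weak form; the projection onto the closure of `V_⋆` disappears when
tested against `V_⋆`. -/
theorem exists_resolvent_solution {lam : ℝ} (hlam : (lam : ℂ) ∉ opSpectrum P.Bstar) (z : P.Z) :
    ∃ v : P.Vstar,
      P.emb v = opResolvent P.Bstar (lam : ℂ) (P.Vbar.orthogonalProjectionOnto (P.emb z)) ∧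
      ∀ v' ∈ P.Vstar, P.shiftedForm lam v v' = ⟪P.emb v', P.emb z⟫_ℂ := by
  have hex : ∃ R, IsResolventAt P.Bstar (lam : ℂ) R := not_not.1 hlam
  have hR : IsResolventAt P.Bstar (lam : ℂ) (opResolvent P.Bstar (lam : ℂ)) := by
    rw [opResolvent, dif_pos hex]
    exact hex.choose_spec
  set R := opResolvent P.Bstar (lam : ℂ)
  set x := P.Vbar.orthogonalProjectionOnto (P.emb z) with hx
  obtain ⟨hdom, hTx⟩ := hR.1 x
  obtain ⟨v, hv, hs⟩ := (mem_formOperator_graph (P.emb_comp_subtype_injective P.Vstar)).1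
    (LinearPMap.mem_graph P.Bstar ⟨R x, hdom⟩)
  refine ⟨v, hv, fun v' hv' => ?_⟩
  have h1 : (P.b 0).form v v' = ⟪P.emb v', (P.Bstar ⟨R x, hdom⟩ : 𝓗)⟫_ℂ := hs ⟨v', hv'⟩
  have h2 : P.Bstar ⟨R x, hdom⟩ = x + (lam : ℂ) • R x := sub_eq_iff_eq_add.1 hTx
  have hv2 : P.emb v = (R x : 𝓗) := hv
  have h3 : ⟪P.emb v', (x : 𝓗)⟫_ℂ = ⟪P.emb v', P.emb z⟫_ℂ :=
    Submodule.inner_orthogonalProjectionOnto_eq_of_mem_left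
      (⟨P.emb v', mem_formSpace (P.emb.toLinearMap ∘ₗ P.Vstar.subtype) ⟨v', hv'⟩⟩ : P.Vbar) (P.emb z)
  rw [shiftedForm_apply, h1, h2, hv2, Submodule.coe_add, Submodule.coe_smul, inner_add_right,
    inner_smul_right, h3]
  ring

/-- The `β`-form is the Schur complement of `b₀ - λ d₀` with respect to `V_⋆`. -/
theorem exists_schur (horth : ∀ z ∈ P.Z, ∀ v ∈ P.Vstar,
      (P.b 0).form z v = inner ℂ (P.emb v) (P.emb z))
    {lam : ℝ} (hlam : (lam : ℂ) ∉ opSpectrum P.Bstar) (z : P.Z) :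
    ∃ v ∈ P.Vstar, (∀ v' ∈ P.Vstar, P.shiftedForm lam (v + z) v' = 0) ∧
      P.betaForm lam z z = -P.shiftedForm lam (v + z) (v + z) := by
  obtain ⟨v, hv, hs⟩ := P.exists_resolvent_solution hlam z
  -- By the choice of `Z`, the shifted form of `z` against `V_⋆` is `(1 - λ) d₀(z, ·)`, so `λ - 1`
  -- times the resolvent solution cancels it.
  have hort : ∀ v' ∈ P.Vstar, P.shiftedForm lam (((lam : ℂ) - 1) • (v : H) + z) v' = 0 := by
    intro v' hv'
    rw [map_add, map_smul, LinearMap.add_apply, LinearMap.smul_apply, hs v' hv', shiftedForm_apply,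
      horth z z.2 v' hv', smul_eq_mul]
    ring
  refine ⟨_, P.Vstar.smul_mem _ v.2, hort, ?_⟩
  have h1 : P.shiftedForm lam (((lam : ℂ) - 1) • (v : H) + z) (((lam : ℂ) - 1) • (v : H) + z) =
      P.shiftedForm lam (((lam : ℂ) - 1) • (v : H) + z) z := by
    rw [map_add (P.shiftedForm lam (((lam : ℂ) - 1) • (v : H) + z)),
      hort _ (P.Vstar.smul_mem _ v.2), zero_add]
  have h2 : (P.b 0).form v z = ⟪P.emb z, P.emb v⟫_ℂ := by
    rw [← NonnegForm.conj_symm, horth z z.2 v v.2, inner_conj_symm]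
  have h3 : ⟪P.toZbar z, P.betaOp lam (P.toZbar z)⟫_ℂ =
      lam * ⟪P.emb z, P.emb z⟫_ℂ + ((lam : ℂ) - 1) ^ 2 * ⟪P.emb z, P.emb v⟫_ℂ := by
    rw [betaOp, add_apply, inner_add_right, smul_apply, smul_apply, inner_smul_right,
      inner_smul_right]
    congr 2
    rw [hv]
    exact Submodule.inner_orthogonalProjectionOnto_eq_of_mem_left (P.toZbar z) _
  rw [betaForm, h3, h1, map_add, map_smul, LinearMap.add_apply, LinearMap.smul_apply,
    shiftedForm_apply, shiftedForm_apply, h2, smul_eq_mul]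
  ring

variable {P} [CompleteSpace H]
variable {ev₀ evs : ℕ → ℝ}

/-- The vector `v + z` is orthogonal to `V_⋆` for the shifted form, which is nonpositive there.
Added to the `m` eigenvectors of `𝐁_⋆` below `lam`, it spans a space of dimension `m + 1` on which
`b₀ ≤ lam d₀`, so `lam` lies in the band with index `m`. -/
theorem mem_bands_of_betaForm_nonneg (hs : IsEigenvalueList P.Bstar (edim P.Vstar) evs)
    (h₀ : IsEigenvalueList P.B₀ (edim P.V₀) ev₀)
    (horth : ∀ z ∈ P.Z, ∀ v ∈ P.Vstar, (P.b 0).form z v = inner ℂ (P.emb v) (P.emb z))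
    {lam : ℝ} (hlam : (lam : ℂ) ∉ opSpectrum P.Bstar) {z : P.Z} (hz : z ≠ 0)
    (hβ : 0 ≤ P.betaForm lam z z) : lam ∈ P.bands ev₀ evs := by
  obtain ⟨v, hv, hort, hβv⟩ := P.exists_schur horth hlam z
  obtain ⟨m, e, r', -, -, hgt, hli, hneg, -, -, -⟩ :=
    P.compactForm_Vstar.exists_spectral_cut hs lam
  have hu : (P.shiftedForm lam (v + z) (v + z)).re ≤ 0 := by
    have := (Complex.nonneg_iff.1 hβ).1
    rw [hβv, Complex.neg_re] at this
    linarith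
  let u : P.V₀ := ⟨v + z, add_mem (P.Vstar_le hv) (P.Z_le z.2)⟩
  let e' : Fin m → P.V₀ := fun i => Submodule.inclusion P.Vstar_le (e i)
  have he' : Set.range e' = Submodule.inclusion P.Vstar_le '' Set.range e := Set.range_comp _ _
  have hli' : LinearIndependent ℂ (Fin.cons u e' : Fin (m + 1) → P.V₀) := by
    refine LinearIndependent.finCons
      (hli.map' _ (LinearMap.ker_eq_bot.2 (Submodule.inclusion_injective P.Vstar_le))) ?_
    intro hmem
    rw [he', ← Submodule.map_span] at hmem
    obtain ⟨y, -, hy⟩ := hmem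
    have h1 : (y : H) = v + z := congrArg Subtype.val hy
    have h2 : (z : H) ∈ P.Vstar ⊓ P.Z := by
      refine ⟨?_, z.2⟩
      rw [← sub_eq_iff_eq_add'.2 h1]
      exact sub_mem y.2 hv
    rw [P.inf_eq, Submodule.mem_bot] at h2
    exact hz (Subtype.ext h2)
  have hform : FormLeOn (P.emb.toLinearMap ∘ₗ P.V₀.subtype) ((P.b 0).restrict P.V₀).form
      (m + 1) lam := by
    refine ⟨_, hli', fun w hw => ?_⟩
    rw [Fin.range_cons, Submodule.mem_span_insert, he', ← Submodule.map_span] at hw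
    obtain ⟨c, _, ⟨y, hy, rfl⟩, rfl⟩ := hw
    have h1 : (P.shiftedForm lam (c • (v + z) + y) (c • (v + z) + y)).re ≤ 0 := by
      rw [shiftedForm_add_self]
      · have h2 := hneg y hy
        change ((P.b 0).form y y).re ≤ lam * ‖P.emb y‖ ^ 2 at h2
        rw [P.shiftedForm_self_re lam y, LinearMap.map_smulₛₗ (P.shiftedForm lam _),
          map_smul (P.shiftedForm lam), LinearMap.smul_apply, smul_eq_mul, smul_eq_mul,
          ← mul_assoc, Complex.conj_mul', ← Complex.ofReal_pow, Complex.re_ofReal_mul]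
        nlinarith [mul_nonneg (sq_nonneg ‖c‖) (neg_nonneg.2 hu)]
      · rw [map_smul, LinearMap.smul_apply, hort y y.2, smul_zero]
    rw [shiftedForm_self_re] at h1
    exact sub_nonpos.1 h1
  have hm : (m : ℕ∞) < edim P.V₀ :=
    lt_of_lt_of_le (by exact_mod_cast Nat.lt_succ_self m) hform.le_edim
  exact ⟨m, hm, (P.compactForm_V₀.list_le_iff h₀ hm).2 hform, fun h => (hgt h).le⟩

/-- For `lam` in band `k` but off the spectrum of `𝐁_⋆`, at most `k` eigenvalues of `𝐁_⋆` lie below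
`lam`, while the shifted form is nonpositive on a space of dimension `k + 1` in `V₀`. A vector there
orthogonal to those eigenvectors yields the required `z`. -/
theorem exists_betaForm_nonneg (hs : IsEigenvalueList P.Bstar (edim P.Vstar) evs)
    (h₀ : IsEigenvalueList P.B₀ (edim P.V₀) ev₀)
    (horth : ∀ z ∈ P.Z, ∀ v ∈ P.Vstar, (P.b 0).form z v = inner ℂ (P.emb v) (P.emb z))
    {lam : ℝ} (hlam : (lam : ℂ) ∉ opSpectrum P.Bstar) (hmem : lam ∈ P.bands ev₀ evs) :
    ∃ z : P.Z, z ≠ 0 ∧ 0 ≤ P.betaForm lam z z := by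
  obtain ⟨k, hk, hk₀, hks⟩ := hmem
  obtain ⟨m, e, r', hm, hle, -, -, -, heig, hr', hpos⟩ :=
    P.compactForm_Vstar.exists_spectral_cut hs lam
  have hne : ∀ i : ℕ, (i : ℕ∞) < edim P.Vstar → evs i ≠ lam := by
    intro i hi heq
    refine hlam ?_
    rw [Bstar]
    exact (P.compactForm_Vstar.opSpectrum_eq_of_list hs) ▸ ⟨lam, ⟨i, hi, heq⟩, rfl⟩
  have hmk : m ≤ k := by
    by_contra hc
    push Not at hc
    have h1 : (k : ℕ∞) < edim P.Vstar := lt_of_lt_of_le (by exact_mod_cast hc) hm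
    exact hne k h1 (le_antisymm (hle k hc) (hks h1))
  -- vectors of `V_⋆` orthogonal to the negative directions
  have hVpos : ∀ v : P.Vstar, (∀ i, P.shiftedForm lam v (e i) = 0) →
      (r' - lam) * ‖P.emb v‖ ^ 2 ≤ (P.shiftedForm lam v v).re := by
    -- As no eigenvalue equals `lam`, orthogonality for the shifted form is the same as
    -- `d₀`-orthogonality to each `e i`.
    intro v hv
    have h1 := hpos v fun i => by
      have h2 : (P.b 0).form v (e i) = evs i * ⟪P.emb (e i), P.emb v⟫_ℂ := by
        rw [← NonnegForm.conj_symm]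
        have h3 : (P.b 0).form (e i) v = evs i * ⟪P.emb v, P.emb (e i)⟫_ℂ := heig i v
        rw [h3, map_mul, Complex.conj_ofReal, inner_conj_symm]
      have h4 := hv i
      rw [shiftedForm_apply, h2, ← sub_mul, mul_eq_zero, sub_eq_zero, Complex.ofReal_inj] at h4
      exact h4.resolve_left (hne i (lt_of_lt_of_le (by exact_mod_cast i.2) hm))
    change r' * ‖P.emb v‖ ^ 2 ≤ ((P.b 0).form v v).re at h1
    rw [shiftedForm_self_re]
    linarith
  obtain ⟨u, hu, hform⟩ := (P.compactForm_V₀.list_le_iff h₀ hk).1 hk₀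
  obtain ⟨w, hw, hw0, hl⟩ := hu.exists_mem_span_apply_eq_zero (Nat.lt_succ_of_le hmk)
    fun i => (P.shiftedForm lam).flip (e i) ∘ₗ P.V₀.subtype
  have hwneg : (P.shiftedForm lam w w).re ≤ 0 := by
    rw [shiftedForm_self_re]
    exact sub_nonpos.2 (hform w hw)
  have hwe : ∀ i, P.shiftedForm lam (w : H) (e i) = 0 := hl
  obtain ⟨⟨v, z⟩, rfl⟩ := P.sumEquiv.surjective w
  rw [coe_sumEquiv] at hwneg hwe
  refine ⟨z, ?_, ?_⟩
  · rintro rfl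
    simp only [ZeroMemClass.coe_zero, add_zero] at hwneg hwe
    have h1 := hVpos v hwe
    have h2 : ‖P.emb v‖ = 0 := by
      by_contra h0
      have : 0 < ‖P.emb v‖ ^ 2 := by positivity
      nlinarith
    have h3 : (v : H) = 0 := P.emb_injective (by rw [norm_eq_zero.1 h2, map_zero])
    refine hw0 ?_
    rw [show v = 0 from Subtype.ext h3]
    exact map_zero P.sumEquiv
  · obtain ⟨v₁, hv₁, hort, hβ⟩ := P.exists_schur horth hlam z
    -- The two summands are orthogonal for the shifted form, and the second, in `V_⋆`, has a
    -- non-negative value; hence the first has a nonpositive one.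
    have e1 : (v : H) + z = (v₁ + z) + ((v - ⟨v₁, hv₁⟩ : P.Vstar) : H) := by
      rw [Submodule.coe_sub]
      abel
    have h1 := hVpos (v - ⟨v₁, hv₁⟩) fun i => by
      have := hwe i
      rw [e1, map_add, LinearMap.add_apply, hort _ (e i).2, zero_add] at this
      exact this
    rw [e1, shiftedForm_add_self (hort _ (v - ⟨v₁, hv₁⟩ : P.Vstar).2)] at hwneg
    have h2 : 0 ≤ (r' - lam) * ‖P.emb ((v - ⟨v₁, hv₁⟩ : P.Vstar) : H)‖ ^ 2 :=
      mul_nonneg (sub_pos.2 hr').le (by positivity)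
    rw [hβ, Complex.nonneg_iff, Complex.neg_re, Complex.neg_im, shiftedForm_self_im, neg_zero]
    exact ⟨by linarith, rfl⟩

end DegenerateProblem

end

theorem mainTheorem5 {n : ℕ} (hn : 1 ≤ n) {H 𝓗 : Type*}
    [NormedAddCommGroup H] [InnerProductSpace ℂ H] [CompleteSpace H]
    [TopologicalSpace.SeparableSpace H]
    [NormedAddCommGroup 𝓗] [InnerProductSpace ℂ 𝓗] [CompleteSpace 𝓗]
    [TopologicalSpace.SeparableSpace 𝓗]
    (P : DegenerateProblem n H 𝓗) :
    -- the eigenvalues can be listed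
    (∃ ev₀ : ℕ → ℝ, IsEigenvalueList P.B₀ (edim P.V₀) ev₀) ∧
    (∃ evs : ℕ → ℝ, IsEigenvalueList P.Bstar (edim P.Vstar) evs) ∧
    -- the band representation
    (∀ ev₀ evs : ℕ → ℝ, IsEigenvalueList P.B₀ (edim P.V₀) ev₀ →
      IsEigenvalueList P.Bstar (edim P.Vstar) evs →
      IsEigenvalueList (P.limitOp 0) (edim P.V₀) ev₀ ∧
      (∀ k : ℕ, (k : ℕ∞) < edim P.Vstar → ev₀ k ≤ evs k) ∧
      (P.Z ≠ ⊥ →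
        (edim P.Vstar = ⊤ →
          P.limitSpectrum = Complex.ofReal '' ⋃ k : ℕ, Set.Icc (ev₀ k) (evs k)) ∧
        (∀ N : ℕ, edim P.Vstar = N →
          P.limitSpectrum = Complex.ofReal ''
            ((⋃ k ∈ Set.Iio N, Set.Icc (ev₀ k) (evs k)) ∪ Set.Ici (ev₀ N))))) ∧
    -- the representation through the β-function
    ((∀ z ∈ P.Z, ∀ v ∈ P.Vstar, (P.b 0).form z v = inner ℂ (P.emb v) (P.emb z)) →
      P.limitSpectrum =
        Complex.ofReal '' {lam : ℝ | (lam : ℂ) ∉ opSpectrum P.Bstar ∧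
          ∃ z : P.Z, z ≠ 0 ∧ 0 ≤ P.betaForm lam z z} ∪ opSpectrum P.Bstar) := by
  obtain ⟨ev₀, h₀⟩ := P.compactForm_V₀.exists_isEigenvalueList
  obtain ⟨evs, hs⟩ := P.compactForm_Vstar.exists_isEigenvalueList
  refine ⟨⟨ev₀, h₀⟩, ⟨evs, hs⟩, fun ev₀ evs h₀ hs => ⟨P.isEigenvalueList_limitOp_zero h₀,
    fun k hk => DegenerateProblem.ev₀_le_evs h₀ hs hk, fun hZ => ⟨fun htop => ?_, fun N hN => ?_⟩⟩,
    fun horth => ?_⟩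
  · rw [DegenerateProblem.limitSpectrum_eq_bands hn h₀ hs,
      DegenerateProblem.bands_of_edim_eq_top htop]
  · rw [DegenerateProblem.limitSpectrum_eq_bands hn h₀ hs,
      DegenerateProblem.bands_of_edim_eq h₀ hZ hN]
  · have hspec : opSpectrum P.Bstar =
        Complex.ofReal '' {r | ∃ k : ℕ, (k : ℕ∞) < edim P.Vstar ∧ evs k = r} :=
      P.compactForm_Vstar.opSpectrum_eq_of_list hs
    rw [DegenerateProblem.limitSpectrum_eq_bands hn h₀ hs]
    refine Set.Subset.antisymm ?_ (Set.union_subset ?_ ?_)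
    · rintro _ ⟨lam, hlam, rfl⟩
      by_cases h : (lam : ℂ) ∈ opSpectrum P.Bstar
      · exact Or.inr h
      · exact Or.inl ⟨lam, ⟨h, DegenerateProblem.exists_betaForm_nonneg hs h₀ horth h hlam⟩, rfl⟩
    · rintro _ ⟨lam, ⟨h, z, hz, hβ⟩, rfl⟩
      exact ⟨lam, DegenerateProblem.mem_bands_of_betaForm_nonneg hs h₀ horth h hz hβ, rfl⟩
    -- Each eigenvalue of `𝐁_⋆` is the upper end of its own band.
    · rw [hspec]
      rintro _ ⟨_, ⟨k, hk, rfl⟩, rfl⟩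
      exact ⟨evs k, ⟨k, lt_of_lt_of_le hk (edim_mono P.Vstar_le),
        DegenerateProblem.ev₀_le_evs h₀ hs hk, fun _ => le_rfl⟩, rfl⟩
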